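/- Let $X$ be a compact Kähler manifold of dimension $n$ with Kähler form $\omega$. A Higgs sheaf on $X$ is a pair $\mathfrak E=(E,\phi)$ of a coherent sheaf $E$ of $\mathcal O_X$-modules and a morphism $\phi:E\to E\otimes\Omega^1_X$ with $\phi\wedge\phi=0$ in $\mathrm{Hom}(E,E\otimes\Omega^2_X)$; it is torsion-free if $E$ is. The tensor product and the direct sum of Higgs sheaves are $$\mathfrak E_1\otimes\mathfrak E_2=(E_1\otimes E_2,\ \phi_1\otimes 1+1\otimes\phi_2),\qquad \mathfrak E_1\oplus\mathfrak E_2=(E_1\oplus E_2,\ \phi_1\oplus\phi_2).$$ The singularity set $S(E)$ is the set of points near which $E$ is not locally free. An *admissible structure* on $\mathfrak E$ is a smooth Hermitian metric $h$ on $E|_U$, where $U\subset X$ is an open set such that $X\setminus U$ is a complex analytic subset of codimension at least two containing $S(E)$, such that 1. the curvature $R_h$ of the Chern connection of $h$ is square-integrable: $\int_U|R_h|^2\,\omega^n<\infty$; 2. the mean curvature $K_h=i\Lambda R_h$ is integrable: $\int_U|K_h|\,\omega^n<\infty$. **Proposition.** Let $\mathfrak E_1,\mathfrak E_2$ be torsion-free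 Higgs sheaves on $X$, and let $h_1,h_2$ be admissible structures on them, defined over $U_1$ and $U_2$ respectively. Then: - $\mathfrak E_1\otimes\mathfrak E_2$ is a Higgs sheaf; there is exactly one Hermitian metric $h_1\otimes h_2$ on $(E_1\otimes E_2)|_{U_1\cap U_2}$ with $(h_1\otimes h_2)(s_1\otimes s_2,t_1\otimes t_2)=h_1(s_1,t_1)\,h_2(s_2,t_2)$ for all local sections $s_i,t_i$ of $E_i$; and it is an admissible structure on $\mathfrak E_1\otimes\mathfrak E_2$. - $\mathfrak E_1\oplus\mathfrak E_2$ is a Higgs sheaf; there is exactly one Hermitian metric $h_1\oplus h_2$ on $(E_1\oplus E_2)|_{U_1\cap U_2}$ with $(h_1\oplus h_2)((s_1,s_2),(t_1,t_2))=h_1(s_1,t_1)+h_2(s_2,t_2)$ for all local sections $s_i,t_i$ of $E_i$; and it is an admissible structure on $\mathfrak E_1\oplus\mathfrak E_2$. In particular both metrics are defined off an analytic subset of codimension at least two, which contains the singularity sets of the tensor product and of the direct sum. -/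

import Mathlib

namespace TensorRelations

open scoped TensorProduct

theorem exists_relation_of_rTensor_eq_zero {R A B M : Type*} [CommRing R] [AddCommGroup A]
    [AddCommGroup B] [AddCommGroup M] [Module R A] [Module R B] [Module R M] (f : A →ₗ[R] B)
    (x : A ⊗[R] M) (hx : f.rTensor M x = 0) :
    ∃ (ι κ : Type) (_ : Fintype ι) (_ : Fintype κ) (a : ι → A) (m : ι → M) (c : ι → κ → R)
      (y : κ → B), x = ∑ i, a i ⊗ₜ m i ∧ (∀ i, f (a i) = ∑ j, c i j • y j) ∧
        ∀ j, ∑ i, c i j • m i = 0 := by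
  obtain ⟨k, a, m, rfl⟩ := TensorProduct.exists_sum_tmul_eq x
  let N : Submodule R M := Submodule.span R (Set.range m)
  have hN : N.FG := Submodule.fg_span (Set.finite_range m)
  let m' : Fin k → N := fun i => ⟨m i, Submodule.subset_span ⟨i, rfl⟩⟩
  obtain ⟨N', hN', hle, h0⟩ := hN.exists_rTensor_fg_inclusion_eq
    (x := ∑ i, m' i ⊗ₜ[R] f (a i)) (y := 0) (by
      rw [map_zero]
      have := congrArg (TensorProduct.comm R B M) hx
      simpa [m'] using this)
  obtain ⟨l, g, hg⟩ := Submodule.fg_iff_exists_fin_generating_family.1 hN'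
  have hgm : ∀ i, g i ∈ N' := fun i => hg ▸ Submodule.subset_span ⟨i, rfl⟩
  let n : Fin k ⊕ Fin l → N' :=
    Sum.elim (fun i => ⟨m i, hle (m' i).2⟩) (fun i => ⟨g i, hgm i⟩)
  let b : Fin k ⊕ Fin l → A := Sum.elim a 0
  have hspan : Submodule.span R (Set.range n) = ⊤ := by
    rw [eq_top_iff]
    have h1 : Submodule.map N'.subtype ⊤ ≤ Submodule.map N'.subtype (Submodule.span R (Set.range n)) := by
      rw [Submodule.map_span, Submodule.map_top, Submodule.range_subtype]
      refine hg.ge.trans (Submodule.span_le.2 ?_)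
      rintro _ ⟨i, rfl⟩
      exact Submodule.subset_span ⟨n (Sum.inr i), ⟨_, rfl⟩, rfl⟩
    exact (Submodule.map_le_map_iff_of_injective N'.injective_subtype _ _).1 h1
  have h2 : ∑ i, n i ⊗ₜ[R] f (b i) = 0 := by
    rw [map_zero] at h0
    rw [Fintype.sum_sum_type]
    simp only [n, b, Sum.elim_inl, Sum.elim_inr, Pi.zero_apply, map_zero, TensorProduct.tmul_zero,
      Finset.sum_const_zero, add_zero]
    rw [← h0, map_sum]
    rfl
  obtain ⟨κ, c, y, h3, h4⟩ := TensorProduct.vanishesTrivially_of_sum_tmul_eq_zero R hspan h2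
  refine ⟨Fin k ⊕ Fin l, Fin κ, inferInstance, inferInstance, b, fun i => n i, c, y, ?_, h3, ?_⟩
  · rw [Fintype.sum_sum_type]; simp [n, b]
  · intro j
    have := congrArg N'.subtype (h4 j)
    simpa using this

theorem tensor_restrict_eq_zero {R A M S A' M' : Type*} [CommRing R] [AddCommGroup A]
    [AddCommGroup M] [Module R A] [Module R M] [CommRing S] [AddCommGroup A'] [AddCommGroup M']
    [Module S A'] [Module S M'] (ρ : R →+* S) (resA : A → A') (resM : M →+ M')
    (hM : ∀ r m, resM (r • m) = ρ r • resM m) (T : A ⊗[R] M →+ A' ⊗[S] M')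
    (hT : ∀ a m, T (a ⊗ₜ m) = resA a ⊗ₜ resM m) {ι κ : Type*} [Fintype ι] [Fintype κ]
    (a : ι → A) (m : ι → M) (c : ι → κ → R) (β : κ → A')
    (ha : ∀ i, resA (a i) = ∑ j, ρ (c i j) • β j) (h0 : ∀ j, ∑ i, c i j • m i = 0) :
    T (∑ i, a i ⊗ₜ m i) = 0 := by
  simp_rw [map_sum, hT, ha, TensorProduct.sum_tmul, TensorProduct.smul_tmul]
  rw [Finset.sum_comm]
  refine Finset.sum_eq_zero fun j _ => ?_
  rw [← TensorProduct.tmul_sum]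
  simp_rw [← hM]
  rw [← map_sum, h0, map_zero, TensorProduct.tmul_zero]

end TensorRelations

namespace PresheafOfModules

open CategoryTheory MonoidalCategory Opposite TensorRelations
open scoped TensorProduct

universe u

variable {C : Type u} [SmallCategory C] {J : GrothendieckTopology C} {R : Cᵒᵖ ⥤ CommRingCat.{u}}
  {A B : PresheafOfModules.{u} (R ⋙ forget₂ CommRingCat RingCat)} (f : A ⟶ B)
  (M : PresheafOfModules.{u} (R ⋙ forget₂ CommRingCat RingCat))

theorem isLocallySurjective_whiskerRight [IsLocallySurjective J f] :
    IsLocallySurjective J (f ▷ M) where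
  imageSieve_mem {U} s := by
    change B.obj (op U) ⊗[R.obj (op U)] M.obj (op U) at s
    induction s using TensorProduct.induction_on with
    | zero =>
      refine J.superset_covering ?_ (J.top_mem _)
      intro V i _
      refine ⟨(0 : A.obj (op V) ⊗[R.obj (op V)] M.obj (op V)), ?_⟩
      refine (map_zero ((f ▷ M).app (op V)).hom).trans (map_zero ((B ⊗ M).map i.op).hom).symm
    | tmul b m =>
      refine J.superset_covering ?_
        (Presheaf.imageSieve_mem J ((PresheafOfModules.toPresheaf _).map f) (U := op U) b)
      rintro V i ⟨a, ha⟩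
      refine ⟨a ⊗ₜ[R.obj (op V)] M.map i.op m, ?_⟩
      change f.app (op V) a = B.map i.op b at ha
      change f.app (op V) a ⊗ₜ[R.obj (op V)] M.map i.op m = B.map i.op b ⊗ₜ[R.obj (op V)] M.map i.op m
      rw [ha]
      rfl
    | add x y hx hy =>
      refine J.superset_covering ?_ (J.intersection_covering hx hy)
      rintro V i ⟨⟨a, ha⟩, ⟨b, hb⟩⟩
      refine ⟨a + b, ?_⟩
      refine (map_add ((f ▷ M).app (op V)).hom a b).trans ?_
      refine Eq.trans ?_ (map_add ((B ⊗ M).map i.op).hom x y).symm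
      exact congrArg₂ (· + ·) ha hb


theorem finset_inf_mem {X : C} {ι : Type*} (s : Finset ι) (S : ι → Sieve X)
    (hS : ∀ i, S i ∈ J X) : s.inf S ∈ J X := by
  classical
  induction s using Finset.induction_on with
  | empty => exact J.top_mem X
  | insert i s _ ih => rw [Finset.inf_insert]; exact J.intersection_covering (hS i) ih

theorem isLocallyInjective_whiskerRight [IsLocallyInjective J f] [IsLocallySurjective J f] :
    IsLocallyInjective J (f ▷ M) where
  equalizerSieve_mem {U} s t hst := by
    obtain ⟨U⟩ := U
    change A.obj (op U) ⊗[R.obj (op U)] M.obj (op U) at s t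
    change (f.app (op U)).hom.rTensor (M.obj (op U)) s =
      (f.app (op U)).hom.rTensor (M.obj (op U)) t at hst
    obtain ⟨ι, κ, _, _, a, m, c, y, hx, h1, h2⟩ :=
      exists_relation_of_rTensor_eq_zero (R := R.obj (op U)) (A := A.obj (op U))
        (B := B.obj (op U)) (M := M.obj (op U)) (f.app (op U)).hom (s - t)
        (by rw [map_sub, hst, sub_self])
    refine J.transitive (finset_inf_mem (J := J) Finset.univ (fun j : κ =>
      Presheaf.imageSieve ((PresheafOfModules.toPresheaf _).map f) (U := U) (y j))
      (fun j => Presheaf.imageSieve_mem J ((PresheafOfModules.toPresheaf _).map f)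
        (U := op U) (y j))) _ ?_
    intro V p hp
    have hp' : ∀ j, ∃ α : A.obj (op V), f.app (op V) α = B.map p.op (y j) := fun j =>
      (Finset.inf_le (f := fun j : κ => Presheaf.imageSieve
        ((PresheafOfModules.toPresheaf _).map f) (U := U) (y j)) (Finset.mem_univ j)) _ hp
    choose α hα using hp'
    let cV : ι → κ → R.obj (op V) := fun i j => R.map p.op (c i j)
    let u : ι → A.obj (op V) := fun i => A.map p.op (a i)
    let v : ι → A.obj (op V) := fun i => ∑ j, cV i j • α j
    have huv : ∀ i, (f.app (op V)).hom (u i) = (f.app (op V)).hom (v i) := by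
      intro i
      have e1 : (f.app (op V)).hom (u i) = B.map p.op (f.app (op U) (a i)) :=
        (naturality_apply f p.op (a i))
      have e2 : (f.app (op U)) (a i) = ∑ j, c i j • y j := h1 i
      have e3 : B.map p.op (∑ j, c i j • y j) = ∑ j, cV i j • B.map p.op (y j) := by
        refine (map_sum (B.map p.op).hom _ _).trans (Finset.sum_congr rfl fun j _ => ?_)
        exact B.map_smul p.op (c i j) (y j)
      rw [e1, e2, e3, map_sum]
      refine Finset.sum_congr rfl fun j _ => ?_
      rw [← hα j]
      exact ((f.app (op V)).hom.map_smul (cV i j) (α j)).symm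
    refine J.superset_covering ?_ (finset_inf_mem (J := J) Finset.univ
      (fun i : ι => Presheaf.equalizerSieve (F := (toPresheaf _).obj A) (X := op V) (u i) (v i))
      (fun i => Presheaf.equalizerSieve_mem J ((PresheafOfModules.toPresheaf _).map f)
        (X := op V) (u i) (v i) (huv i)))
    intro W q hq
    have hq' : ∀ i, A.map q.op (u i) = A.map q.op (v i) := fun i =>
      (Finset.inf_le (f := fun i : ι => Presheaf.equalizerSieve (F := (toPresheaf _).obj A)
        (X := op V) (u i) (v i)) (Finset.mem_univ i)) _ hq
    have key := tensor_restrict_eq_zero (R := R.obj (op U)) (A := A.obj (op U))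
      (M := M.obj (op U)) (S := R.obj (op W)) (A' := A.obj (op W)) (M' := M.obj (op W))
      (R.map (q ≫ p).op).hom (fun z => A.map (q ≫ p).op z)
      (M.map (q ≫ p).op).hom.toAddMonoidHom (fun r z => M.map_smul (q ≫ p).op r z)
      ((A ⊗ M).map (q ≫ p).op).hom.toAddMonoidHom (fun _ _ => rfl) a m c
      (fun j => A.map q.op (α j)) ?_ h2
    · rw [← hx] at key
      change ((A ⊗ M).map (q ≫ p).op).hom s = ((A ⊗ M).map (q ≫ p).op).hom t
      exact sub_eq_zero.1 ((map_sub ((A ⊗ M).map (q ≫ p).op).hom s t).symm.trans key)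
    · intro i
      have e1 : A.map (q ≫ p).op (a i) = A.map q.op (u i) := by
        simp only [u, op_comp, A.map_comp]
        rfl
      refine (e1.trans (hq' i)).trans ?_
      refine (map_sum (A.map q.op).hom _ _).trans (Finset.sum_congr rfl fun j _ => ?_)
      refine (A.map_smul q.op (cV i j) (α j)).trans ?_
      have : R.map q.op (cV i j) = R.map (q ≫ p).op (c i j) := by simp [cV]
      exact congrArg (fun r : R.obj (op W) => r • (A.map q.op (α j) : A.obj (op W))) this

end PresheafOfModules


namespace SheafOfModules

open CategoryTheory MonoidalCategory Opposite TensorRelations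
open scoped TensorProduct
open PresheafOfModules

universe u

variable {C : Type u} [SmallCategory C] {J : GrothendieckTopology C}

/-- A sheaf of commutative rings, viewed as a sheaf of rings. -/
abbrev ofComm (O : Sheaf J CommRingCat.{u}) : Sheaf J RingCat.{u} :=
  ⟨O.obj ⋙ forget₂ CommRingCat RingCat,
    ((sheafCompose J (forget₂ CommRingCat RingCat)).obj O).property⟩

variable {O : Sheaf J CommRingCat.{u}} [J.WEqualsLocallyBijective AddCommGrpCat.{u}]
  [HasSheafify J AddCommGrpCat.{u}]

/-- The presheaf of modules underlying a sheaf of modules over a sheaf of commutative rings. -/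
abbrev psh (E : SheafOfModules.{u} (ofComm O)) :
    PresheafOfModules.{u} (O.obj ⋙ forget₂ CommRingCat RingCat) := E.val

/-- The presheaf of modules map underlying a morphism of sheaves of modules. -/
abbrev pshMap {E F : SheafOfModules.{u} (ofComm O)} (f : E ⟶ F) : psh E ⟶ psh F := f.val

/-- Sheafification of presheaves of modules over a sheaf of commutative rings. -/
noncomputable abbrev shf (O : Sheaf J CommRingCat.{u}) :
    PresheafOfModules.{u} (O.obj ⋙ forget₂ CommRingCat RingCat) ⥤ SheafOfModules.{u} (ofComm O) :=
  PresheafOfModules.sheafification (R₀ := O.obj ⋙ forget₂ CommRingCat RingCat)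
    (R := ofComm O) (𝟙 _)

/-- The canonical map from a presheaf of modules to its sheafification. -/
noncomputable def toShf (P : PresheafOfModules.{u} (O.obj ⋙ forget₂ CommRingCat RingCat)) :
    P ⟶ psh ((shf O).obj P) :=
  PresheafOfModules.homMk (CategoryTheory.toSheafify J P.presheaf) fun X r m =>
    ((PresheafOfModules.toSheafify (𝟙 (ofComm O).obj)
      (CategoryTheory.toSheafify J P.presheaf)).app X).hom.map_smul r m

instance (P : PresheafOfModules.{u} (O.obj ⋙ forget₂ CommRingCat RingCat)) :
    PresheafOfModules.IsLocallyInjective J (toShf P) :=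
  inferInstanceAs (Presheaf.IsLocallyInjective J (CategoryTheory.toSheafify J P.presheaf))

instance (P : PresheafOfModules.{u} (O.obj ⋙ forget₂ CommRingCat RingCat)) :
    PresheafOfModules.IsLocallySurjective J (toShf P) :=
  inferInstanceAs (Presheaf.IsLocallySurjective J (CategoryTheory.toSheafify J P.presheaf))

/-- The morphism out of a sheafification induced by a morphism of presheaves of modules. -/
noncomputable def shfLift {P : PresheafOfModules.{u} (O.obj ⋙ forget₂ CommRingCat RingCat)}
    {F : SheafOfModules.{u} (ofComm O)} (g : P ⟶ F.val) : (shf O).obj P ⟶ F :=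
  ⟨(PresheafOfModules.homEquivOfIsLocallyBijective (f := toShf P) F.isSheaf).symm g⟩

theorem toShf_shfLift {P : PresheafOfModules.{u} (O.obj ⋙ forget₂ CommRingCat RingCat)}
    {F : SheafOfModules.{u} (ofComm O)} (g : P ⟶ F.val) : toShf P ≫ (shfLift g).val = g :=
  (PresheafOfModules.homEquivOfIsLocallyBijective (f := toShf P) F.isSheaf).apply_symm_apply g

theorem isIso_shf_map {P Q : PresheafOfModules.{u} (O.obj ⋙ forget₂ CommRingCat RingCat)}
    (f : P ⟶ Q) [PresheafOfModules.IsLocallyInjective J f]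
    [PresheafOfModules.IsLocallySurjective J f] : IsIso ((shf O).map f) := by
  have h : (J.W.inverseImage (PresheafOfModules.toPresheaf _)) f :=
    J.W_of_isLocallyBijective ((PresheafOfModules.toPresheaf _).map f)
  rw [PresheafOfModules.inverseImage_W_toPresheaf_eq_inverseImage_isomorphisms
    (R₀ := O.obj ⋙ forget₂ CommRingCat RingCat) (R := ofComm O) (𝟙 _)] at h
  exact h

theorem isIso_shf_map_whiskerRight
    (P Q : PresheafOfModules.{u} (O.obj ⋙ forget₂ CommRingCat RingCat)) :
    IsIso ((shf O).map (toShf P ▷ Q)) :=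
  haveI := isLocallyInjective_whiskerRight (J := J) (toShf P) Q
  haveI := isLocallySurjective_whiskerRight (J := J) (toShf P) Q
  isIso_shf_map _

/-- Sheafifying `P` does not change the sheaf associated with `P ⊗ Q`. -/
noncomputable def shfTensorRight
    (P Q : PresheafOfModules.{u} (O.obj ⋙ forget₂ CommRingCat RingCat)) :
    (shf O).obj (P ⊗ Q) ≅ (shf O).obj (psh ((shf O).obj P) ⊗ Q) :=
  haveI := isIso_shf_map_whiskerRight P Q
  asIso ((shf O).map (toShf P ▷ Q))

/-- Sheafifying `Q` does not change the sheaf associated with `P ⊗ Q`. -/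
noncomputable def shfTensorLeft
    (P Q : PresheafOfModules.{u} (O.obj ⋙ forget₂ CommRingCat RingCat)) :
    (shf O).obj (P ⊗ Q) ≅ (shf O).obj (P ⊗ psh ((shf O).obj Q)) :=
  (shf O).mapIso (β_ P Q) ≪≫ shfTensorRight Q P ≪≫ (shf O).mapIso (β_ _ P)

/-- The tensor product of sheaves of modules: the sheaf associated with the presheaf
`U ↦ E(U) ⊗ F(U)`. -/
noncomputable def tensor (E F : SheafOfModules.{u} (ofComm O)) : SheafOfModules.{u} (ofComm O) :=
  (shf O).obj (psh E ⊗ psh F)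

/-- The tensor product of two morphisms of sheaves of modules. -/
noncomputable def tensorMap {E E' F F' : SheafOfModules.{u} (ofComm O)} (f : E ⟶ E')
    (g : F ⟶ F') : tensor E F ⟶ tensor E' F' :=
  (shf O).map (pshMap f ⊗ₘ pshMap g)

/-- The section `s ⊗ t` of `E ⊗ F` defined by sections `s` of `E` and `t` of `F`. -/
noncomputable def tmul {E F : SheafOfModules.{u} (ofComm O)} {U : Cᵒᵖ} (s : E.val.obj U)
    (t : F.val.obj U) : (tensor E F).val.obj U :=
  (toShf (psh E ⊗ psh F)).app U
    (TensorProduct.tmul (O.obj.obj U) (s : (psh E).obj U) (t : (psh F).obj U))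

/-- The canonical isomorphism `(E ⊗ F) ⊗ G ≅ E ⊗ (F ⊗ G)`. -/
noncomputable def tensorAssoc (E F G : SheafOfModules.{u} (ofComm O)) :
    tensor (tensor E F) G ≅ tensor E (tensor F G) :=
  (shfTensorRight (psh E ⊗ psh F) (psh G)).symm ≪≫
    (shf O).mapIso (α_ (psh E) (psh F) (psh G)) ≪≫ shfTensorLeft (psh E) (psh F ⊗ psh G)

/-- The canonical isomorphism `E ⊗ F ≅ F ⊗ E`. -/
noncomputable def tensorComm (E F : SheafOfModules.{u} (ofComm O)) : tensor E F ≅ tensor F E :=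
  (shf O).mapIso (β_ (psh E) (psh F))

end SheafOfModules

namespace Higgs

open TopologicalSpace CategoryTheory CategoryTheory.Limits MonoidalCategory Opposite MeasureTheory
open scoped Manifold ContDiff ENNReal Matrix ComplexOrder

section Sheaves

variable (n : ℕ) (X : Type) [TopologicalSpace X] [ChartedSpace (Fin n → ℂ) X]

/-- The sheaf `𝒪_X` of holomorphic functions on a complex manifold `X` of dimension `n`
(complex-differentiable functions of class `C^∞` over `ℂ` are the holomorphic ones). -/
noncomputable abbrev hol : Sheaf (Opens.grothendieckTopology (TopCat.of X)) CommRingCat.{0} :=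
  smoothSheafCommRing 𝓘(ℂ, Fin n → ℂ) 𝓘(ℂ) X ℂ

/-- Sheaves of `𝒪_X`-modules. -/
abbrev AnalyticSheaf : Type 1 := SheafOfModules.{0} (SheafOfModules.ofComm (hol n X))

variable {n X}

/-- Holomorphic functions on an open set. -/
abbrev HolFun (n : ℕ) {X : Type} [TopologicalSpace X] [ChartedSpace (Fin n → ℂ) X]
    (V : Opens X) : Type := (SheafOfModules.ofComm (hol n X)).obj.obj (op V)

/-- The value of a holomorphic function at a point. -/
noncomputable def HolFun.eval {V : Opens X} (f : HolFun n V) (x : V) : ℂ :=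
  (show C^∞⟮𝓘(ℂ, Fin n → ℂ), V; 𝓘(ℂ), ℂ⟯ from f) x

/-- The restriction of a holomorphic function to a smaller open set. -/
noncomputable def HolFun.res {W V : Opens X} (h : W ≤ V) (f : HolFun n V) : HolFun n W :=
  ((SheafOfModules.ofComm (hol n X)).obj.map (homOfLE h).op).hom f

namespace AnalyticSheaf

/-- The module of sections of `E` over an open set. -/
abbrev Sec (E : AnalyticSheaf n X) (V : Opens X) : Type := E.val.obj (op V)

/-- The restriction of a section to a smaller open set. -/
noncomputable def res {E : AnalyticSheaf n X} {W V : Opens X} (h : W ≤ V) (s : E.Sec V) : E.Sec W :=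
  (E.val.map (homOfLE h).op).hom s

/-- `E` is coherent: every point has a neighbourhood `V` on which there is an exact sequence
`𝒪^q → 𝒪^p → E → 0`, the maps being given by generators `s` and relations `ρ`. -/
def IsCoherent (E : AnalyticSheaf n X) : Prop :=
  ∀ x : X, ∃ V : Opens X, x ∈ V ∧ ∃ (p q : ℕ) (s : Fin p → E.Sec V) (ρ : Fin q → Fin p → HolFun n V),
    (∀ j, ∑ i, ρ j i • s i = 0) ∧
    (∀ (W : Opens X) (hW : W ≤ V) (t : E.Sec W), ∀ y ∈ W, ∃ (W' : Opens X) (hW' : W' ≤ W),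
      y ∈ W' ∧ ∃ a : Fin p → HolFun n W', res hW' t = ∑ i, a i • res (hW'.trans hW) (s i)) ∧
    (∀ (W : Opens X) (hW : W ≤ V) (a : Fin p → HolFun n W), ∑ i, a i • res hW (s i) = 0 →
      ∀ y ∈ W, ∃ (W' : Opens X) (hW' : W' ≤ W), y ∈ W' ∧ ∃ b : Fin q → HolFun n W',
        ∀ i, (a i).res hW' = ∑ j, b j * (ρ j i).res (hW'.trans hW))

/-- `E` is torsion-free: no nonzero germ of a section of `E` is annihilated by a nonzero germ of a
holomorphic function (the local rings of `𝒪_X` are integral domains). -/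
def IsTorsionFree (E : AnalyticSheaf n X) : Prop :=
  ∀ (V : Opens X) (f : HolFun n V) (s : E.Sec V), f • s = 0 → ∀ x ∈ V,
    ∃ (W : Opens X) (hW : W ≤ V), x ∈ W ∧ (f.res hW = 0 ∨ res hW s = 0)

/-- A finite family of sections of `E` over `V` is a frame if it defines an isomorphism from the
free sheaf on it to `E|_V`. -/
def IsFrame {E : AnalyticSheaf n X} {V : Opens X} {ι : Type} [Fintype ι] (e : ι → E.Sec V) : Prop :=
  ∀ (W : Opens X) (hW : W ≤ V),
    Function.Bijective fun a : ι → HolFun n W => ∑ i, a i • res hW (e i)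

/-- The singularity set of `E`: the set of points near which `E` is not locally free. -/
def singularSet (E : AnalyticSheaf n X) : Set X :=
  {x | ¬ ∃ V : Opens X, x ∈ V ∧ ∃ (r : ℕ) (e : Fin r → E.Sec V), IsFrame e}

end AnalyticSheaf

end Sheaves

section Charts

variable {n : ℕ} {X : Type} [TopologicalSpace X] [ChartedSpace (Fin n → ℂ) X]

/-- A function on the open set `V`, read in the chart `c` (and extended by `0`). -/
noncomputable def inChart {V : Opens X} (c : OpenPartialHomeomorph X (Fin n → ℂ)) (f : V → ℂ) :
    (Fin n → ℂ) → ℂ :=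
  open scoped Classical in fun z => if h : c.symm z ∈ V then f ⟨c.symm z, h⟩ else 0

/-- The image at `c⁻¹(z)` of a vector `v ∈ ℂⁿ` under the differential of the inverse of the
chart `c`. -/
noncomputable def chartVec (c : OpenPartialHomeomorph X (Fin n → ℂ)) (z v : Fin n → ℂ) :
    TangentSpace 𝓘(ℂ, Fin n → ℂ) (c.symm z) :=
  mfderiv 𝓘(ℂ, Fin n → ℂ) 𝓘(ℂ, Fin n → ℂ) c.symm z v

end Charts

section Forms

variable (n : ℕ) (X : Type) [TopologicalSpace X] [ChartedSpace (Fin n → ℂ) X]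

/-- Alternating `p`-forms on the holomorphic tangent space at a point. -/
abbrev FormAt (p : ℕ) (x : X) : Type := TangentSpace 𝓘(ℂ, Fin n → ℂ) x [⋀^Fin p]→ₗ[ℂ] ℂ

variable {n X}

/-- The coefficients of a field of `p`-forms in a chart. -/
noncomputable def formCoeff {p : ℕ} {V : Opens X} (c : OpenPartialHomeomorph X (Fin n → ℂ))
    (w : ∀ x : V, FormAt n X p (x : X)) (v : Fin p → Fin n → ℂ) : (Fin n → ℂ) → ℂ :=
  open scoped Classical in fun z =>
    if h : c.symm z ∈ V then w ⟨c.symm z, h⟩ (fun i => chartVec c z (v i)) else 0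

/-- A field of `p`-forms is holomorphic if its coefficients in the charts are. -/
def IsHolForm {p : ℕ} {V : Opens X} (w : ∀ x : V, FormAt n X p (x : X)) : Prop :=
  ∀ x : V, ∀ c ∈ atlas (Fin n → ℂ) X, (x : X) ∈ c.source → ∀ v : Fin p → Fin n → ℂ,
    DifferentiableAt ℂ (formCoeff c w v) (c x)

theorem eventually_symm_mem {n : ℕ} {X : Type} [TopologicalSpace X]
    {c : OpenPartialHomeomorph X (Fin n → ℂ)} {x : X} (hx : x ∈ c.source)
    {V : Opens X} (hV : x ∈ V) : ∀ᶠ z in nhds (c x), c.symm z ∈ V := by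
  have h := c.continuousAt_symm (c.map_source hx)
  rw [ContinuousAt, c.left_inv hx] at h
  exact h (V.isOpen.mem_nhds hV)

/-- Holomorphy is a local condition. -/
def holFormPredicate (n : ℕ) (X : Type) [TopologicalSpace X] [ChartedSpace (Fin n → ℂ) X] (p : ℕ) :
    TopCat.LocalPredicate (X := TopCat.of X) (fun x : X => FormAt n X p x) where
  pred {V} w := IsHolForm (V := V) w
  res := by
    intro W V i w hw x c hc hx v
    have hi : W ≤ V := leOfHom i
    refine (hw ⟨x, hi x.2⟩ c hc hx v).congr_of_eventuallyEq ?_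
    filter_upwards [eventually_symm_mem hx x.2] with z hz
    have hz' : c.symm z ∈ V := hi hz
    simp only [formCoeff, hz, hz', dif_pos]
    rfl
  locality := by
    intro V w h x c hc hx v
    obtain ⟨W, hxW, i, hW⟩ := h x
    have hi : W ≤ V := leOfHom i
    refine (hW ⟨x, hxW⟩ c hc hx v).congr_of_eventuallyEq ?_
    filter_upwards [eventually_symm_mem hx hxW] with z hz
    have hz' : c.symm z ∈ V := hi hz
    simp only [formCoeff, hz, hz', dif_pos]
    rfl

variable [IsManifold 𝓘(ℂ, Fin n → ℂ) ∞ X]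

theorem differentiableAt_inChart {V : Opens X} (f : HolFun n V) {x : X} (hV : x ∈ V)
    {c : OpenPartialHomeomorph X (Fin n → ℂ)} (hc : c ∈ atlas (Fin n → ℂ) X) (hx : x ∈ c.source) :
    DifferentiableAt ℂ (inChart c f.eval) (c x) := by
  classical
  let F : X → ℂ := fun y => if h : y ∈ V then f.eval ⟨y, h⟩ else 0
  have hf : ContMDiff 𝓘(ℂ, Fin n → ℂ) 𝓘(ℂ) ∞ f.eval :=
    (show C^∞⟮𝓘(ℂ, Fin n → ℂ), V; 𝓘(ℂ), ℂ⟯ from f).contMDiff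
  have hF : ContMDiffAt 𝓘(ℂ, Fin n → ℂ) 𝓘(ℂ) ∞ F x := by
    have h1 : ContMDiffAt 𝓘(ℂ, Fin n → ℂ) 𝓘(ℂ) ∞ (fun y : V => F y) ⟨x, hV⟩ := by
      have : (fun y : V => F y) = f.eval := by
        funext y
        simp [F]
      rw [this]
      exact hf _
    exact contMDiffAt_subtype_iff.1 h1
  have hs : ContMDiffAt 𝓘(ℂ, Fin n → ℂ) 𝓘(ℂ, Fin n → ℂ) ∞ c.symm (c x) :=
    (contMDiffOn_symm_of_mem_maximalAtlas (IsManifold.subset_maximalAtlas hc)).contMDiffAt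
      (c.open_target.mem_nhds (c.map_source hx))
  have h2 : ContMDiffAt 𝓘(ℂ, Fin n → ℂ) 𝓘(ℂ) ∞ (F ∘ c.symm) (c x) := by
    refine ContMDiffAt.comp _ ?_ hs
    rw [c.left_inv hx]
    exact hF
  exact (contMDiffAt_iff_contDiffAt.1 h2).differentiableAt (by simp)

/-- The group of holomorphic `p`-forms on `V`. -/
def holForms (n : ℕ) {X : Type} [TopologicalSpace X] [ChartedSpace (Fin n → ℂ) X] (p : ℕ)
    (V : Opens X) : AddSubgroup (∀ x : V, FormAt n X p (x : X)) where
  carrier := {w | IsHolForm w}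
  add_mem' := by
    intro w₁ w₂ h₁ h₂ x c hc hx v
    have h : formCoeff c (w₁ + w₂) v = formCoeff c w₁ v + formCoeff c w₂ v := by
      funext z
      by_cases hz : c.symm z ∈ V <;> simp [formCoeff, hz]
    rw [h]
    exact (h₁ x c hc hx v).add (h₂ x c hc hx v)
  zero_mem' := by
    intro x c hc hx v
    have h : formCoeff c (0 : ∀ x : V, FormAt n X p (x : X)) v = 0 := by
      funext z
      simp [formCoeff]
    rw [h]
    exact differentiableAt_const _
  neg_mem' := by
    intro w h₁ x c hc hx v
    have h : formCoeff c (-w) v = -formCoeff c w v := by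
      funext z
      by_cases hz : c.symm z ∈ V <;> simp [formCoeff, hz]
    rw [h]
    exact (h₁ x c hc hx v).neg

/-- Pointwise multiplication of holomorphic forms by holomorphic functions. -/
noncomputable instance holForms.module (p : ℕ) (V : Opens X) :
    Module (HolFun n V) (holForms n p V) where
  smul f w := ⟨fun x => f.eval x • w.1 x, by
    intro x c hc hx v
    have h : formCoeff c (fun x => f.eval x • w.1 x) v =
        fun z => inChart c f.eval z * formCoeff c w.1 v z := by
      funext z
      by_cases hz : c.symm z ∈ V <;> simp [formCoeff, inChart, hz]
    rw [h]
    exact (differentiableAt_inChart f x.2 hc hx).mul (w.2 x c hc hx v)⟩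
  one_smul w := Subtype.ext (funext fun x => one_smul ℂ (w.1 x))
  mul_smul f g w := Subtype.ext (funext fun x => mul_smul (f.eval x) (g.eval x) (w.1 x))
  smul_zero f := Subtype.ext (funext fun x => smul_zero (f.eval x))
  smul_add f w₁ w₂ := Subtype.ext (funext fun x => smul_add (f.eval x) (w₁.1 x) (w₂.1 x))
  add_smul f g w := Subtype.ext (funext fun x => add_smul (f.eval x) (g.eval x) (w.1 x))
  zero_smul w := Subtype.ext (funext fun x => zero_smul ℂ (w.1 x))

/-- The presheaf of abelian groups of holomorphic `p`-forms. -/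
noncomputable def formsAb (n : ℕ) (X : Type) [TopologicalSpace X] [ChartedSpace (Fin n → ℂ) X]
    (p : ℕ) : (Opens (TopCat.of X))ᵒᵖ ⥤ AddCommGrpCat.{0} where
  obj V := AddCommGrpCat.of (holForms n p (X := X) V.unop)
  map i := AddCommGrpCat.ofHom
    { toFun := fun w => ⟨fun x => w.1 ⟨x, leOfHom i.unop x.2⟩,
        (holFormPredicate n X p).res i.unop w.1 w.2⟩
      map_zero' := rfl
      map_add' := fun _ _ => rfl }
  map_id _ := rfl
  map_comp _ _ := rfl

noncomputable instance (p : ℕ) (V : (Opens (TopCat.of X))ᵒᵖ) :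
    Module ((SheafOfModules.ofComm (hol n X)).obj.obj V) ((formsAb n X p).obj V) :=
  holForms.module p V.unop

theorem formsAb_isSheaf (n : ℕ) (X : Type) [TopologicalSpace X] [ChartedSpace (Fin n → ℂ) X]
    (p : ℕ) : CategoryTheory.Presheaf.IsSheaf (Opens.grothendieckTopology (TopCat.of X))
      (formsAb n X p) := by
  rw [CategoryTheory.Presheaf.isSheaf_iff_isSheaf_forget _ _
    (CategoryTheory.forget AddCommGrpCat)]
  exact (TopCat.subsheafToTypes (holFormPredicate n X p)).property

/-- The sheaf `Ω^p_X` of holomorphic `p`-forms on `X`. -/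
noncomputable def Omega (n : ℕ) (X : Type) [TopologicalSpace X] [ChartedSpace (Fin n → ℂ) X]
    [IsManifold 𝓘(ℂ, Fin n → ℂ) ∞ X] (p : ℕ) : AnalyticSheaf n X where
  val := PresheafOfModules.ofPresheaf (R := (SheafOfModules.ofComm (hol n X)).obj)
    (formsAb n X p) (fun _ _ _ _ _ => rfl)
  isSheaf := formsAb_isSheaf n X p

/-- The exterior product `(a ∧ b)(v, w) = a(v) b(w) - a(w) b(v)` of two `1`-forms at a point. -/
noncomputable def wedgeAt {x : X} (a b : FormAt n X 1 x) : FormAt n X 2 x where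
  toFun v := a (fun _ => v 0) * b (fun _ => v 1) - a (fun _ => v 1) * b (fun _ => v 0)
  map_update_add' := by
    intro _ v i y z
    have ha := (AlternatingMap.ofSubsingleton ℂ _ ℂ (0 : Fin 1)).symm a |>.map_add y z
    have hb := (AlternatingMap.ofSubsingleton ℂ _ ℂ (0 : Fin 1)).symm b |>.map_add y z
    simp only [AlternatingMap.ofSubsingleton_symm_apply_apply] at ha hb
    change a (fun _ => y + z) = a (fun _ => y) + a (fun _ => z) at ha
    change b (fun _ => y + z) = b (fun _ => y) + b (fun _ => z) at hb
    fin_cases i <;> simp [ha, hb] <;> ring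
  map_update_smul' := by
    intro _ v i t z
    have ha := (AlternatingMap.ofSubsingleton ℂ _ ℂ (0 : Fin 1)).symm a |>.map_smul t z
    have hb := (AlternatingMap.ofSubsingleton ℂ _ ℂ (0 : Fin 1)).symm b |>.map_smul t z
    simp only [AlternatingMap.ofSubsingleton_symm_apply_apply] at ha hb
    change a (fun _ => t • z) = t • a (fun _ => z) at ha
    change b (fun _ => t • z) = t • b (fun _ => z) at hb
    fin_cases i <;> simp [ha, hb] <;> ring
  map_eq_zero_of_eq' := by
    intro v i j hij hne
    have h : v 0 = v 1 := by
      fin_cases i <;> fin_cases j <;> first | exact absurd rfl hne | exact hij | exact hij.symm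
    simp [h]

/-- The exterior product of holomorphic `1`-forms. -/
noncomputable def wedgeForms {V : Opens X} (a b : holForms n 1 V) : holForms n 2 V :=
  ⟨fun x => wedgeAt (a.1 x) (b.1 x), by
    intro x c hc hx v
    have h : formCoeff c (fun x => wedgeAt (a.1 x) (b.1 x)) v =
        fun z => formCoeff c a.1 (fun _ => v 0) z * formCoeff c b.1 (fun _ => v 1) z -
          formCoeff c a.1 (fun _ => v 1) z * formCoeff c b.1 (fun _ => v 0) z := by
      funext z
      by_cases hz : c.symm z ∈ V <;> simp [formCoeff, hz, wedgeAt]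
    rw [h]
    exact ((a.2 x c hc hx _).mul (b.2 x c hc hx _)).sub ((a.2 x c hc hx _).mul (b.2 x c hc hx _))⟩

/-- The exterior product as a morphism of presheaves of modules `Ω¹ ⊗ Ω¹ → Ω²`. -/
noncomputable def wedgePsh (n : ℕ) (X : Type) [TopologicalSpace X] [ChartedSpace (Fin n → ℂ) X]
    [IsManifold 𝓘(ℂ, Fin n → ℂ) ∞ X] :
    SheafOfModules.psh (Omega n X 1) ⊗ SheafOfModules.psh (Omega n X 1) ⟶
      SheafOfModules.psh (Omega n X 2) where
  app V := ModuleCat.MonoidalCategory.tensorLift (R := (hol n X).obj.obj V)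
    (M₁ := (SheafOfModules.psh (Omega n X 1)).obj V)
    (M₂ := (SheafOfModules.psh (Omega n X 1)).obj V)
    (M₃ := (SheafOfModules.psh (Omega n X 2)).obj V)
    (fun a b => wedgeForms (V := V.unop) a b)
    (fun a a' b => Subtype.ext (funext fun x => AlternatingMap.ext fun v => by
      change (a.1 x + a'.1 x) (fun _ => v 0) * b.1 x (fun _ => v 1) -
          (a.1 x + a'.1 x) (fun _ => v 1) * b.1 x (fun _ => v 0) =
        (a.1 x (fun _ => v 0) * b.1 x (fun _ => v 1) - a.1 x (fun _ => v 1) * b.1 x (fun _ => v 0)) +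
        (a'.1 x (fun _ => v 0) * b.1 x (fun _ => v 1) - a'.1 x (fun _ => v 1) * b.1 x (fun _ => v 0))
      simp only [AlternatingMap.add_apply]
      ring))
    (fun f a b => Subtype.ext (funext fun x => AlternatingMap.ext fun v => by
      change (HolFun.eval f x • a.1 x) (fun _ => v 0) * b.1 x (fun _ => v 1) -
          (HolFun.eval f x • a.1 x) (fun _ => v 1) * b.1 x (fun _ => v 0) =
        HolFun.eval f x *
          (a.1 x (fun _ => v 0) * b.1 x (fun _ => v 1) - a.1 x (fun _ => v 1) * b.1 x (fun _ => v 0))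
      simp only [AlternatingMap.smul_apply, smul_eq_mul]
      ring))
    (fun a b b' => Subtype.ext (funext fun x => AlternatingMap.ext fun v => by
      change a.1 x (fun _ => v 0) * (b.1 x + b'.1 x) (fun _ => v 1) -
          a.1 x (fun _ => v 1) * (b.1 x + b'.1 x) (fun _ => v 0) =
        (a.1 x (fun _ => v 0) * b.1 x (fun _ => v 1) - a.1 x (fun _ => v 1) * b.1 x (fun _ => v 0)) +
        (a.1 x (fun _ => v 0) * b'.1 x (fun _ => v 1) - a.1 x (fun _ => v 1) * b'.1 x (fun _ => v 0))
      simp only [AlternatingMap.add_apply]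
      ring))
    (fun f a b => Subtype.ext (funext fun x => AlternatingMap.ext fun v => by
      change a.1 x (fun _ => v 0) * (HolFun.eval f x • b.1 x) (fun _ => v 1) -
          a.1 x (fun _ => v 1) * (HolFun.eval f x • b.1 x) (fun _ => v 0) =
        HolFun.eval f x *
          (a.1 x (fun _ => v 0) * b.1 x (fun _ => v 1) - a.1 x (fun _ => v 1) * b.1 x (fun _ => v 0))
      simp only [AlternatingMap.smul_apply, smul_eq_mul]
      ring))
  naturality {V W} i := by
    refine ModuleCat.MonoidalCategory.tensor_ext fun a b => ?_
    rfl

/-- The exterior product as a morphism of sheaves of modules `Ω¹ ⊗ Ω¹ → Ω²`. -/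
noncomputable def wedge (n : ℕ) (X : Type) [TopologicalSpace X] [ChartedSpace (Fin n → ℂ) X]
    [IsManifold 𝓘(ℂ, Fin n → ℂ) ∞ X] :
    SheafOfModules.tensor (Omega n X 1) (Omega n X 1) ⟶ Omega n X 2 :=
  SheafOfModules.shfLift (wedgePsh n X)

end Forms
section HiggsSheaves

/-- A sheaf of `𝒪_X`-modules `E` with a morphism `φ : E → E ⊗ Ω¹_X`. -/
structure HiggsPair (n : ℕ) (X : Type) [TopologicalSpace X] [ChartedSpace (Fin n → ℂ) X]
    [IsManifold 𝓘(ℂ, Fin n → ℂ) ∞ X] where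
  /-- the underlying sheaf -/
  sheaf : AnalyticSheaf n X
  /-- the Higgs field -/
  field : sheaf ⟶ SheafOfModules.tensor sheaf (Omega n X 1)

namespace HiggsPair

variable {n : ℕ} {X : Type} [TopologicalSpace X] [ChartedSpace (Fin n → ℂ) X]
  [IsManifold 𝓘(ℂ, Fin n → ℂ) ∞ X]

/-- The morphism `φ ∧ φ : E → E ⊗ Ω²_X`. -/
noncomputable def fieldSquare (H : HiggsPair n X) :
    H.sheaf ⟶ SheafOfModules.tensor H.sheaf (Omega n X 2) :=
  H.field ≫ SheafOfModules.tensorMap H.field (𝟙 (Omega n X 1)) ≫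
    (SheafOfModules.tensorAssoc H.sheaf (Omega n X 1) (Omega n X 1)).hom ≫
    SheafOfModules.tensorMap (𝟙 H.sheaf) (wedge n X)

/-- `(E, φ)` is a Higgs sheaf: `E` is coherent and `φ ∧ φ = 0`. -/
structure IsHiggsSheaf (H : HiggsPair n X) : Prop where
  coherent : H.sheaf.IsCoherent
  integrable : H.fieldSquare = 0

/-- The tensor product `(E₁ ⊗ E₂, φ₁ ⊗ 1 + 1 ⊗ φ₂)`. -/
noncomputable def tensor (H₁ H₂ : HiggsPair n X) : HiggsPair n X where
  sheaf := SheafOfModules.tensor H₁.sheaf H₂.sheaf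
  field :=
    SheafOfModules.tensorMap H₁.field (𝟙 H₂.sheaf) ≫
      (SheafOfModules.tensorAssoc H₁.sheaf (Omega n X 1) H₂.sheaf).hom ≫
      SheafOfModules.tensorMap (𝟙 H₁.sheaf)
        (SheafOfModules.tensorComm (Omega n X 1) H₂.sheaf).hom ≫
      (SheafOfModules.tensorAssoc H₁.sheaf H₂.sheaf (Omega n X 1)).inv +
    SheafOfModules.tensorMap (𝟙 H₁.sheaf) H₂.field ≫
      (SheafOfModules.tensorAssoc H₁.sheaf H₂.sheaf (Omega n X 1)).inv

/-- The direct sum `(E₁ ⊕ E₂, φ₁ ⊕ φ₂)`. -/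
noncomputable def directSum (H₁ H₂ : HiggsPair n X) : HiggsPair n X where
  sheaf := H₁.sheaf ⊞ H₂.sheaf
  field :=
    biprod.fst ≫ H₁.field ≫ SheafOfModules.tensorMap biprod.inl (𝟙 (Omega n X 1)) +
    biprod.snd ≫ H₂.field ≫ SheafOfModules.tensorMap biprod.inr (𝟙 (Omega n X 1))

end HiggsPair

end HiggsSheaves

section Metrics

/-- The derivative `∂f/∂z_α`. -/
noncomputable def dz {n : ℕ} (α : Fin n) (f : (Fin n → ℂ) → ℂ) (z : Fin n → ℂ) : ℂ :=
  (1 / 2) * (fderiv ℝ f z (Pi.single α 1) - Complex.I * fderiv ℝ f z (Pi.single α Complex.I))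

/-- The derivative `∂f/∂z̄_α`. -/
noncomputable def dzbar {n : ℕ} (α : Fin n) (f : (Fin n → ℂ) → ℂ) (z : Fin n → ℂ) : ℂ :=
  (1 / 2) * (fderiv ℝ f z (Pi.single α 1) + Complex.I * fderiv ℝ f z (Pi.single α Complex.I))

variable {n : ℕ} {X : Type} [TopologicalSpace X] [ChartedSpace (Fin n → ℂ) X]

/-- The matrix `(g_{αβ̄})` of a sesquilinear form on the tangent spaces in a chart. -/
noncomputable def metricCoeff (g : ∀ x : X, TangentSpace 𝓘(ℂ, Fin n → ℂ) x →ₗ[ℂ]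
    TangentSpace 𝓘(ℂ, Fin n → ℂ) x →ₗ⋆[ℂ] ℂ) (c : OpenPartialHomeomorph X (Fin n → ℂ))
    (z : Fin n → ℂ) : Matrix (Fin n) (Fin n) ℂ :=
  Matrix.of fun α β => g (c.symm z) (chartVec c z (Pi.single α 1)) (chartVec c z (Pi.single β 1))

/-- A Kähler metric on a complex manifold: a smooth Hermitian metric on the holomorphic tangent
bundle whose associated form `ω = i ∑ g_{αβ̄} dz_α ∧ dz̄_β` is closed. -/
structure KahlerMetric (n : ℕ) (X : Type) [TopologicalSpace X] [ChartedSpace (Fin n → ℂ) X] where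
  /-- the Hermitian inner product, conjugate-linear in the second variable -/
  inner : ∀ x : X, TangentSpace 𝓘(ℂ, Fin n → ℂ) x →ₗ[ℂ]
    TangentSpace 𝓘(ℂ, Fin n → ℂ) x →ₗ⋆[ℂ] ℂ
  conj_symm : ∀ x v w, inner x w v = (starRingEnd ℂ) (inner x v w)
  pos : ∀ x v, v ≠ 0 → 0 < (inner x v v).re
  smooth : ∀ c ∈ atlas (Fin n → ℂ) X, ∀ α β,
    ContDiffOn ℝ ∞ (fun z => metricCoeff inner c z α β) c.target
  closed : ∀ c ∈ atlas (Fin n → ℂ) X, ∀ z ∈ c.target, ∀ α β γ,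
    dz γ (fun w => metricCoeff inner c w α β) z = dz α (fun w => metricCoeff inner c w γ β) z

/-- The Riemannian volume measure of a Kähler metric: the measure which in every chart is
`ωⁿ / n! = 2ⁿ det (g_{αβ̄})` times the Lebesgue measure. As these measures agree on the overlaps of
the charts, it is the smallest measure which dominates all of them. -/
noncomputable def KahlerMetric.volume [MeasurableSpace X] (g : KahlerMetric n X) : Measure X :=
  ⨆ c : atlas (Fin n → ℂ) X,
    (((MeasureTheory.volume : Measure (Fin n → ℂ)).restrict c.1.target).withDensity fun z =>
      ENNReal.ofReal (2 ^ n * (metricCoeff g.inner c.1 z).det.re)).map c.1.symm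

/-- A (smooth) Hermitian metric on `E|_U`: smoothly varying sesquilinear pairings of sections of `E`
over the open subsets of `U` which are positive definite in every local frame. It is meaningful as a
metric on a vector bundle when `E|_U` is locally free. -/
structure HermitianMetric (E : AnalyticSheaf n X) (U : Opens X) where
  /-- the function `x ↦ h_x(s(x), t(x))` -/
  form : ∀ V : Opens X, V ≤ U → E.Sec V → E.Sec V → V → ℂ
  add_left : ∀ V hV s₁ s₂ t x, form V hV (s₁ + s₂) t x = form V hV s₁ t x + form V hV s₂ t x
  smul_left : ∀ (V : Opens X) (hV : V ≤ U) (f : HolFun n V) s t x,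
    form V hV (f • s) t x = f.eval x * form V hV s t x
  conj_symm : ∀ V hV s t x, form V hV t s x = (starRingEnd ℂ) (form V hV s t x)
  restrict : ∀ (V W : Opens X) (hV : V ≤ U) (hW : W ≤ V) s t (x : W),
    form W (hW.trans hV) (AnalyticSheaf.res hW s) (AnalyticSheaf.res hW t) x =
      form V hV s t ⟨x, hW x.2⟩
  smooth : ∀ V hV s t, ∀ c ∈ atlas (Fin n → ℂ) X,
    ContDiffOn ℝ ∞ (inChart c (form V hV s t)) (c.target ∩ c.symm ⁻¹' V)
  posDef : ∀ (V : Opens X) (hV : V ≤ U) (r : ℕ) (e : Fin r → E.Sec V), AnalyticSheaf.IsFrame e →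
    ∀ x : V, (Matrix.of fun i j => form V hV (e i) (e j) x).PosDef

namespace HermitianMetric

variable {E : AnalyticSheaf n X} {U : Opens X} (h : HermitianMetric E U)

/-- The matrix `H = (h(e_i, e_j))` of the metric in a frame, read in a chart. -/
noncomputable def gram {V : Opens X} (hV : V ≤ U) {r : ℕ} (e : Fin r → E.Sec V)
    (c : OpenPartialHomeomorph X (Fin n → ℂ)) (z : Fin n → ℂ) : Matrix (Fin r) (Fin r) ℂ :=
  Matrix.of fun i j => inChart c (h.form V hV (e i) (e j)) z

/-- The coefficient `A_α` of the connection form `∂H · H⁻¹ = ∑ A_α dz_α` of the Chern connection: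
`∇ e_i = ∑_j (∂H · H⁻¹)_{ij} e_j`. -/
noncomputable def connection {V : Opens X} (hV : V ≤ U) {r : ℕ} (e : Fin r → E.Sec V)
    (c : OpenPartialHomeomorph X (Fin n → ℂ)) (α : Fin n) (z : Fin n → ℂ) :
    Matrix (Fin r) (Fin r) ℂ :=
  (Matrix.of fun i j => dz α (fun w => h.gram hV e c w i j) z) * (h.gram hV e c z)⁻¹

/-- The coefficient `R_{αβ̄}` of the Chern curvature `R = ∂̄(∂H · H⁻¹) = ∑ R_{αβ̄} dz_α ∧ dz̄_β`. -/
noncomputable def curvature {V : Opens X} (hV : V ≤ U) {r : ℕ} (e : Fin r → E.Sec V)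
    (c : OpenPartialHomeomorph X (Fin n → ℂ)) (α β : Fin n) (z : Fin n → ℂ) :
    Matrix (Fin r) (Fin r) ℂ :=
  Matrix.of fun i j => -dzbar β (fun w => h.connection hV e c α w i j) z

/-- The mean curvature `K = iΛR = ∑ g^{αβ̄} R_{αβ̄}`, where `g^{αβ̄}` is the `(β, α)` entry of the
inverse of the matrix `(g_{αβ̄})`. -/
noncomputable def meanCurvature (g : KahlerMetric n X) {V : Opens X} (hV : V ≤ U) {r : ℕ}
    (e : Fin r → E.Sec V) (c : OpenPartialHomeomorph X (Fin n → ℂ)) (z : Fin n → ℂ) :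
    Matrix (Fin r) (Fin r) ℂ :=
  ∑ α, ∑ β, ((metricCoeff g.inner c z)⁻¹ β α) • h.curvature hV e c α β z

/-- The Hermitian product `tr(A B^*)` of two endomorphisms with matrices `A`, `B` in a frame in
which the metric has matrix `H`; the adjoint of `B` with respect to the metric is `H Bᴴ H⁻¹`. -/
noncomputable def endInner {r : ℕ} (H A B : Matrix (Fin r) (Fin r) ℂ) : ℂ :=
  (A * (H * Bᴴ * H⁻¹)).trace

/-- `|R|² = ∑ g^{αγ̄} g^{δβ̄} tr(R_{αβ̄} R_{γδ̄}^*)`, computed in a frame and a chart. -/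
noncomputable def curvatureNormSqIn (g : KahlerMetric n X) {V : Opens X} (hV : V ≤ U) {r : ℕ}
    (e : Fin r → E.Sec V) (c : OpenPartialHomeomorph X (Fin n → ℂ)) (z : Fin n → ℂ) : ℝ :=
  (∑ α, ∑ β, ∑ γ, ∑ δ, (metricCoeff g.inner c z)⁻¹ γ α * (metricCoeff g.inner c z)⁻¹ β δ *
    endInner (h.gram hV e c z) (h.curvature hV e c α β z) (h.curvature hV e c γ δ z)).re

/-- `|K|`, computed in a frame and a chart. -/
noncomputable def meanCurvatureNormIn (g : KahlerMetric n X) {V : Opens X} (hV : V ≤ U) {r : ℕ}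
    (e : Fin r → E.Sec V) (c : OpenPartialHomeomorph X (Fin n → ℂ)) (z : Fin n → ℂ) : ℝ :=
  √(endInner (h.gram hV e c z) (h.meanCurvature g hV e c z) (h.meanCurvature g hV e c z)).re

/-- The function `|R_h|²`. It can be computed in any frame and chart around the point: the supremum
is that of a constant family. -/
noncomputable def curvatureNormSq (g : KahlerMetric n X) (x : X) : ℝ≥0∞ :=
  ⨆ (c ∈ atlas (Fin n → ℂ) X) (_ : x ∈ c.source) (V : Opens X) (hV : V ≤ U) (_ : x ∈ V) (r : ℕ)
    (e : Fin r → E.Sec V) (_ : AnalyticSheaf.IsFrame e),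
    ENNReal.ofReal (h.curvatureNormSqIn g hV e c (c x))

/-- The function `|K_h|`. It can be computed in any frame and chart around the point: the supremum
is that of a constant family. -/
noncomputable def meanCurvatureNorm (g : KahlerMetric n X) (x : X) : ℝ≥0∞ :=
  ⨆ (c ∈ atlas (Fin n → ℂ) X) (_ : x ∈ c.source) (V : Opens X) (hV : V ≤ U) (_ : x ∈ V) (r : ℕ)
    (e : Fin r → E.Sec V) (_ : AnalyticSheaf.IsFrame e),
    ENNReal.ofReal (h.meanCurvatureNormIn g hV e c (c x))

end HermitianMetric

/-- `A` is a (closed) complex analytic subset of `X`: near every point of `X` it is the set of common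
zeros of finitely many holomorphic functions. -/
def IsAnalyticSubset (n : ℕ) {X : Type} [TopologicalSpace X] [ChartedSpace (Fin n → ℂ) X]
    (A : Set X) : Prop :=
  ∀ x : X, ∃ V : Opens X, x ∈ V ∧ ∃ (k : ℕ) (f : Fin k → HolFun n V),
    ∀ y : V, (y : X) ∈ A ↔ ∀ i, (f i).eval y = 0

/-- Near its point `a`, the set `A` is a complex submanifold of codimension `k`. -/
def IsRegularPoint (n : ℕ) {X : Type} [TopologicalSpace X] [ChartedSpace (Fin n → ℂ) X]
    (A : Set X) (a : X) (k : ℕ) : Prop :=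
  a ∈ A ∧ k ≤ n ∧ ∃ c ∈ IsManifold.maximalAtlas 𝓘(ℂ, Fin n → ℂ) ∞ X, a ∈ c.source ∧
    ∀ y ∈ c.source, y ∈ A ↔ ∀ i : Fin n, (i : ℕ) < k → c y i = 0

/-- The analytic subset `A` has codimension at least `m`: it has codimension at least `m` at all its
regular points. -/
def CodimAtLeast (n : ℕ) {X : Type} [TopologicalSpace X] [ChartedSpace (Fin n → ℂ) X]
    (m : ℕ) (A : Set X) : Prop :=
  ∀ a k, IsRegularPoint n A a k → m ≤ k

/-- A Hermitian metric `h` on `E|_U` is an admissible structure on `E`: the complement of `U` is an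
analytic subset of codimension at least two containing the singularity set of `E`, the Chern
curvature of `h` is square-integrable, and its mean curvature is integrable. -/
structure IsAdmissible [MeasurableSpace X] (g : KahlerMetric n X) {E : AnalyticSheaf n X}
    {U : Opens X} (h : HermitianMetric E U) : Prop where
  analytic : IsAnalyticSubset n (U : Set X)ᶜ
  codim : CodimAtLeast n 2 (U : Set X)ᶜ
  singular : E.singularSet ⊆ (U : Set X)ᶜ
  curvature : ∫⁻ x in (U : Set X), h.curvatureNormSq g x ∂g.volume < ⊤
  meanCurvature : ∫⁻ x in (U : Set X), h.meanCurvatureNorm g x ∂g.volume < ⊤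

/-- `h` is the Hermitian metric `h₁ ⊗ h₂` on `(E₁ ⊗ E₂)|_{U₁ ∩ U₂}`, which is determined by
`h(s₁ ⊗ s₂, t₁ ⊗ t₂) = h₁(s₁, t₁) h₂(s₂, t₂)`. -/
def IsTensorMetric {E₁ E₂ : AnalyticSheaf n X} {U₁ U₂ : Opens X} (h₁ : HermitianMetric E₁ U₁)
    (h₂ : HermitianMetric E₂ U₂)
    (h : HermitianMetric (SheafOfModules.tensor E₁ E₂) (U₁ ⊓ U₂)) : Prop :=
  ∀ (V : Opens X) (hV : V ≤ U₁ ⊓ U₂) (s₁ t₁ : E₁.Sec V) (s₂ t₂ : E₂.Sec V) (x : V),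
    h.form V hV (SheafOfModules.tmul s₁ s₂) (SheafOfModules.tmul t₁ t₂) x =
      h₁.form V (hV.trans inf_le_left) s₁ t₁ x * h₂.form V (hV.trans inf_le_right) s₂ t₂ x

/-- `h` is the Hermitian metric `h₁ ⊕ h₂` on `(E₁ ⊕ E₂)|_{U₁ ∩ U₂}`:
`h(s, t) = h₁(s₁, t₁) + h₂(s₂, t₂)` for sections `s = (s₁, s₂)` and `t = (t₁, t₂)`. -/
def IsSumMetric {E₁ E₂ : AnalyticSheaf n X} {U₁ U₂ : Opens X} (h₁ : HermitianMetric E₁ U₁)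
    (h₂ : HermitianMetric E₂ U₂) (h : HermitianMetric (E₁ ⊞ E₂ : AnalyticSheaf n X) (U₁ ⊓ U₂)) :
    Prop :=
  ∀ (V : Opens X) (hV : V ≤ U₁ ⊓ U₂) (s t : (E₁ ⊞ E₂ : AnalyticSheaf n X).Sec V) (x : V),
    h.form V hV s t x =
      h₁.form V (hV.trans inf_le_left)
        ((biprod.fst : E₁ ⊞ E₂ ⟶ E₁).val.app (op V) s)
        ((biprod.fst : E₁ ⊞ E₂ ⟶ E₁).val.app (op V) t) x +
      h₂.form V (hV.trans inf_le_right)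
        ((biprod.snd : E₁ ⊞ E₂ ⟶ E₂).val.app (op V) s)
        ((biprod.snd : E₁ ⊞ E₂ ⟶ E₂).val.app (op V) t) x

end Metrics

end Higgs

open scoped Manifold ContDiff

/-! Curvature is additive under both operations. In holomorphic frames the matrix of `h₁ ⊗ h₂` is
the Kronecker product of the two Gram matrices and that of `h₁ ⊕ h₂` is block diagonal, whence `R =
R₁ ⊗ 1 + 1 ⊗ R₂` (`chernCurvature_kronecker`) and `R = R₁ ⊕ R₂` (`chernCurvature_fromBlocks`);
contracting with the Kähler metric gives the same formulas for the mean curvature.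

For norms, `|A ⊗ 1|² = rk(E₂) |A|²` because the trace of the identity is the rank. The parallelogram
law then gives `|R|² ≤ 2 rk(E₂) |R₁|² + 2 rk(E₁) |R₂|²`, and a similar bound with square roots for
`|K|`; for the direct sum `|R|²` and `|K|²` simply add. The ranks are bounded uniformly: a frame
near a point has no more members than a local system of generators, and finitely many such systems
serve the compact space (`IsCoherent.exists_card_le`). Integrability follows from
`IsAdmissible.of_le`. The norms are suprema over all charts and frames; they can be evaluated in one
convenient frame because a holomorphic change of frame conjugates the curvature
(`chernCurvature_frame_change`), and they are measurable because they are lower semicontinuous.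

The complement of `U₁ ∩ U₂` is the union of two analytic sets of codimension at least two, and off
the singularity sets tensor products and direct sums of frames are frames.

The tensor product is a sheafification, so its sections are sums of pure tensors only locally, and
two such sums define the same section only when they agree locally. Every statement about it is
checked after shrinking. In this way the pairing of pure tensors descends to a unique Hermitian form
(`exists_tensorForm`), positive definite because a Kronecker product of positive definite matrices
is. Coherence comes from tensoring local presentations: the relations among the `sᵢ ⊗ s'ⱼ` are
generated by those of either factor, by right exactness of the tensor product
(`IsPresentation.exists_of_sum_tmul_eq_zero`).

For the Higgs field of the tensor product, the square consists of `(φ₁ ∧ φ₁) ⊗ 1`, `1 ⊗ (φ₂ ∧ φ₂)`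
and two mixed terms, which cancel since the wedge of `1`-forms is antisymmetric. For the direct sum,
both inclusions commute with the Higgs fields. -/

namespace Higgs

open TopologicalSpace CategoryTheory CategoryTheory.Limits MonoidalCategory Opposite MeasureTheory
open scoped Manifold ContDiff ENNReal Matrix ComplexOrder TensorProduct

/-! ### Sections of analytic sheaves, of their tensor products and of their direct sums -/

section Sections

variable {n : ℕ} {X : Type} [TopologicalSpace X] [ChartedSpace (Fin n → ℂ) X]

namespace HolFun

/-- `HolFun` is an object of `RingCat`, which only supplies a ring; commutativity, needed for tensor
products over it, comes from the structure sheaf `hol`. -/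
noncomputable instance (V : Opens X) : CommRing (HolFun n V) :=
  inferInstanceAs (CommRing ((hol n X).obj.obj (op V)))

theorem ext_eval {V : Opens X} {f g : HolFun n V} (h : ∀ x, f.eval x = g.eval x) : f = g :=
  ContMDiffMap.ext h

/-- Evaluation of holomorphic functions at a point. -/
noncomputable def evalHom {V : Opens X} (x : V) : HolFun n V →+* ℂ where
  toFun f := f.eval x
  map_one' := rfl
  map_mul' _ _ := rfl
  map_zero' := rfl
  map_add' _ _ := rfl

/-- Restriction of holomorphic functions as a ring homomorphism. -/
noncomputable def resHom {W V : Opens X} (h : W ≤ V) : HolFun n V →+* HolFun n W :=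
  ((SheafOfModules.ofComm (hol n X)).obj.map (homOfLE h).op).hom

theorem resHom_apply {W V : Opens X} (h : W ≤ V) (f : HolFun n V) : resHom h f = f.res h := rfl

theorem eval_res {W V : Opens X} (h : W ≤ V) (f : HolFun n V) (x : W) :
    (f.res h).eval x = f.eval ⟨x, h x.2⟩ := rfl

@[simp] theorem res_res {W' W V : Opens X} (h : W ≤ V) (h' : W' ≤ W) (f : HolFun n V) :
    (f.res h).res h' = f.res (h'.trans h) := rfl

@[simp] theorem res_add {W V : Opens X} (h : W ≤ V) (f g : HolFun n V) :
    (f + g).res h = f.res h + g.res h := rfl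

@[simp] theorem res_zero {W V : Opens X} (h : W ≤ V) : (0 : HolFun n V).res h = 0 := rfl

@[simp] theorem res_mul {W V : Opens X} (h : W ≤ V) (f g : HolFun n V) :
    (f * g).res h = f.res h * g.res h := rfl

@[simp] theorem res_sum {W V : Opens X} (h : W ≤ V) {ι : Type*} (s : Finset ι)
    (f : ι → HolFun n V) : (∑ i ∈ s, f i).res h = ∑ i ∈ s, (f i).res h :=
  map_sum (resHom h) f s

end HolFun

/-- Brings finitely many local statements to a single neighbourhood; finiteness keeps the
intersection open. -/
theorem exists_common_nhd {ι : Type*} [Finite ι] {W : Opens X} {y : X} (hy : y ∈ W)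
    (f : ι → Opens X) (hf : ∀ i, y ∈ f i) : ∃ W' : Opens X, W' ≤ W ∧ y ∈ W' ∧ ∀ i, W' ≤ f i := by
  refine ⟨W ⊓ ⟨⋂ i, (f i : Set X), isOpen_iInter_of_finite fun i => (f i).isOpen⟩, inf_le_left,
    ⟨hy, Set.mem_iInter.2 hf⟩, fun i z hz => Set.mem_iInter.1 hz.2 i⟩

namespace AnalyticSheaf

variable {E F G E' F' : AnalyticSheaf n X} {U V W W' : Opens X}

@[simp] theorem res_add (h : W ≤ V) (s t : E.Sec V) : res h (s + t) = res h s + res h t :=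
  map_add (E.val.map (homOfLE h).op).hom s t

@[simp] theorem res_zero (h : W ≤ V) : res h (0 : E.Sec V) = 0 :=
  map_zero (E.val.map (homOfLE h).op).hom

@[simp] theorem res_sum (h : W ≤ V) {ι : Type*} (s : Finset ι) (f : ι → E.Sec V) :
    res h (∑ i ∈ s, f i) = ∑ i ∈ s, res h (f i) :=
  map_sum (E.val.map (homOfLE h).op).hom f s

@[simp] theorem res_smul (h : W ≤ V) (f : HolFun n V) (s : E.Sec V) :
    res h (f • s) = f.res h • res h s :=
  PresheafOfModules.map_smul E.val (homOfLE h).op f s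

@[simp] theorem res_res (h : W ≤ V) (h' : W' ≤ W) (s : E.Sec V) :
    res h' (res h s) = res (h'.trans h) s :=
  (congrArg (fun f => f s) (E.val.presheaf.map_comp (homOfLE h).op (homOfLE h').op)).symm

@[simp] theorem res_self (h : V ≤ V) (s : E.Sec V) : res h s = s :=
  congrArg (fun f => f s) (E.val.presheaf.map_id (op V))

/-- A sheaf is separated, and the open sets on which `s` and `t` agree form a covering sieve.
Identities in a tensor product can therefore be checked where the sections are sums of pure tensors.
-/
theorem eq_of_locally_eq {s t : E.Sec V}
    (h : ∀ x ∈ V, ∃ (W : Opens X) (hW : W ≤ V), x ∈ W ∧ res hW s = res hW t) : s = t := by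
  have hE : Presheaf.IsSheaf (Opens.grothendieckTopology (TopCat.of X)) E.val.presheaf := E.isSheaf
  rw [Presheaf.isSheaf_iff_isSheaf_forget _ _ (CategoryTheory.forget AddCommGrpCat),
    isSheaf_iff_isSheaf_of_type] at hE
  have hS : Presheaf.equalizerSieve (F := E.val.presheaf) (X := op V) s t ∈
      Opens.grothendieckTopology (TopCat.of X) V := by
    rw [Opens.mem_grothendieckTopology]
    intro x hx
    obtain ⟨W, hW, hxW, hst⟩ := h x hx
    exact ⟨W, homOfLE hW, hst, hxW⟩
  exact (hE.isSeparated _ hS).ext fun W f hf => hf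

/-- The value on sections of a morphism of sheaves. -/
noncomputable def map (f : E ⟶ F) (V : Opens X) : E.Sec V →ₗ[HolFun n V] F.Sec V :=
  (f.val.app (op V)).hom

theorem map_res (f : E ⟶ F) (h : W ≤ V) (s : E.Sec V) :
    map f W (res h s) = res h (map f V s) :=
  PresheafOfModules.naturality_apply f.val (homOfLE h).op s

@[simp] theorem map_comp (f : E ⟶ F) (g : F ⟶ G) (s : E.Sec V) :
    map (f ≫ g) V s = map g V (map f V s) := rfl

@[simp] theorem map_id (s : E.Sec V) : map (𝟙 E) V s = s := rfl

@[simp] theorem map_add_hom (f g : E ⟶ F) (s : E.Sec V) :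
    map (f + g) V s = map f V s + map g V s := rfl

@[simp] theorem map_zero_hom (s : E.Sec V) : map (0 : E ⟶ F) V s = 0 := rfl

theorem hom_ext {f g : E ⟶ F} (h : ∀ (V : Opens X) (s : E.Sec V), map f V s = map g V s) :
    f = g := by
  apply SheafOfModules.hom_ext
  apply PresheafOfModules.hom_ext
  intro V
  exact ModuleCat.hom_ext (LinearMap.ext (h V.unop))

/-- The tensor product of analytic sheaves. -/
noncomputable abbrev ten (E F : AnalyticSheaf n X) : AnalyticSheaf n X := SheafOfModules.tensor E F

/-- The section of `E ⊗ F` defined by an element of `E(V) ⊗ F(V)`. -/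
noncomputable def ofTensor (E F : AnalyticSheaf n X) (V : Opens X) :
    E.Sec V ⊗[HolFun n V] F.Sec V →ₗ[HolFun n V] (ten E F).Sec V :=
  ((SheafOfModules.toShf (SheafOfModules.psh E ⊗ SheafOfModules.psh F)).app (op V)).hom

/-- The section `s ⊗ t` of `E ⊗ F`. -/
noncomputable def tmul (s : E.Sec V) (t : F.Sec V) : (ten E F).Sec V :=
  SheafOfModules.tmul s t

theorem tmul_eq (s : E.Sec V) (t : F.Sec V) : tmul s t = ofTensor E F V (s ⊗ₜ t) := rfl

/-- Restriction on `E(V) ⊗ F(V)`. -/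
noncomputable def resTensor (E F : AnalyticSheaf n X) (h : W ≤ V) :
    E.Sec V ⊗[HolFun n V] F.Sec V →+ E.Sec W ⊗[HolFun n W] F.Sec W :=
  ((SheafOfModules.psh E ⊗ SheafOfModules.psh F).map (homOfLE h).op).hom.toAddMonoidHom

@[simp] theorem resTensor_tmul (h : W ≤ V) (s : E.Sec V) (t : F.Sec V) :
    resTensor E F h (s ⊗ₜ t) = res h s ⊗ₜ res h t := rfl

theorem res_ofTensor (h : W ≤ V) (u : E.Sec V ⊗[HolFun n V] F.Sec V) :
    res h (ofTensor E F V u) = ofTensor E F W (resTensor E F h u) :=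
  (PresheafOfModules.naturality_apply
    (SheafOfModules.toShf (SheafOfModules.psh E ⊗ SheafOfModules.psh F)) (homOfLE h).op u).symm

/-- Local surjectivity of the map from a presheaf to its sheafification. -/
theorem exists_ofTensor (s : (ten E F).Sec V) {x : X} (hx : x ∈ V) :
    ∃ (W : Opens X) (hW : W ≤ V), x ∈ W ∧ ∃ u, ofTensor E F W u = res hW s := by
  have h := Presheaf.imageSieve_mem (Opens.grothendieckTopology (TopCat.of X))
    ((PresheafOfModules.toPresheaf _).map
      (SheafOfModules.toShf (SheafOfModules.psh E ⊗ SheafOfModules.psh F))) (U := op V) s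
  rw [Opens.mem_grothendieckTopology] at h
  obtain ⟨W, f, ⟨u, hu⟩, hxW⟩ := h x hx
  exact ⟨W, leOfHom f, hxW, u, hu⟩

/-- Local injectivity of the map from a presheaf to its sheafification. -/
theorem resTensor_eq_of_ofTensor_eq {u v : E.Sec V ⊗[HolFun n V] F.Sec V}
    (huv : ofTensor E F V u = ofTensor E F V v) {x : X} (hx : x ∈ V) :
    ∃ (W : Opens X) (hW : W ≤ V), x ∈ W ∧ resTensor E F hW u = resTensor E F hW v := by
  have h := Presheaf.equalizerSieve_mem (Opens.grothendieckTopology (TopCat.of X))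
    ((PresheafOfModules.toPresheaf _).map
      (SheafOfModules.toShf (SheafOfModules.psh E ⊗ SheafOfModules.psh F))) (X := op V) u v huv
  rw [Opens.mem_grothendieckTopology] at h
  obtain ⟨W, f, hu, hxW⟩ := h x hx
  exact ⟨W, leOfHom f, hxW, hu⟩

@[simp] theorem add_tmul (s s' : E.Sec V) (t : F.Sec V) : tmul (s + s') t = tmul s t + tmul s' t := by
  simp only [tmul_eq, TensorProduct.add_tmul, map_add]

@[simp] theorem tmul_add (s : E.Sec V) (t t' : F.Sec V) : tmul s (t + t') = tmul s t + tmul s t' := by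
  simp only [tmul_eq, TensorProduct.tmul_add, map_add]

@[simp] theorem zero_tmul (t : F.Sec V) : tmul (0 : E.Sec V) t = 0 := by
  simp only [tmul_eq, TensorProduct.zero_tmul, map_zero]

@[simp] theorem tmul_zero (s : E.Sec V) : tmul s (0 : F.Sec V) = 0 := by
  simp only [tmul_eq, TensorProduct.tmul_zero, map_zero]

@[simp] theorem sum_tmul {ι : Type*} (a : Finset ι) (s : ι → E.Sec V) (t : F.Sec V) :
    tmul (∑ i ∈ a, s i) t = ∑ i ∈ a, tmul (s i) t := by
  simp only [tmul_eq, TensorProduct.sum_tmul, map_sum]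

@[simp] theorem tmul_sum {ι : Type*} (a : Finset ι) (s : E.Sec V) (t : ι → F.Sec V) :
    tmul s (∑ i ∈ a, t i) = ∑ i ∈ a, tmul s (t i) := by
  simp only [tmul_eq, TensorProduct.tmul_sum, map_sum]

@[simp] theorem smul_tmul (f : HolFun n V) (s : E.Sec V) (t : F.Sec V) :
    tmul (f • s) t = f • tmul s t := by
  rw [tmul_eq, tmul_eq, ← TensorProduct.smul_tmul', map_smul]

@[simp] theorem tmul_smul (f : HolFun n V) (s : E.Sec V) (t : F.Sec V) :
    tmul s (f • t) = f • tmul s t := by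
  rw [tmul_eq, tmul_eq, TensorProduct.tmul_smul, map_smul]

@[simp] theorem res_tmul (h : W ≤ V) (s : E.Sec V) (t : F.Sec V) :
    res h (tmul s t) = tmul (res h s) (res h t) := by
  rw [tmul_eq, res_ofTensor, resTensor_tmul, tmul_eq]

theorem exists_sum_tmul (s : (ten E F).Sec V) {x : X} (hx : x ∈ V) :
    ∃ (W : Opens X) (hW : W ≤ V), x ∈ W ∧ ∃ (k : ℕ) (a : Fin k → E.Sec W) (b : Fin k → F.Sec W),
      res hW s = ∑ i, tmul (a i) (b i) := by
  obtain ⟨W, hW, hxW, u, hu⟩ := exists_ofTensor s hx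
  obtain ⟨k, a, b, rfl⟩ := TensorProduct.exists_sum_tmul_eq u
  exact ⟨W, hW, hxW, k, a, b, by rw [← hu, map_sum]; rfl⟩

/-- Every section of `E ⊗ F` is locally a sum of pure tensors, and `G` is separated. -/
theorem tensor_hom_ext {f g : ten E F ⟶ G}
    (h : ∀ (V : Opens X) (s : E.Sec V) (t : F.Sec V), map f V (tmul s t) = map g V (tmul s t)) :
    f = g := by
  refine hom_ext fun V s => eq_of_locally_eq fun x hx => ?_
  obtain ⟨W, hW, hxW, k, a, b, hs⟩ := exists_sum_tmul s hx
  refine ⟨W, hW, hxW, ?_⟩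
  simp only [← map_res, hs, map_sum, h]

/-- Naturality of sheafification. It evaluates, on sections coming from the presheaf tensor product,
every canonical map obtained by sheafifying a presheaf map. -/
theorem map_shf_map {P Q : PresheafOfModules.{0} ((hol n X).obj ⋙ forget₂ CommRingCat RingCat)}
    (f : P ⟶ Q) (V : Opens X) (u : P.obj (op V)) :
    map ((SheafOfModules.shf (hol n X)).map f) V ((SheafOfModules.toShf P).app (op V) u) =
      (SheafOfModules.toShf Q).app (op V) (f.app (op V) u) :=
  (congrArg (fun k => k.app (op V) u) (CategoryTheory.toSheafify_naturality
    (Opens.grothendieckTopology (TopCat.of X)) ((PresheafOfModules.toPresheaf _).map f))).symm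

theorem map_tensorMap (f : E ⟶ E') (g : F ⟶ F') (s : E.Sec V) (t : F.Sec V) :
    map (SheafOfModules.tensorMap f g) V (tmul s t) = tmul (map f V s) (map g V t) :=
  map_shf_map _ V _

theorem map_tensorComm (s : E.Sec V) (t : F.Sec V) :
    map (SheafOfModules.tensorComm E F).hom V (tmul s t) = tmul t s :=
  map_shf_map _ V _

@[simp] theorem map_inv_hom (i : E ≅ F) (s : E.Sec V) : map i.inv V (map i.hom V s) = s := by
  rw [← map_comp, i.hom_inv_id, map_id]

theorem map_tensorAssoc (s : E.Sec V) (t : F.Sec V) (w : G.Sec V) :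
    map (SheafOfModules.tensorAssoc E F G).hom V (tmul (tmul s t) w) = tmul s (tmul t w) := by
  let P := SheafOfModules.psh E
  let Q := SheafOfModules.psh F
  let R := SheafOfModules.psh G
  have h1 : map (SheafOfModules.shfTensorRight (P ⊗ Q) R).hom V
      ((SheafOfModules.toShf ((P ⊗ Q) ⊗ R)).app (op V)
        ((s ⊗ₜ[HolFun n V] t) ⊗ₜ[HolFun n V] w)) = tmul (tmul s t) w :=
    map_shf_map _ V _
  have h2 : map ((SheafOfModules.shf (hol n X)).map (α_ P Q R).hom) V
      ((SheafOfModules.toShf ((P ⊗ Q) ⊗ R)).app (op V)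
        ((s ⊗ₜ[HolFun n V] t) ⊗ₜ[HolFun n V] w)) =
      (SheafOfModules.toShf (P ⊗ (Q ⊗ R))).app (op V)
        (s ⊗ₜ[HolFun n V] (t ⊗ₜ[HolFun n V] w)) :=
    map_shf_map _ V _
  -- `h3`, `h4`, `h5` follow the element through `shfTensorLeft`, which is `shfTensorRight`
  -- conjugated by braidings.
  have h3 : map ((SheafOfModules.shf (hol n X)).map (β_ P (Q ⊗ R)).hom) V
      ((SheafOfModules.toShf (P ⊗ (Q ⊗ R))).app (op V)
        (s ⊗ₜ[HolFun n V] (t ⊗ₜ[HolFun n V] w))) =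
      (SheafOfModules.toShf ((Q ⊗ R) ⊗ P)).app (op V)
        ((t ⊗ₜ[HolFun n V] w) ⊗ₜ[HolFun n V] s) :=
    map_shf_map _ V _
  have h4 : map (SheafOfModules.shfTensorRight (Q ⊗ R) P).hom V
      ((SheafOfModules.toShf ((Q ⊗ R) ⊗ P)).app (op V)
        ((t ⊗ₜ[HolFun n V] w) ⊗ₜ[HolFun n V] s)) = tmul (tmul t w) s :=
    map_shf_map _ V _
  have h5 : map ((SheafOfModules.shf (hol n X)).map
      (β_ (SheafOfModules.psh ((SheafOfModules.shf (hol n X)).obj (Q ⊗ R))) P).hom) V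
      (tmul (tmul t w) s) = tmul s (tmul t w) :=
    map_shf_map _ V _
  -- The associator starts with the inverse of `shfTensorRight`, for which there is no direct
  -- formula; its value is read off from that of the forward map in `h1`.
  have h0 := (congrArg (map (SheafOfModules.shfTensorRight (P ⊗ Q) R).inv V) h1).symm.trans
    (map_inv_hom _ _)
  refine (congrArg (fun z => map ((SheafOfModules.shf (hol n X)).map
    (β_ (SheafOfModules.psh ((SheafOfModules.shf (hol n X)).obj (Q ⊗ R))) P).hom) V
    (map (SheafOfModules.shfTensorRight (Q ⊗ R) P).hom V
    (map ((SheafOfModules.shf (hol n X)).map (β_ P (Q ⊗ R)).hom) V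
    (map ((SheafOfModules.shf (hol n X)).map (α_ P Q R).hom) V z)))) h0).trans ?_
  rw [h2, h3, h4]
  exact h5

theorem map_tensorAssoc_inv (s : E.Sec V) (t : F.Sec V) (w : G.Sec V) :
    map (SheafOfModules.tensorAssoc E F G).inv V (tmul s (tmul t w)) = tmul (tmul s t) w := by
  rw [← map_tensorAssoc]
  exact map_inv_hom _ _

theorem map_shfLift {P : PresheafOfModules.{0} ((hol n X).obj ⋙ forget₂ CommRingCat RingCat)}
    (f : P ⟶ E.val) (V : Opens X) (u : P.obj (op V)) :
    map (SheafOfModules.shfLift f) V ((SheafOfModules.toShf P).app (op V) u) = f.app (op V) u :=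
  congrArg (fun k => k.app (op V) u) (SheafOfModules.toShf_shfLift f)

/-- The first component of a section of a direct sum. -/
noncomputable abbrev fst (V : Opens X) : (E ⊞ F : AnalyticSheaf n X).Sec V →ₗ[HolFun n V] E.Sec V :=
  map biprod.fst V

/-- The second component of a section of a direct sum. -/
noncomputable abbrev snd (V : Opens X) : (E ⊞ F : AnalyticSheaf n X).Sec V →ₗ[HolFun n V] F.Sec V :=
  map biprod.snd V

/-- The inclusion of sections of the first summand. -/
noncomputable abbrev inl (V : Opens X) : E.Sec V →ₗ[HolFun n V] (E ⊞ F : AnalyticSheaf n X).Sec V :=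
  map biprod.inl V

/-- The inclusion of sections of the second summand. -/
noncomputable abbrev inr (V : Opens X) : F.Sec V →ₗ[HolFun n V] (E ⊞ F : AnalyticSheaf n X).Sec V :=
  map biprod.inr V

@[simp] theorem fst_inl (s : E.Sec V) : fst (F := F) V (inl V s) = s := by
  rw [← map_comp, biprod.inl_fst, map_id]

@[simp] theorem snd_inl (s : E.Sec V) : snd (F := F) V (inl V s) = 0 := by
  rw [← map_comp, biprod.inl_snd, map_zero_hom]

@[simp] theorem fst_inr (s : F.Sec V) : fst (E := E) V (inr V s) = 0 := by
  rw [← map_comp, biprod.inr_fst, map_zero_hom]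

@[simp] theorem snd_inr (s : F.Sec V) : snd (E := E) V (inr V s) = s := by
  rw [← map_comp, biprod.inr_snd, map_id]

theorem inl_fst_add_inr_snd (s : (E ⊞ F : AnalyticSheaf n X).Sec V) :
    inl V (fst V s) + inr V (snd V s) = s := by
  rw [← map_comp, ← map_comp, ← map_add_hom, biprod.total, map_id]

end AnalyticSheaf

end Sections

/-! ### Integrability of the Higgs fields of tensor products and direct sums -/

section HiggsFields

open AnalyticSheaf

variable {n : ℕ} {X : Type} [TopologicalSpace X] [ChartedSpace (Fin n → ℂ) X]
  [IsManifold 𝓘(ℂ, Fin n → ℂ) ∞ X] {V W : Opens X}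

/-- The exterior product of sections of `Ω¹`. -/
noncomputable def wedgeSec (a b : (Omega n X 1).Sec V) : (Omega n X 2).Sec V :=
  map (wedge n X) V (tmul a b)

/-- The sign rule that cancels the mixed terms in the square of a tensor product field. -/
theorem wedgeSec_comm (a b : (Omega n X 1).Sec V) : wedgeSec a b + wedgeSec b a = 0 := by
  have h : ∀ a b : (Omega n X 1).Sec V, wedgeSec a b = wedgeForms (V := V) a b := fun a b =>
    map_shfLift (wedgePsh n X) V (a ⊗ₜ[HolFun n V] b)
  rw [h, h]
  refine Subtype.ext (funext fun x => AlternatingMap.ext fun v => ?_)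
  change (a.1 x (fun _ => v 0) * b.1 x (fun _ => v 1) - a.1 x (fun _ => v 1) * b.1 x (fun _ => v 0))
    + (b.1 x (fun _ => v 0) * a.1 x (fun _ => v 1) - b.1 x (fun _ => v 1) * a.1 x (fun _ => v 0)) = 0
  ring

/-- The contraction `(a ⊗ α) ∧ β = a ⊗ (α ∧ β)` as a morphism of sheaves. -/
noncomputable def wedgeRight (E : AnalyticSheaf n X) :
    ten (ten E (Omega n X 1)) (Omega n X 1) ⟶ ten E (Omega n X 2) :=
  (SheafOfModules.tensorAssoc E (Omega n X 1) (Omega n X 1)).hom ≫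
    SheafOfModules.tensorMap (𝟙 E) (wedge n X)

variable {E F G : AnalyticSheaf n X}

theorem map_wedgeRight (s : E.Sec V) (a b : (Omega n X 1).Sec V) :
    map (wedgeRight E) V (tmul (tmul s a) b) = tmul s (wedgeSec a b) := by
  rw [wedgeRight, map_comp, map_tensorAssoc, map_tensorMap, map_id]
  rfl

/-- The morphism `φ ∧ φ` of a morphism `φ : E → E ⊗ Ω¹`. -/
noncomputable def fieldSquare (φ : E ⟶ ten E (Omega n X 1)) : E ⟶ ten E (Omega n X 2) :=
  (HiggsPair.mk E φ).fieldSquare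

/-- Any expansion of `φ(s)` into pure tensors is allowed, which makes `φ ∧ φ` computable on the
expansion built from those of two factors. -/
theorem map_fieldSquare (φ : E ⟶ ten E (Omega n X 1)) {ι : Type*} [Fintype ι] {s : E.Sec V}
    {a : ι → E.Sec V} {α : ι → (Omega n X 1).Sec V} (hs : map φ V s = ∑ i, tmul (a i) (α i)) :
    map (fieldSquare φ) V s = ∑ i, map (wedgeRight E) V (tmul (map φ V (a i)) (α i)) := by
  have h : map (fieldSquare φ) V s = map (wedgeRight E) V
    (map (SheafOfModules.tensorMap φ (𝟙 (Omega n X 1))) V (map φ V s)) := rfl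
  rw [h, hs, map_sum, map_sum]
  refine Finset.sum_congr rfl fun i _ => ?_
  rw [map_tensorMap, map_id]

/-- The tensor product of two morphisms. -/
noncomputable def tenMap {E E' F F' : AnalyticSheaf n X} (f : E ⟶ E') (g : F ⟶ F') :
    ten E F ⟶ ten E' F' := SheafOfModules.tensorMap f g

omit [IsManifold 𝓘(ℂ, Fin n → ℂ) ∞ X] in
theorem map_tenMap {E E' F F' : AnalyticSheaf n X} (f : E ⟶ E') (g : F ⟶ F') (s : E.Sec V)
    (t : F.Sec V) : map (tenMap f g) V (tmul s t) = tmul (map f V s) (map g V t) :=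
  map_tensorMap f g s t

/-- The canonical map `E ⊗ (F ⊗ G) → (E ⊗ F) ⊗ G`. -/
noncomputable def tensorAssocInv (E F G : AnalyticSheaf n X) :
    ten E (ten F G) ⟶ ten (ten E F) G :=
  (SheafOfModules.tensorAssoc E F G).inv

omit [IsManifold 𝓘(ℂ, Fin n → ℂ) ∞ X] in
theorem map_tensorAssocInv (s : E.Sec V) (t : F.Sec V) (w : G.Sec V) :
    map (tensorAssocInv E F G) V (tmul s (tmul t w)) = tmul (tmul s t) w :=
  map_tensorAssoc_inv s t w

/-- The isomorphism `(E ⊗ F) ⊗ G → (E ⊗ G) ⊗ F` given by `(s ⊗ t) ⊗ w ↦ (s ⊗ w) ⊗ t`. -/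
noncomputable def tensorRightComm (E F G : AnalyticSheaf n X) :
    ten (ten E F) G ⟶ ten (ten E G) F :=
  (SheafOfModules.tensorAssoc E F G).hom ≫
    SheafOfModules.tensorMap (𝟙 E) (SheafOfModules.tensorComm F G).hom ≫
      tensorAssocInv E G F

omit [IsManifold 𝓘(ℂ, Fin n → ℂ) ∞ X] in
theorem map_tensorRightComm (s : E.Sec V) (t : F.Sec V) (w : G.Sec V) :
    map (tensorRightComm E F G) V (tmul (tmul s t) w) = tmul (tmul s w) t := by
  rw [tensorRightComm, map_comp, map_comp, map_tensorAssoc, map_tensorMap, map_id,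
    map_tensorComm, map_tensorAssocInv]

/-- The Higgs field of a tensor product. -/
noncomputable def tensorField (φ : E ⟶ ten E (Omega n X 1)) (ψ : F ⟶ ten F (Omega n X 1)) :
    ten E F ⟶ ten (ten E F) (Omega n X 1) :=
  ((HiggsPair.mk E φ).tensor (HiggsPair.mk F ψ)).field

theorem map_tensorField (φ : E ⟶ ten E (Omega n X 1)) (ψ : F ⟶ ten F (Omega n X 1)) (s : E.Sec V)
    (t : F.Sec V) : map (tensorField φ ψ) V (tmul s t) =
      map (tensorRightComm E (Omega n X 1) F) V (tmul (map φ V s) t) +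
      map (tensorAssocInv E F (Omega n X 1)) V (tmul s (map ψ V t)) := by
  have h : map (tensorField φ ψ) V (tmul s t) =
    map (tensorRightComm E (Omega n X 1) F) V
      (map (SheafOfModules.tensorMap φ (𝟙 F)) V (tmul s t)) +
    map (tensorAssocInv E F (Omega n X 1)) V
      (map (SheafOfModules.tensorMap (𝟙 E) ψ) V (tmul s t)) := rfl
  rw [h, map_tensorMap, map_tensorMap, map_id, map_id]

/-- Contraction with `β` acts on the form factor only, so it commutes with moving `t` past that
factor; on pure tensors both sides are visibly equal. -/
theorem wedgeRight_tensorRightComm (u : (ten E (Omega n X 1)).Sec V) (t : F.Sec V)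
    (β : (Omega n X 1).Sec V) :
    map (wedgeRight (ten E F)) V (tmul (map (tensorRightComm E (Omega n X 1) F) V (tmul u t)) β) =
      map (tensorRightComm E (Omega n X 2) F) V
        (tmul (map (wedgeRight E) V (tmul u β)) t) := by
  refine eq_of_locally_eq fun x hx => ?_
  obtain ⟨W, hW, hxW, k, a, b, hu⟩ := exists_sum_tmul u hx
  refine ⟨W, hW, hxW, ?_⟩
  simp only [← map_res, res_tmul, hu, sum_tmul, map_sum, map_tensorRightComm, map_wedgeRight]

theorem wedgeRight_tensorAssocInv (s : E.Sec V) (u : (ten F (Omega n X 1)).Sec V)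
    (β : (Omega n X 1).Sec V) :
    map (wedgeRight (ten E F)) V
        (tmul (map (tensorAssocInv E F (Omega n X 1)) V (tmul s u)) β) =
      map (tensorAssocInv E F (Omega n X 2)) V
        (tmul s (map (wedgeRight F) V (tmul u β))) := by
  refine eq_of_locally_eq fun x hx => ?_
  obtain ⟨W, hW, hxW, k, a, b, hu⟩ := exists_sum_tmul u hx
  refine ⟨W, hW, hxW, ?_⟩
  simp only [← map_res, res_tmul, hu, sum_tmul, tmul_sum, map_sum, map_tensorAssocInv,
    map_wedgeRight]

/-- Modulo the canonical isomorphisms, the square on `s ⊗ t` is `(φ ∧ φ)(s) ⊗ t + s ⊗ (ψ ∧ ψ)(t)`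
plus the sum of `aᵢ ⊗ bⱼ ⊗ (βⱼ ∧ αᵢ + αᵢ ∧ βⱼ)`, and each of these terms vanishes. -/
theorem map_fieldSquare_tensorField_tmul {φ : E ⟶ ten E (Omega n X 1)}
    {ψ : F ⟶ ten F (Omega n X 1)} (hφ : fieldSquare φ = 0) (hψ : fieldSquare ψ = 0)
    {k l : ℕ} {s : E.Sec V} {t : F.Sec V} {a : Fin k → E.Sec V} {b : Fin l → F.Sec V}
    {α : Fin k → (Omega n X 1).Sec V} {β : Fin l → (Omega n X 1).Sec V}
    (hs : map φ V s = ∑ i, tmul (a i) (α i)) (ht : map ψ V t = ∑ i, tmul (b i) (β i)) :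
    map (fieldSquare (tensorField φ ψ)) V (tmul s t) = 0 := by
  -- The field sends `s ⊗ t` to the sum of the `(aᵢ ⊗ t) ⊗ αᵢ` and the `(s ⊗ bⱼ) ⊗ βⱼ`, an expansion
  -- indexed by a disjoint union.
  have h := map_fieldSquare (tensorField φ ψ) (V := V) (s := tmul s t)
    (a := Sum.elim (fun i => tmul (a i) t) fun j => tmul s (b j)) (α := Sum.elim α β) (by
      rw [map_tensorField, hs, ht, sum_tmul, tmul_sum, map_sum, map_sum, Fintype.sum_sum_type]
      simp only [map_tensorRightComm, map_tensorAssocInv, Sum.elim_inl, Sum.elim_inr])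
  rw [h, Fintype.sum_sum_type]
  simp only [Sum.elim_inl, Sum.elim_inr, map_tensorField, add_tmul, map_add,
    Finset.sum_add_distrib, wedgeRight_tensorRightComm, wedgeRight_tensorAssocInv]
  have e1 := map_fieldSquare φ hs
  have e2 := map_fieldSquare ψ ht
  rw [hφ, map_zero_hom] at e1
  rw [hψ, map_zero_hom] at e2
  -- The unmixed terms assemble into `(φ ∧ φ)(s) ⊗ t` and `s ⊗ (ψ ∧ ψ)(t)`, both zero.
  rw [← map_sum (map (tensorRightComm E _ F) V) (fun i => tmul (map (wedgeRight E) V _) t),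
    ← sum_tmul, ← e1, zero_tmul, map_zero, zero_add,
    ← map_sum (map (tensorAssocInv E F _) V) (fun i => tmul s _), ← tmul_sum, ← e2, tmul_zero,
    map_zero, add_zero]
  simp only [hs, ht, sum_tmul, tmul_sum, map_sum, map_wedgeRight, map_tensorRightComm,
    map_tensorAssocInv]
  -- Only the two mixed double sums remain; bringing them to the same order pairs `βⱼ ∧ αᵢ` with `αᵢ
  -- ∧ βⱼ`.
  rw [Finset.sum_comm, ← Finset.sum_add_distrib]
  refine Finset.sum_eq_zero fun j _ => ?_
  rw [← Finset.sum_add_distrib]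
  refine Finset.sum_eq_zero fun i _ => ?_
  rw [← tmul_add, wedgeSec_comm, tmul_zero]

theorem fieldSquare_tensorField {φ : E ⟶ ten E (Omega n X 1)} {ψ : F ⟶ ten F (Omega n X 1)}
    (hφ : fieldSquare φ = 0) (hψ : fieldSquare ψ = 0) : fieldSquare (tensorField φ ψ) = 0 := by
  refine tensor_hom_ext fun V s t => eq_of_locally_eq fun x hx => ?_
  obtain ⟨W₁, hW₁, hx₁, k, a, α, h1⟩ := exists_sum_tmul (map φ V s) hx
  obtain ⟨W, hW, hxW, l, b, β, h2⟩ := exists_sum_tmul (res hW₁ (map ψ V t)) hx₁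
  refine ⟨W, hW.trans hW₁, hxW, ?_⟩
  rw [res_res, ← map_res] at h2
  replace h1 := congrArg (res hW) h1
  simp only [res_res, ← map_res, res_sum, res_tmul] at h1
  have h := map_fieldSquare_tensorField_tmul hφ hψ h1 h2
  rw [← res_tmul, map_res] at h
  rw [h, map_zero_hom, res_zero]

/-- Naturality of `φ ∧ φ` along morphisms compatible with the Higgs fields. Applied to the
inclusions of the summands, it reduces the direct sum to its two factors. -/
theorem fieldSquare_comp {φ : E ⟶ ten E (Omega n X 1)} {ψ : F ⟶ ten F (Omega n X 1)} (f : E ⟶ F)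
    (hf : f ≫ ψ = φ ≫ tenMap f (𝟙 (Omega n X 1))) :
    f ≫ fieldSquare ψ = fieldSquare φ ≫ tenMap f (𝟙 (Omega n X 2)) := by
  have key : ∀ (V : Opens X) (u : (ten E (Omega n X 1)).Sec V) (α : (Omega n X 1).Sec V),
      map (wedgeRight F) V (tmul (map (tenMap f (𝟙 _)) V u) α) =
        map (tenMap f (𝟙 _)) V (map (wedgeRight E) V (tmul u α)) := by
    intro V u α
    refine eq_of_locally_eq fun x hx => ?_
    obtain ⟨W, hW, hxW, k, a, b, hu⟩ := exists_sum_tmul u hx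
    refine ⟨W, hW, hxW, ?_⟩
    simp only [← map_res, res_tmul, hu, sum_tmul, map_sum, map_tenMap, map_wedgeRight, map_id]
  have hf' : ∀ (V : Opens X) (s : E.Sec V), map ψ V (map f V s) =
      map (tenMap f (𝟙 (Omega n X 1))) V (map φ V s) := fun V s =>
    congrArg (fun k => map k V s) hf
  refine hom_ext fun V s => eq_of_locally_eq fun x hx => ?_
  obtain ⟨W, hW, hxW, k, a, α, hs⟩ := exists_sum_tmul (map φ V s) hx
  refine ⟨W, hW, hxW, ?_⟩
  rw [← map_res, ← map_res, map_comp, map_comp]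
  rw [← map_res] at hs
  rw [map_fieldSquare φ hs, map_fieldSquare ψ (a := fun i => map f W (a i)) (α := α) (by
    simp only [hf', hs, map_sum, map_tenMap, map_id])]
  simp only [map_sum, hf', key]

theorem HiggsPair.fieldSquare_tensor {H₁ H₂ : HiggsPair n X} (h₁ : H₁.fieldSquare = 0)
    (h₂ : H₂.fieldSquare = 0) : (H₁.tensor H₂).fieldSquare = 0 :=
  fieldSquare_tensorField (φ := H₁.field) (ψ := H₂.field) h₁ h₂

theorem HiggsPair.fieldSquare_directSum {H₁ H₂ : HiggsPair n X} (h₁ : H₁.fieldSquare = 0)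
    (h₂ : H₂.fieldSquare = 0) : (H₁.directSum H₂).fieldSquare = 0 := by
  let χ : (H₁.sheaf ⊞ H₂.sheaf : AnalyticSheaf n X) ⟶
      ten (H₁.sheaf ⊞ H₂.sheaf : AnalyticSheaf n X) (Omega n X 1) := (H₁.directSum H₂).field
  have e1 := fieldSquare_comp (φ := H₁.field) (ψ := χ) biprod.inl (by
    simp [χ, HiggsPair.directSum]; rfl)
  have e2 := fieldSquare_comp (φ := H₂.field) (ψ := χ) biprod.inr (by
    simp [χ, HiggsPair.directSum]; rfl)
  replace h₁ : Higgs.fieldSquare H₁.field = 0 := h₁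
  replace h₂ : Higgs.fieldSquare H₂.field = 0 := h₂
  rw [h₁, zero_comp] at e1
  rw [h₂, zero_comp] at e2
  -- A morphism out of a biproduct is determined by its composites with the two inclusions.
  exact biprod.hom_ext' (f := Higgs.fieldSquare χ) (g := 0) (by rw [e1, comp_zero])
    (by rw [e2, comp_zero])

end HiggsFields

/-! ### Local presentations and coherence -/

section Coherence

namespace AnalyticSheaf

variable {n : ℕ} {X : Type} [TopologicalSpace X] [ChartedSpace (Fin n → ℂ) X]
  {E F : AnalyticSheaf n X} {V W : Opens X} {ι κ ι' κ' : Type} [Fintype ι] [Fintype κ] [Fintype ι']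
  [Fintype κ']

/-- The sections `s` generate the sheaf `E` over `V`. -/
def Generates (s : ι → E.Sec V) : Prop :=
  ∀ (W : Opens X) (hW : W ≤ V) (t : E.Sec W), ∀ y ∈ W, ∃ (W' : Opens X) (hW' : W' ≤ W),
    y ∈ W' ∧ ∃ a : ι → HolFun n W', res hW' t = ∑ i, a i • res (hW'.trans hW) (s i)

/-- Generators `s` and relations `ρ` present the sheaf `E` over `V`. -/
structure IsPresentation (s : ι → E.Sec V) (ρ : κ → ι → HolFun n V) : Prop where
  rel : ∀ j, ∑ i, ρ j i • s i = 0
  gen : Generates s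
  syz : ∀ (W : Opens X) (hW : W ≤ V) (a : ι → HolFun n W), ∑ i, a i • res hW (s i) = 0 →
    ∀ y ∈ W, ∃ (W' : Opens X) (hW' : W' ≤ W), y ∈ W' ∧ ∃ b : κ → HolFun n W',
      ∀ i, (a i).res hW' = ∑ j, b j * (ρ j i).res (hW'.trans hW)

theorem Generates.reindex {s : ι → E.Sec V} (h : Generates s) (e : ι' ≃ ι) : Generates (s ∘ e) := by
  intro W hW t y hy
  obtain ⟨W', hW', hy', a, ha⟩ := h W hW t y hy
  refine ⟨W', hW', hy', a ∘ e, ?_⟩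
  rw [ha, ← e.sum_comp]
  rfl

theorem Generates.restrict {s : ι → E.Sec V} (h : Generates s) (hW : W ≤ V) :
    Generates fun i => res hW (s i) := by
  intro U hU t y hy
  simpa only [res_res] using h U (hU.trans hW) t y hy

theorem IsPresentation.reindex {s : ι → E.Sec V} {ρ : κ → ι → HolFun n V} (h : IsPresentation s ρ)
    (e : ι' ≃ ι) (f : κ' ≃ κ) : IsPresentation (s ∘ e) fun j i => ρ (f j) (e i) where
  rel j := by
    rw [← h.rel (f j), ← e.sum_comp]
    rfl
  gen := h.gen.reindex e
  syz W hW a ha y hy := by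
    obtain ⟨W', hW', hy', b, hb⟩ := h.syz W hW (a ∘ e.symm) (by
      rw [← ha, ← e.sum_comp]
      simp) y hy
    refine ⟨W', hW', hy', b ∘ f, fun i => ?_⟩
    have := hb (e i)
    simp only [Function.comp_apply, Equiv.symm_apply_apply] at this
    rw [this, ← f.sum_comp]
    rfl

theorem IsPresentation.restrict {s : ι → E.Sec V} {ρ : κ → ι → HolFun n V}
    (h : IsPresentation s ρ) (hW : W ≤ V) :
    IsPresentation (fun i => res hW (s i)) fun j i => (ρ j i).res hW where
  rel j := by
    have := congrArg (res hW) (h.rel j)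
    simpa only [res_sum, res_smul, res_zero] using this
  gen := h.gen.restrict hW
  syz U hU a ha y hy := by
    simp only [res_res] at ha
    exact h.syz U (hU.trans hW) a ha y hy

/-- Arbitrary finite index types are convenient because the presentations built below are indexed by
products and disjoint unions. -/
theorem isCoherent_iff : E.IsCoherent ↔ ∀ x : X, ∃ V : Opens X, x ∈ V ∧ ∃ (ι κ : Type)
    (_ : Fintype ι) (_ : Fintype κ) (s : ι → E.Sec V) (ρ : κ → ι → HolFun n V),
      IsPresentation s ρ := by
  constructor
  · intro h x
    obtain ⟨V, hx, p, q, s, ρ, h1, h2, h3⟩ := h x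
    exact ⟨V, hx, Fin p, Fin q, inferInstance, inferInstance, s, ρ, h1, h2, h3⟩
  · intro h x
    obtain ⟨V, hx, ι, κ, _, _, s, ρ, h1⟩ := h x
    obtain ⟨h1, h2, h3⟩ := h1.reindex (Fintype.equivFin ι).symm (Fintype.equivFin κ).symm
    exact ⟨V, hx, _, _, _, _, h1, h2, h3⟩

theorem Generates.exists_common {s : ι → E.Sec V} (hs : Generates s) (hW : W ≤ V) {α : Type*}
    [Finite α] (t : α → E.Sec W) {y : X} (hy : y ∈ W) :
    ∃ (W' : Opens X) (hW' : W' ≤ W), y ∈ W' ∧ ∃ a : α → ι → HolFun n W',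
      ∀ k, res hW' (t k) = ∑ i, a k i • res (hW'.trans hW) (s i) := by
  choose f hf hy' a ha using fun k => hs W hW (t k) y hy
  obtain ⟨W', hW', hyW', hle⟩ := exists_common_nhd hy f hy'
  refine ⟨W', hW', hyW', fun k i => (a k i).res (hle k), fun k => ?_⟩
  have := congrArg (res (hle k)) (ha k)
  simpa only [res_res, res_sum, res_smul] using this

theorem IsPresentation.exists_common {s : ι → E.Sec V} {ρ : κ → ι → HolFun n V}
    (hs : IsPresentation s ρ) (hW : W ≤ V) {α : Type*} [Finite α] (a : α → ι → HolFun n W)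
    (ha : ∀ k, ∑ i, a k i • res hW (s i) = 0) {y : X} (hy : y ∈ W) :
    ∃ (W' : Opens X) (hW' : W' ≤ W), y ∈ W' ∧ ∃ b : α → κ → HolFun n W',
      ∀ k i, (a k i).res hW' = ∑ j, b k j * (ρ j i).res (hW'.trans hW) := by
  choose f hf hy' b hb using fun k => hs.syz W hW (a k) (ha k) y hy
  obtain ⟨W', hW', hyW', hle⟩ := exists_common_nhd hy f hy'
  refine ⟨W', hW', hyW', fun k i => (b k i).res (hle k), fun k i => ?_⟩
  have := congrArg (HolFun.res (hle k)) (hb k i)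
  simpa only [HolFun.res_res, HolFun.res_sum, HolFun.res_mul] using this

theorem Generates.tensor {s : ι → E.Sec V} {s' : ι' → F.Sec V} (hs : Generates s)
    (hs' : Generates s') :
    Generates (E := ten E F) fun i : ι × ι' => tmul (s i.1) (s' i.2) := by
  intro W hW t y hy
  obtain ⟨W₁, hW₁, hy₁, k, a, b, ht⟩ := exists_sum_tmul t hy
  obtain ⟨W₂, hW₂, hy₂, c, hc⟩ := hs.exists_common (hW₁.trans hW) a hy₁
  obtain ⟨W₃, hW₃, hy₃, d, hd⟩ := hs'.exists_common (hW₂.trans (hW₁.trans hW))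
    (fun k => res hW₂ (b k)) hy₂
  refine ⟨W₃, hW₃.trans (hW₂.trans hW₁), hy₃, fun i => ∑ k, (c k i.1).res hW₃ * d k i.2, ?_⟩
  have h := congrArg (res (hW₃.trans hW₂)) ht
  have hc' := fun k => congrArg (res hW₃) (hc k)
  simp only [res_res, res_sum, res_tmul, res_smul] at h hc' hd
  rw [h]
  simp only [hc', hd, sum_tmul, tmul_sum, smul_tmul, tmul_smul, res_tmul, smul_smul,
    Fintype.sum_prod_type, Finset.sum_smul, Finset.smul_sum]
  rw [Finset.sum_comm]
  simp only [fun x => Finset.sum_comm (s := (Finset.univ : Finset (Fin k)))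
    (t := (Finset.univ : Finset ι)) (f := x)]
  rw [Finset.sum_comm]
  simp only [mul_comm]

/-- Right exactness of `- ⊗ F` applied to `𝒪^κ → 𝒪^ι → E → 0`, at the level of sections. As `𝒪^ι →
E` is surjective only locally, the algebraic statement on one open set is not enough. The equational
criterion for vanishing reduces the matter to finitely many elements `z` of `E`, which are lifted to
`𝒪^ι` after shrinking. -/
theorem IsPresentation.exists_of_sum_tmul_eq_zero {s : ι → E.Sec V} {ρ : κ → ι → HolFun n V}
    (hs : IsPresentation s ρ) (hW : W ≤ V) (t : ι → F.Sec W)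
    (h : ∑ i, tmul (res hW (s i)) (t i) = 0) {y : X} (hy : y ∈ W) :
    ∃ (W' : Opens X) (hW' : W' ≤ W), y ∈ W' ∧ ∃ m : κ → F.Sec W',
      ∀ i, res hW' (t i) = ∑ j, (ρ j i).res (hW'.trans hW) • m j := by
  classical
  -- Vanishing in the sheaf becomes vanishing in the algebraic tensor product on a smaller open set.
  obtain ⟨W₁, hW₁, hy₁, h0⟩ := resTensor_eq_of_ofTensor_eq (E := E) (F := F)
    (u := ∑ i, res hW (s i) ⊗ₜ t i) (v := 0) (by
      simpa only [map_sum, map_zero, tmul_eq] using h) hy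
  simp only [map_sum, map_zero, resTensor_tmul, res_res] at h0
  let f : (ι → HolFun n W₁) →ₗ[HolFun n W₁] E.Sec W₁ :=
    Fintype.linearCombination (HolFun n W₁) fun i => res (hW₁.trans hW) (s i)
  have hf : ∀ a, f a = ∑ i, a i • res (hW₁.trans hW) (s i) := fun a => rfl
  obtain ⟨ι₂, κ₂, _, _, A, m, c, z, hx, hA, hm⟩ :=
    TensorRelations.exists_relation_of_rTensor_eq_zero f
      (∑ i, Pi.single i (1 : HolFun n W₁) ⊗ₜ[HolFun n W₁] res hW₁ (t i)) (by
        simp only [map_sum, LinearMap.rTensor_tmul, hf]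
        simpa [Pi.single_apply, ite_smul] using h0)
  -- The `i`-th coordinate `𝒪^ι ⊗ F → F` applied to the two expressions for the sum of the `eᵢ ⊗
  -- tᵢ`.
  have hn : ∀ i, res hW₁ (t i) = ∑ k, A k i • m k := by
    intro i
    have := congrArg (TensorProduct.lift ((LinearMap.lsmul (HolFun n W₁) (F.Sec W₁)).comp
      (LinearMap.proj i : (ι → HolFun n W₁) →ₗ[HolFun n W₁] HolFun n W₁))) hx
    simpa [Pi.single_apply, ite_smul] using this
  obtain ⟨W₂, hW₂, hy₂, z', hz⟩ := hs.gen.exists_common (hW₁.trans hW) z hy₁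
  -- `A k` and the combination of the lifts `z'` with coefficients `c k j` have the same image in
  -- `E`, so their difference is a syzygy and hence locally a combination of the rows of `ρ`.
  obtain ⟨W₃, hW₃, hy₃, b, hb⟩ := hs.exists_common (hW₂.trans (hW₁.trans hW))
    (fun k i => (A k i).res hW₂ - ∑ j, (c k j).res hW₂ * z' j i) (by
      intro k
      have h1 := congrArg (res hW₂) (hA k)
      simp only [hf, res_sum, res_smul, res_res, hz] at h1
      simp only [sub_smul, Finset.sum_sub_distrib, h1, Finset.sum_smul, Finset.smul_sum, smul_smul]
      rw [Finset.sum_comm, sub_self]) hy₂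
  refine ⟨W₃, hW₃.trans (hW₂.trans hW₁), hy₃,
    fun l => ∑ k, b k l • res (hW₃.trans hW₂) (m k), fun i => ?_⟩
  have h1 := congrArg (res (hW₃.trans hW₂)) (hn i)
  simp only [res_sum, res_smul, res_res] at h1
  have h2 : ∀ k, (A k i).res (hW₃.trans hW₂) =
      ∑ j, b k j * (ρ j i).res (hW₃.trans (hW₂.trans (hW₁.trans hW))) +
        ∑ j, (c k j).res (hW₃.trans hW₂) * (z' j i).res hW₃ := by
    intro k
    rw [← hb k i, ← sub_eq_iff_eq_add]
    simp only [← HolFun.resHom_apply, map_sub, map_sum, map_mul]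
    rfl
  -- The choice of lifts does not matter: their contribution is a multiple of the sums of the `c k j
  -- • m k` over `k`, which vanish.
  have h3 : ∑ k, (∑ j, (c k j).res (hW₃.trans hW₂) * (z' j i).res hW₃) •
      res (hW₃.trans hW₂) (m k) = 0 := by
    simp only [Finset.sum_smul]
    rw [Finset.sum_comm]
    refine Finset.sum_eq_zero fun j _ => ?_
    have h4 := congrArg (res (hW₃.trans hW₂)) (hm j)
    simp only [res_sum, res_smul, res_zero] at h4
    simp only [mul_comm _ ((z' j i).res hW₃), mul_smul]
    rw [← Finset.smul_sum, h4, smul_zero]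
  rw [h1]
  simp only [h2, add_smul, Finset.sum_add_distrib]
  rw [h3, add_zero]
  simp only [Finset.sum_smul, Finset.smul_sum, smul_smul]
  rw [Finset.sum_comm]
  simp only [mul_comm]

/-- The kernel of `𝒪^ι ⊗ 𝒪^ι' → E ⊗ F` is generated by the relations of one factor tensored with the
generators of the other, in both ways. A syzygy is corrected by relations of the first kind until
every row of coefficients is a syzygy of `s'`. -/
theorem IsPresentation.tensor [DecidableEq ι] [DecidableEq ι'] {s : ι → E.Sec V}
    {ρ : κ → ι → HolFun n V} {s' : ι' → F.Sec V} {ρ' : κ' → ι' → HolFun n V}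
    (hs : IsPresentation s ρ) (hs' : IsPresentation s' ρ') :
    IsPresentation (E := ten E F) (fun i : ι × ι' => tmul (s i.1) (s' i.2))
      (Sum.elim (fun (j : κ × ι') i => if i.2 = j.2 then ρ j.1 i.1 else 0)
        fun (j : ι × κ') i => if i.1 = j.1 then ρ' j.2 i.2 else 0) where
  rel := by
    rintro (⟨j, i'⟩ | ⟨i, j'⟩)
    · simp only [Sum.elim_inl, Fintype.sum_prod_type, ite_smul, zero_smul, Finset.sum_ite_eq',
        Finset.mem_univ, if_true]
      simp only [← smul_tmul, ← sum_tmul, hs.rel, zero_tmul]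
    · simp only [Sum.elim_inr, Fintype.sum_prod_type_right, ite_smul, zero_smul,
        Finset.sum_ite_eq', Finset.mem_univ, if_true]
      simp only [← tmul_smul, ← tmul_sum, hs'.rel, tmul_zero]
  gen := hs.gen.tensor hs'.gen
  syz W hW a ha y hy := by
    -- Grouping by `i` rewrites the syzygy as a vanishing sum of `sᵢ ⊗ tᵢ`, where `tᵢ` is the
    -- combination of the `s'` with coefficients from row `i` of `a`.
    obtain ⟨W₁, hW₁, hy₁, m, hm⟩ := hs.exists_of_sum_tmul_eq_zero hW
      (fun i => ∑ i', a (i, i') • res hW (s' i')) (by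
        rw [← ha]
        simp only [Fintype.sum_prod_type, tmul_sum, tmul_smul, res_tmul]) hy
    obtain ⟨W₂, hW₂, hy₂, d, hd⟩ := hs'.gen.exists_common (hW₁.trans hW) m hy₁
    -- After expanding `m j` in the generators `s'`, with coefficients `d j`, the row `i` of `a`
    -- minus that of `ρᵀ d` is a syzygy of `s'`.
    obtain ⟨W₃, hW₃, hy₃, g, hg⟩ := hs'.exists_common (hW₂.trans (hW₁.trans hW))
      (fun i i' => (a (i, i')).res (hW₂.trans hW₁) -
        ∑ j, (ρ j i).res (hW₂.trans (hW₁.trans hW)) * d j i') (by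
        intro i
        have h1 := congrArg (res hW₂) (hm i)
        simp only [res_sum, res_smul, res_res, hd, HolFun.res_res] at h1
        simp only [sub_smul, Finset.sum_sub_distrib, h1, Finset.sum_smul, Finset.smul_sum,
          smul_smul]
        rw [Finset.sum_comm, sub_self]) hy₂
    refine ⟨W₃, hW₃.trans (hW₂.trans hW₁), hy₃,
      Sum.elim (fun j => (d j.1 j.2).res hW₃) fun j => g j.1 j.2, ?_⟩
    rintro ⟨i, i'⟩
    have h1 := hg i i'
    rw [Fintype.sum_sum_type]
    simp only [← HolFun.resHom_apply, map_sub, map_sum, map_mul] at h1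
    rw [sub_eq_iff_eq_add] at h1
    simp only [Sum.elim_inl, Sum.elim_inr, Fintype.sum_prod_type, ← HolFun.resHom_apply, apply_ite,
      map_zero, mul_zero, Finset.sum_ite_eq, Finset.mem_univ, if_true]
    have h2 : ∀ x, (∑ j, if i = x then g x j * HolFun.resHom (hW₃.trans (hW₂.trans
        (hW₁.trans hW))) (ρ' j i') else 0) = if i = x then ∑ j, g x j * HolFun.resHom
        (hW₃.trans (hW₂.trans (hW₁.trans hW))) (ρ' j i') else 0 := fun x => by
      split_ifs <;> simp
    rw [Finset.sum_congr rfl fun x _ => h2 x, Finset.sum_ite_eq, if_pos (Finset.mem_univ _),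
      add_comm]
    refine h1.trans (congrArg₂ _ rfl (Finset.sum_congr rfl fun x _ => mul_comm _ _))

theorem IsPresentation.directSum {s : ι → E.Sec V}
    {ρ : κ → ι → HolFun n V} {s' : ι' → F.Sec V} {ρ' : κ' → ι' → HolFun n V}
    (hs : IsPresentation s ρ) (hs' : IsPresentation s' ρ') :
    IsPresentation (E := (E ⊞ F : AnalyticSheaf n X))
      (Sum.elim (fun i => inl V (s i)) fun i => inr V (s' i))
      (Sum.elim (fun j => Sum.elim (ρ j) 0) fun j => Sum.elim 0 (ρ' j)) where
  rel := by
    rintro (j | j)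
    · simp only [Fintype.sum_sum_type, Sum.elim_inl, Sum.elim_inr, Pi.zero_apply, zero_smul,
        Finset.sum_const_zero, add_zero, ← map_smul, ← map_sum, hs.rel, map_zero]
    · simp only [Fintype.sum_sum_type, Sum.elim_inl, Sum.elim_inr, Pi.zero_apply, zero_smul,
        Finset.sum_const_zero, zero_add, ← map_smul, ← map_sum, hs'.rel, map_zero]
  gen := by
    intro W hW t y hy
    obtain ⟨W₁, hW₁, hy₁, a, ha⟩ := hs.gen W hW (fst W t) y hy
    obtain ⟨W₂, hW₂, hy₂, b, hb⟩ := hs'.gen W₁ (hW₁.trans hW) (res hW₁ (snd W t)) y hy₁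
    refine ⟨W₂, hW₂.trans hW₁, hy₂, Sum.elim (fun i => (a i).res hW₂) b, ?_⟩
    have h1 := congrArg (res hW₂) ha
    simp only [res_res, res_sum, res_smul] at h1 hb
    rw [← inl_fst_add_inr_snd t]
    simp only [res_add, Fintype.sum_sum_type, Sum.elim_inl, Sum.elim_inr, ← map_res,
      ← map_smul, ← map_sum]
    rw [← h1, ← hb]
    simp only [map_res]
  syz W hW a ha y hy := by
    simp only [Fintype.sum_sum_type, Sum.elim_inl, Sum.elim_inr, ← map_res, ← map_smul,
      ← map_sum] at ha
    have h1 := congrArg (fst W) ha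
    have h2 := congrArg (snd W) ha
    simp only [map_add, fst_inl, fst_inr, snd_inl, snd_inr, map_zero, add_zero, zero_add] at h1 h2
    obtain ⟨W₁, hW₁, hy₁, b, hb⟩ := hs.syz W hW _ h1 y hy
    obtain ⟨W₂, hW₂, hy₂, b', hb'⟩ := hs'.syz W₁ (hW₁.trans hW) (fun i => (a (Sum.inr i)).res hW₁)
      (by simpa only [res_res, res_sum, res_smul, res_zero] using congrArg (res hW₁) h2) y hy₁
    refine ⟨W₂, hW₂.trans hW₁, hy₂, Sum.elim (fun j => (b j).res hW₂) b', ?_⟩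
    rintro (i | i)
    · have := congrArg (HolFun.res hW₂) (hb i)
      simpa [Fintype.sum_sum_type] using this
    · simpa [Fintype.sum_sum_type] using hb' i

theorem IsCoherent.tensor (hE : E.IsCoherent) (hF : F.IsCoherent) : (ten E F).IsCoherent := by
  classical
  rw [isCoherent_iff] at *
  intro x
  obtain ⟨V₁, h₁, ι, κ, _, _, s, ρ, hs⟩ := hE x
  obtain ⟨V₂, h₂, ι', κ', _, _, s', ρ', hs'⟩ := hF x
  exact ⟨V₁ ⊓ V₂, ⟨h₁, h₂⟩, _, _, inferInstance, inferInstance, _, _,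
    (hs.restrict inf_le_left).tensor (hs'.restrict inf_le_right)⟩

theorem IsCoherent.directSum (hE : E.IsCoherent) (hF : F.IsCoherent) :
    (E ⊞ F : AnalyticSheaf n X).IsCoherent := by
  rw [isCoherent_iff] at *
  intro x
  obtain ⟨V₁, h₁, ι, κ, _, _, s, ρ, hs⟩ := hE x
  obtain ⟨V₂, h₂, ι', κ', _, _, s', ρ', hs'⟩ := hF x
  exact ⟨V₁ ⊓ V₂, ⟨h₁, h₂⟩, _, _, inferInstance, inferInstance, _, _,
    (hs.restrict inf_le_left).directSum (hs'.restrict inf_le_right)⟩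

end AnalyticSheaf

end Coherence

/-! ### Local frames, change of frame and the bound on the rank -/

section Frames

namespace AnalyticSheaf

variable {n : ℕ} {X : Type} [TopologicalSpace X] [ChartedSpace (Fin n → ℂ) X]
  {E F : AnalyticSheaf n X} {V V' W : Opens X} {ι κ ι' : Type} [Fintype ι] [Fintype κ] [Fintype ι']

theorem IsFrame.restrict {e : ι → E.Sec V} (h : IsFrame e) (hW : W ≤ V) :
    IsFrame fun i => res hW (e i) := by
  intro U hU
  simpa only [res_res] using h U (hU.trans hW)

theorem IsFrame.coeff_eq {e : ι → E.Sec V} (h : IsFrame e) (hW : W ≤ V) {a b : ι → HolFun n W}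
    (hab : ∑ i, a i • res hW (e i) = ∑ i, b i • res hW (e i)) : a = b :=
  (h W hW).1 hab

theorem IsFrame.exists_coeff {e : ι → E.Sec V} (h : IsFrame e) (hW : W ≤ V) (s : E.Sec W) :
    ∃ a : ι → HolFun n W, s = ∑ i, a i • res hW (e i) := by
  obtain ⟨a, ha⟩ := (h W hW).2 s
  exact ⟨a, ha.symm⟩

theorem IsFrame.generates {e : ι → E.Sec V} (h : IsFrame e) : Generates e := by
  intro W hW t y hy
  obtain ⟨a, ha⟩ := h.exists_coeff hW t
  exact ⟨W, le_rfl, hy, a, by rw [res_self, ha]⟩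

/-- A frame is a presentation without relations. With the converse `IsPresentation.isFrame`, this
turns the results on presentations of tensor products and direct sums into results on frames. -/
theorem IsFrame.isPresentation [IsEmpty κ] {e : ι → E.Sec V} (h : IsFrame e) :
    IsPresentation e fun (j : κ) (_ : ι) => isEmptyElim j where
  rel j := isEmptyElim j
  gen := h.generates
  syz W hW a ha y hy := by
    have h0 : a = 0 := h.coeff_eq hW (by simp [ha])
    exact ⟨W, le_rfl, hy, fun j => isEmptyElim j, fun i => by simp [h0]⟩

/-- Holomorphy is local, so a function that is locally given by holomorphic functions is one. -/
theorem exists_holFun (f : W → ℂ) (h : ∀ x : W, ∃ (U : Opens X) (hU : U ≤ W), (x : X) ∈ U ∧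
    ∃ g : HolFun n U, ∀ z : U, g.eval z = f ⟨z, hU z.2⟩) : ∃ g : HolFun n W, ∀ z, g.eval z = f z := by
  refine ⟨(⟨f, (contDiffWithinAt_localInvariantProp (I := 𝓘(ℂ, Fin n → ℂ)) (I' := 𝓘(ℂ))
    ∞).localPredicate X ℂ |>.locality (U := W) f fun x => ?_⟩ :
    C^∞⟮𝓘(ℂ, Fin n → ℂ), W; 𝓘(ℂ), ℂ⟯), fun _ => rfl⟩
  obtain ⟨U, hU, hxU, g, hg⟩ := h x
  refine ⟨U, hxU, homOfLE hU, ?_⟩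
  have hgf : g.eval = fun z : U => f ⟨z, hU z.2⟩ := funext hg
  change ContMDiff 𝓘(ℂ, Fin n → ℂ) 𝓘(ℂ) ∞ (fun z : U => f ⟨z, hU z.2⟩)
  rw [← hgf]
  exact (show C^∞⟮𝓘(ℂ, Fin n → ℂ), U; 𝓘(ℂ), ℂ⟯ from g).contMDiff

/-- In the absence of relations the coefficients of a section are unique on every open set. The
local coefficients supplied by generation therefore agree on overlaps and glue. -/
theorem IsPresentation.isFrame [IsEmpty κ] {e : ι → E.Sec V} {ρ : κ → ι → HolFun n V}
    (h : IsPresentation e ρ) : IsFrame e := by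
  have inj : ∀ (W : Opens X) (hW : W ≤ V) (a b : ι → HolFun n W),
      ∑ i, a i • res hW (e i) = ∑ i, b i • res hW (e i) → a = b := by
    intro W hW a b hab
    funext i
    refine HolFun.ext_eval fun y => ?_
    obtain ⟨W', hW', hy, c, hc⟩ := h.syz W hW (a - b) (by
      simp only [Pi.sub_apply, sub_smul, Finset.sum_sub_distrib, hab, sub_self]) y y.2
    -- There are no relations, so the sum over `κ` is empty and the difference of coefficients
    -- vanishes near `y`.
    have h1 := hc i
    rw [Finset.univ_eq_empty, Finset.sum_empty] at h1
    exact sub_eq_zero.1 (congrArg (fun f : HolFun n W' => f.eval ⟨y, hy⟩) h1)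
  refine fun W hW => ⟨fun a b hab => inj W hW a b hab, fun t => ?_⟩
  choose U hU hyU a ha using fun y : W => h.gen W hW t y y.2
  -- By uniqueness on `U y ⊓ U z`, evaluating each local coefficient at its own centre gives a
  -- function that agrees with `a y i` on all of `U y`.
  have key : ∀ (y : W) (z : U y) (i : ι),
      (a y i).eval z = (a ⟨z, hU y z.2⟩ i).eval ⟨z, hyU ⟨z, hU y z.2⟩⟩ := by
    intro y z i
    let z' : W := ⟨z, hU y z.2⟩
    have h1 := congrArg (res (inf_le_left : U y ⊓ U z' ≤ U y)) (ha y)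
    have h2 := congrArg (res (inf_le_right : U y ⊓ U z' ≤ U z')) (ha z')
    simp only [res_res, res_sum, res_smul] at h1 h2
    have h3 := congrFun (inj _ _ _ _ (h1.symm.trans h2)) i
    exact congrArg (fun f : HolFun n (U y ⊓ U z') => f.eval ⟨z, z.2, hyU z'⟩) h3
  choose g hg using fun i => exists_holFun (n := n) (fun y : W => (a y i).eval ⟨y, hyU y⟩) fun y =>
    ⟨U y, hU y, hyU y, a y i, fun z => key y z i⟩
  refine ⟨g, eq_of_locally_eq fun y hy => ⟨U ⟨y, hy⟩, hU _, hyU ⟨y, hy⟩, ?_⟩⟩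
  rw [ha]
  simp only [res_sum, res_smul, res_res]
  refine Finset.sum_congr rfl fun i _ => congrArg (· • _) (HolFun.ext_eval fun z => ?_)
  rw [HolFun.eval_res, hg]
  exact (key ⟨y, hy⟩ z i).symm

theorem IsFrame.tensor {e : ι → E.Sec V} {e' : ι' → F.Sec V} (h : IsFrame e) (h' : IsFrame e') :
    IsFrame (E := ten E F) fun i : ι × ι' => tmul (e i.1) (e' i.2) := by
  classical
  exact ((h.isPresentation (κ := Empty)).tensor (h'.isPresentation (κ := Empty))).isFrame

theorem IsFrame.directSum {e : ι → E.Sec V} {e' : ι' → F.Sec V} (h : IsFrame e)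
    (h' : IsFrame e') : IsFrame (E := (E ⊞ F : AnalyticSheaf n X))
      (Sum.elim (fun i => inl V (e i)) fun i => inr V (e' i)) :=
  ((h.isPresentation (κ := Empty)).directSum (h'.isPresentation (κ := Empty))).isFrame

theorem IsFrame.reindex {e : ι → E.Sec V} (h : IsFrame e) (σ : ι' ≃ ι) : IsFrame (e ∘ σ) :=
  ((h.isPresentation (κ := Empty)).reindex σ (Equiv.refl Empty)).isFrame

/-- Two frames differ by an invertible matrix of holomorphic functions. -/
theorem IsFrame.exists_change [DecidableEq ι] [DecidableEq ι'] {e : ι → E.Sec V}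
    {e' : ι' → E.Sec V'} (h : IsFrame e) (h' : IsFrame e') (hW : W ≤ V) (hW' : W ≤ V') :
    ∃ (P : Matrix ι ι' (HolFun n W)) (Q : Matrix ι' ι (HolFun n W)),
      (∀ i, res hW (e i) = ∑ j, P i j • res hW' (e' j)) ∧ P * Q = 1 ∧ Q * P = 1 := by
  choose P hP using fun i => h'.exists_coeff hW' (res hW (e i))
  choose Q hQ using fun j => h.exists_coeff hW (res hW' (e' j))
  refine ⟨Matrix.of P, Matrix.of Q, hP, ?_, ?_⟩
  · funext i
    refine h.coeff_eq hW ?_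
    simp only [Matrix.mul_apply, Matrix.one_apply, ite_smul, one_smul, zero_smul,
      Finset.sum_ite_eq, Finset.mem_univ, if_true, Matrix.of_apply]
    conv_rhs => rw [hP i]
    simp only [hQ, Finset.smul_sum, Finset.sum_smul, smul_smul]
    exact Finset.sum_comm
  · funext j
    refine h'.coeff_eq hW' ?_
    simp only [Matrix.mul_apply, Matrix.one_apply, ite_smul, one_smul, zero_smul,
      Finset.sum_ite_eq, Finset.mem_univ, if_true, Matrix.of_apply]
    conv_rhs => rw [hQ j]
    simp only [hP, Finset.smul_sum, Finset.sum_smul, smul_smul]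
    exact Finset.sum_comm

/-- Expressing the frame in the generators and the generators in the frame factors the identity
matrix through `κ`; the comparison of ranks is made over the field `ℂ`, after evaluation at `x`. -/
theorem IsFrame.card_le [DecidableEq ι] {e : ι → E.Sec V} {s : κ → E.Sec V'} (h : IsFrame e)
    (hs : Generates s) {x : X} (hx : x ∈ V) (hx' : x ∈ V') : Fintype.card ι ≤ Fintype.card κ := by
  obtain ⟨W, hW, hxW, a, ha⟩ := hs.exists_common (W := V ⊓ V') inf_le_right
    (fun i => res inf_le_left (e i)) ⟨hx, hx'⟩
  choose b hb using fun k => h.exists_coeff (hW.trans inf_le_left) (res (hW.trans inf_le_right) (s k))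
  have hab : (Matrix.of a) * (Matrix.of b) = 1 := by
    funext i
    refine h.coeff_eq (hW.trans inf_le_left) ?_
    have h1 := ha i
    simp only [res_res] at h1
    simp only [Matrix.mul_apply, Matrix.one_apply, ite_smul, one_smul, zero_smul,
      Finset.sum_ite_eq, Finset.mem_univ, if_true, Matrix.of_apply]
    rw [h1]
    simp only [hb, Finset.smul_sum, Finset.sum_smul, smul_smul]
    exact Finset.sum_comm
  have h2 := congrArg (fun M => M.map (HolFun.evalHom ⟨x, hxW⟩)) hab
  simp only [Matrix.map_mul, map_zero, map_one, Matrix.map_one] at h2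
  have h3 := Matrix.rank_mul_le_left ((Matrix.of a).map (HolFun.evalHom ⟨x, hxW⟩))
    ((Matrix.of b).map (HolFun.evalHom ⟨x, hxW⟩))
  rw [h2, Matrix.rank_one] at h3
  exact h3.trans (Matrix.rank_le_card_width _)

/-- The size of a frame near a point is at most the number of local generators. Compactness makes
this uniform, which keeps the constants in the curvature estimates independent of the point. -/
theorem IsCoherent.exists_card_le [CompactSpace X] (hE : E.IsCoherent) :
    ∃ N : ℕ, ∀ (V : Opens X) (r : ℕ) (e : Fin r → E.Sec V), IsFrame e → (V : Set X).Nonempty →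
      r ≤ N := by
  suffices ∃ N : ℕ, ∀ x ∈ (Set.univ : Set X), ∀ (V : Opens X) (r : ℕ) (e : Fin r → E.Sec V),
      IsFrame e → x ∈ V → r ≤ N by
    obtain ⟨N, hN⟩ := this
    exact ⟨N, fun V r e he ⟨x, hx⟩ => hN x trivial V r e he hx⟩
  -- Sets admitting a bound are stable under subsets and finite unions, and every point has a
  -- neighbourhood that is one.
  refine isCompact_univ.induction_on (p := fun S => ∃ N : ℕ, ∀ x ∈ S, ∀ (V : Opens X) (r : ℕ)
    (e : Fin r → E.Sec V), IsFrame e → x ∈ V → r ≤ N) ⟨0, fun x hx => hx.elim⟩ ?_ ?_ ?_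
  · rintro S T hST ⟨N, hN⟩
    exact ⟨N, fun x hx => hN x (hST hx)⟩
  · rintro S T ⟨N, hN⟩ ⟨M, hM⟩
    refine ⟨max N M, fun x hx V r e he hxV => ?_⟩
    rcases hx with hx | hx
    · exact (hN x hx V r e he hxV).trans (le_max_left _ _)
    · exact (hM x hx V r e he hxV).trans (le_max_right _ _)
  · intro x _
    obtain ⟨V, hxV, p, q, s, ρ, -, hs, -⟩ := hE x
    refine ⟨V, mem_nhdsWithin_of_mem_nhds (V.isOpen.mem_nhds hxV), p, fun y hy V' r e he hyV' => ?_⟩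
    simpa using he.card_le hs hyV' hy

end AnalyticSheaf

end Frames

/-! ### Derivatives `∂` and `∂̄` of matrix-valued functions -/

section Calculus

variable {n : ℕ} {ι κ μ : Type}

theorem dz_congr {α : Fin n} {f g : (Fin n → ℂ) → ℂ} {z : Fin n → ℂ} (h : f =ᶠ[nhds z] g) :
    dz α f z = dz α g z := by
  rw [dz, dz, h.fderiv_eq]

theorem dzbar_congr {α : Fin n} {f g : (Fin n → ℂ) → ℂ} {z : Fin n → ℂ} (h : f =ᶠ[nhds z] g) :
    dzbar α f z = dzbar α g z := by
  rw [dzbar, dzbar, h.fderiv_eq]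

theorem dzbar_eq_conj (α : Fin n) (f : (Fin n → ℂ) → ℂ) (z : Fin n → ℂ) :
    dzbar α f z = star (dz α (fun w => star (f w)) z) := by
  have h : fderiv ℝ (fun w => star (f w)) z = (starL' ℝ : ℂ ≃L[ℝ] ℂ) ∘L fderiv ℝ f z :=
    (starL' ℝ : ℂ ≃L[ℝ] ℂ).comp_fderiv
  simp only [dz, dzbar, h]
  simp

/-- The entrywise derivative `∂/∂z_α` of a matrix-valued function. -/
noncomputable def matDz (α : Fin n) (M : (Fin n → ℂ) → Matrix ι κ ℂ) (z : Fin n → ℂ) :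
    Matrix ι κ ℂ :=
  Matrix.of fun i j => dz α (fun w => M w i j) z

/-- The entrywise derivative `∂/∂z̄_α` of a matrix-valued function. -/
noncomputable def matDzbar (α : Fin n) (M : (Fin n → ℂ) → Matrix ι κ ℂ) (z : Fin n → ℂ) :
    Matrix ι κ ℂ :=
  Matrix.of fun i j => dzbar α (fun w => M w i j) z

/-- All entries of a matrix-valued function are differentiable at `z`. -/
def MatDiffAt (𝕜 : Type) [NontriviallyNormedField 𝕜] [NormedAlgebra 𝕜 ℂ]
    (M : (Fin n → ℂ) → Matrix ι κ ℂ) (z : Fin n → ℂ) : Prop :=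
  ∀ i j, DifferentiableAt 𝕜 (fun w => M w i j) z

/-- All entries of a matrix-valued function are smooth on `Ω`. -/
def MatSmoothOn (𝕜 : Type) [NontriviallyNormedField 𝕜] [NormedAlgebra 𝕜 ℂ]
    (M : (Fin n → ℂ) → Matrix ι κ ℂ) (Ω : Set (Fin n → ℂ)) : Prop :=
  ∀ i j, ContDiffOn 𝕜 ∞ (fun w => M w i j) Ω

theorem MatSmoothOn.matDiffAt {𝕜 : Type} [NontriviallyNormedField 𝕜] [NormedAlgebra 𝕜 ℂ]
    {M : (Fin n → ℂ) → Matrix ι κ ℂ} {Ω : Set (Fin n → ℂ)} (h : MatSmoothOn 𝕜 M Ω) (hΩ : IsOpen Ω)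
    {z : Fin n → ℂ} (hz : z ∈ Ω) : MatDiffAt 𝕜 M z := fun i j =>
  ((h i j).contDiffAt (hΩ.mem_nhds hz)).differentiableAt (by simp)

theorem MatSmoothOn.mul [Fintype κ] {𝕜 : Type} [NontriviallyNormedField 𝕜] [NormedAlgebra 𝕜 ℂ]
    {M : (Fin n → ℂ) → Matrix ι κ ℂ} {N : (Fin n → ℂ) → Matrix κ μ ℂ} {Ω : Set (Fin n → ℂ)}
    (hM : MatSmoothOn 𝕜 M Ω) (hN : MatSmoothOn 𝕜 N Ω) : MatSmoothOn 𝕜 (fun w => M w * N w) Ω := by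
  intro i j
  simp only [Matrix.mul_apply]
  exact ContDiffOn.sum fun k _ => (hM i k).mul (hN k j)

/-- Cramer's rule: the entries of the inverse are determinants in the entries of `M` divided by `det
M`. -/
theorem MatSmoothOn.inv [Fintype ι] [DecidableEq ι] {M : (Fin n → ℂ) → Matrix ι ι ℂ} {Ω : Set (Fin n → ℂ)}
    (hM : MatSmoothOn ℝ M Ω) (hdet : ∀ z ∈ Ω, (M z).det ≠ 0) :
    MatSmoothOn ℝ (fun w => (M w)⁻¹) Ω := by
  have hd : ∀ {N : (Fin n → ℂ) → Matrix ι ι ℂ}, MatSmoothOn ℝ N Ω →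
      ContDiffOn ℝ ∞ (fun w => (N w).det) Ω := by
    intro N hN
    simp only [Matrix.det_apply]
    refine ContDiffOn.sum fun σ _ => ContDiffOn.const_smul _ ?_
    exact contDiffOn_prod fun i _ => hN _ _
  intro i j
  simp only [Matrix.inv_def, Ring.inverse_eq_inv', Matrix.smul_apply, smul_eq_mul,
    Matrix.adjugate_apply]
  refine ((hd hM).inv hdet).mul (hd fun k l => ?_)
  -- The adjugate is a determinant with row `j` replaced by a constant unit vector.
  by_cases hk : k = j
  · subst hk
    simpa using contDiffOn_const
  · simpa [hk] using hM k l

theorem MatSmoothOn.matDz {M : (Fin n → ℂ) → Matrix ι κ ℂ} {Ω : Set (Fin n → ℂ)}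
    (hM : MatSmoothOn ℝ M Ω) (hΩ : IsOpen Ω) (α : Fin n) : MatSmoothOn ℝ (matDz α M) Ω := by
  intro i j
  have h : ContDiffOn ℝ ∞ (fderiv ℝ fun w => M w i j) Ω := (hM i j).fderiv_of_isOpen hΩ (by simp)
  exact contDiffOn_const.mul ((h.clm_apply contDiffOn_const).sub
    (contDiffOn_const.mul (h.clm_apply contDiffOn_const)))

theorem MatSmoothOn.matDzbar {M : (Fin n → ℂ) → Matrix ι κ ℂ} {Ω : Set (Fin n → ℂ)}
    (hM : MatSmoothOn ℝ M Ω) (hΩ : IsOpen Ω) (α : Fin n) : MatSmoothOn ℝ (matDzbar α M) Ω := by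
  intro i j
  have h : ContDiffOn ℝ ∞ (fderiv ℝ fun w => M w i j) Ω := (hM i j).fderiv_of_isOpen hΩ (by simp)
  exact contDiffOn_const.mul ((h.clm_apply contDiffOn_const).add
    (contDiffOn_const.mul (h.clm_apply contDiffOn_const)))

theorem dz_mul {α : Fin n} {f g : (Fin n → ℂ) → ℂ} {z : Fin n → ℂ} (hf : DifferentiableAt ℝ f z)
    (hg : DifferentiableAt ℝ g z) :
    dz α (fun w => f w * g w) z = dz α f z * g z + f z * dz α g z := by
  simp only [dz, fderiv_fun_mul hf hg]
  simp only [_root_.add_apply, _root_.smul_apply, smul_eq_mul]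
  ring

theorem dzbar_mul {α : Fin n} {f g : (Fin n → ℂ) → ℂ} {z : Fin n → ℂ} (hf : DifferentiableAt ℝ f z)
    (hg : DifferentiableAt ℝ g z) :
    dzbar α (fun w => f w * g w) z = dzbar α f z * g z + f z * dzbar α g z := by
  simp only [dzbar, fderiv_fun_mul hf hg]
  simp only [_root_.add_apply, _root_.smul_apply, smul_eq_mul]
  ring

theorem dz_sum {α : Fin n} (s : Finset ι) {f : ι → (Fin n → ℂ) → ℂ} {z : Fin n → ℂ}
    (hf : ∀ i ∈ s, DifferentiableAt ℝ (f i) z) :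
    dz α (fun w => ∑ i ∈ s, f i w) z = ∑ i ∈ s, dz α (f i) z := by
  simp only [dz, fderiv_fun_sum hf, _root_.sum_apply, Finset.mul_sum,
    ← Finset.sum_sub_distrib]

theorem dzbar_sum {α : Fin n} (s : Finset ι) {f : ι → (Fin n → ℂ) → ℂ} {z : Fin n → ℂ}
    (hf : ∀ i ∈ s, DifferentiableAt ℝ (f i) z) :
    dzbar α (fun w => ∑ i ∈ s, f i w) z = ∑ i ∈ s, dzbar α (f i) z := by
  simp only [dzbar, fderiv_fun_sum hf, _root_.sum_apply, Finset.mul_sum,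
    ← Finset.sum_add_distrib]

theorem dzbar_add {α : Fin n} {f g : (Fin n → ℂ) → ℂ} {z : Fin n → ℂ} (hf : DifferentiableAt ℝ f z)
    (hg : DifferentiableAt ℝ g z) :
    dzbar α (fun w => f w + g w) z = dzbar α f z + dzbar α g z := by
  simp only [dzbar, fderiv_fun_add hf hg, _root_.add_apply]
  ring

@[simp] theorem dz_const (α : Fin n) (a : ℂ) (z : Fin n → ℂ) : dz α (fun _ => a) z = 0 := by
  simp [dz]

@[simp] theorem dzbar_const (α : Fin n) (a : ℂ) (z : Fin n → ℂ) : dzbar α (fun _ => a) z = 0 := by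
  simp [dzbar]

/-- The Cauchy–Riemann equations: the real derivative is `ℂ`-linear, so the value at `I` is `I`
times that at `1`. -/
theorem dzbar_eq_zero {α : Fin n} {f : (Fin n → ℂ) → ℂ} {z : Fin n → ℂ}
    (hf : DifferentiableAt ℂ f z) : dzbar α f z = 0 := by
  have h1 : (Pi.single α Complex.I : Fin n → ℂ) = Complex.I • Pi.single α 1 := by
    rw [← Pi.single_smul, smul_eq_mul, mul_one]
  rw [dzbar, hf.fderiv_restrictScalars ℝ]
  simp only [ContinuousLinearMap.coe_restrictScalars', h1, map_smul, smul_eq_mul, ← mul_assoc,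
    Complex.I_mul_I]
  ring

theorem dz_eq_fderiv {α : Fin n} {f : (Fin n → ℂ) → ℂ} {z : Fin n → ℂ}
    (hf : DifferentiableAt ℂ f z) : dz α f z = fderiv ℂ f z (Pi.single α 1) := by
  have h1 : (Pi.single α Complex.I : Fin n → ℂ) = Complex.I • Pi.single α 1 := by
    rw [← Pi.single_smul, smul_eq_mul, mul_one]
  rw [dz, hf.fderiv_restrictScalars ℝ]
  simp only [ContinuousLinearMap.coe_restrictScalars', h1, map_smul, smul_eq_mul, ← mul_assoc,
    Complex.I_mul_I]
  ring

theorem dz_conj_eq_zero {α : Fin n} {f : (Fin n → ℂ) → ℂ} {z : Fin n → ℂ}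
    (hf : DifferentiableAt ℂ f z) : dz α (fun w => star (f w)) z = 0 := by
  have h := dzbar_eq_conj α f z
  rw [dzbar_eq_zero hf] at h
  exact star_eq_zero.1 h.symm

theorem matDz_congr {α : Fin n} {M N : (Fin n → ℂ) → Matrix ι κ ℂ} {z : Fin n → ℂ}
    (h : M =ᶠ[nhds z] N) : matDz α M z = matDz α N z := by
  ext i j
  exact dz_congr (h.mono fun w hw => congrFun (congrFun hw i) j)

theorem matDzbar_congr {α : Fin n} {M N : (Fin n → ℂ) → Matrix ι κ ℂ} {z : Fin n → ℂ}
    (h : M =ᶠ[nhds z] N) : matDzbar α M z = matDzbar α N z := by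
  ext i j
  exact dzbar_congr (h.mono fun w hw => congrFun (congrFun hw i) j)

theorem MatDiffAt.mul [Fintype κ] {𝕜 : Type} [NontriviallyNormedField 𝕜] [NormedAlgebra 𝕜 ℂ]
    {M : (Fin n → ℂ) → Matrix ι κ ℂ} {N : (Fin n → ℂ) → Matrix κ μ ℂ} {z : Fin n → ℂ}
    (hM : MatDiffAt 𝕜 M z) (hN : MatDiffAt 𝕜 N z) : MatDiffAt 𝕜 (fun w => M w * N w) z := by
  intro i j
  simp only [Matrix.mul_apply]
  exact DifferentiableAt.fun_sum fun k _ => (hM i k).mul (hN k j)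

theorem matDz_mul [Fintype κ] {α : Fin n} {M : (Fin n → ℂ) → Matrix ι κ ℂ} {N : (Fin n → ℂ) → Matrix κ μ ℂ}
    {z : Fin n → ℂ} (hM : MatDiffAt ℝ M z) (hN : MatDiffAt ℝ N z) :
    matDz α (fun w => M w * N w) z = matDz α M z * N z + M z * matDz α N z := by
  ext i j
  simp only [matDz, Matrix.of_apply, Matrix.mul_apply, Matrix.add_apply,
    ← Finset.sum_add_distrib]
  rw [dz_sum _ fun k _ => (hM i k).fun_mul (hN k j)]
  exact Finset.sum_congr rfl fun k _ => dz_mul (hM i k) (hN k j)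

theorem matDzbar_mul [Fintype κ] {α : Fin n} {M : (Fin n → ℂ) → Matrix ι κ ℂ} {N : (Fin n → ℂ) → Matrix κ μ ℂ}
    {z : Fin n → ℂ} (hM : MatDiffAt ℝ M z) (hN : MatDiffAt ℝ N z) :
    matDzbar α (fun w => M w * N w) z = matDzbar α M z * N z + M z * matDzbar α N z := by
  ext i j
  simp only [matDzbar, Matrix.of_apply, Matrix.mul_apply, Matrix.add_apply,
    ← Finset.sum_add_distrib]
  rw [dzbar_sum _ fun k _ => (hM i k).fun_mul (hN k j)]
  exact Finset.sum_congr rfl fun k _ => dzbar_mul (hM i k) (hN k j)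

theorem matDzbar_add {α : Fin n} {M N : (Fin n → ℂ) → Matrix ι κ ℂ} {z : Fin n → ℂ}
    (hM : MatDiffAt ℝ M z) (hN : MatDiffAt ℝ N z) :
    matDzbar α (fun w => M w + N w) z = matDzbar α M z + matDzbar α N z := by
  ext i j
  exact dzbar_add (hM i j) (hN i j)

theorem matDzbar_eq_zero {α : Fin n} {M : (Fin n → ℂ) → Matrix ι κ ℂ} {z : Fin n → ℂ}
    (hM : MatDiffAt ℂ M z) : matDzbar α M z = 0 := by
  ext i j
  exact dzbar_eq_zero (hM i j)

theorem matDz_conjTranspose_eq_zero {α : Fin n} {M : (Fin n → ℂ) → Matrix ι κ ℂ} {z : Fin n → ℂ}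
    (hM : MatDiffAt ℂ M z) : matDz α (fun w => (M w)ᴴ) z = 0 := by
  ext i j
  exact dz_conj_eq_zero (hM j i)

theorem MatDiffAt.real {M : (Fin n → ℂ) → Matrix ι κ ℂ} {z : Fin n → ℂ} (hM : MatDiffAt ℂ M z) :
    MatDiffAt ℝ M z := fun i j => (hM i j).restrictScalars ℝ

theorem MatDiffAt.conjTranspose {M : (Fin n → ℂ) → Matrix ι κ ℂ} {z : Fin n → ℂ}
    (hM : MatDiffAt ℝ M z) : MatDiffAt ℝ (fun w => (M w)ᴴ) z := fun i j =>
  (starL' ℝ : ℂ ≃L[ℝ] ℂ).differentiableAt.comp z (hM j i)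

/-- For holomorphic `M` the derivative `∂M` is again holomorphic. The term `∂P · P⁻¹` of a
transformed connection is therefore killed by `∂̄`. -/
theorem MatSmoothOn.matDiffAt_matDz {M : (Fin n → ℂ) → Matrix ι κ ℂ} {Ω : Set (Fin n → ℂ)}
    (hM : MatSmoothOn ℂ M Ω) (hΩ : IsOpen Ω) (α : Fin n) {z : Fin n → ℂ} (hz : z ∈ Ω) :
    MatDiffAt ℂ (Higgs.matDz α M) z := by
  intro i j
  have h : ContDiffOn ℂ ∞ (fderiv ℂ fun w => M w i j) Ω := (hM i j).fderiv_of_isOpen hΩ (by simp)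
  have h1 : DifferentiableAt ℂ (fun w => fderiv ℂ (fun w => M w i j) w (Pi.single α 1)) z :=
    ((h.clm_apply contDiffOn_const).contDiffAt (hΩ.mem_nhds hz)).differentiableAt (by simp)
  refine h1.congr_of_eventuallyEq ?_
  filter_upwards [hΩ.mem_nhds hz] with w hw
  exact dz_eq_fderiv (hM.matDiffAt hΩ hw i j)

end Calculus

/-! ### Chern connection and curvature: change of frame, Kronecker products, diagonal blocks -/

section Curvature

open scoped Kronecker

variable {n : ℕ} {ι κ : Type} [Fintype ι] [Fintype κ] [DecidableEq ι] [DecidableEq κ]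

/-- The coefficient of the Chern connection form `∂H · H⁻¹`. -/
noncomputable def chernConnection (H : (Fin n → ℂ) → Matrix ι ι ℂ) (α : Fin n) (z : Fin n → ℂ) :
    Matrix ι ι ℂ :=
  matDz α H z * (H z)⁻¹

/-- The coefficient of the Chern curvature form `∂̄(∂H · H⁻¹)`. -/
noncomputable def chernCurvature (H : (Fin n → ℂ) → Matrix ι ι ℂ) (α β : Fin n) (z : Fin n → ℂ) :
    Matrix ι ι ℂ :=
  -matDzbar β (chernConnection H α) z

variable {Ω : Set (Fin n → ℂ)} {z : Fin n → ℂ} {H : (Fin n → ℂ) → Matrix ι ι ℂ}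
  {K : (Fin n → ℂ) → Matrix κ κ ℂ}

theorem MatSmoothOn.chernConnection (hH : MatSmoothOn ℝ H Ω) (hΩ : IsOpen Ω)
    (hdet : ∀ z ∈ Ω, (H z).det ≠ 0) (α : Fin n) : MatSmoothOn ℝ (chernConnection H α) Ω :=
  (hH.matDz hΩ α).mul (hH.inv hdet)

theorem MatSmoothOn.chernCurvature (hH : MatSmoothOn ℝ H Ω) (hΩ : IsOpen Ω)
    (hdet : ∀ z ∈ Ω, (H z).det ≠ 0) (α β : Fin n) : MatSmoothOn ℝ (chernCurvature H α β) Ω :=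
  fun i j => ((hH.chernConnection hΩ hdet α).matDzbar hΩ β i j).neg

theorem chernConnection_congr {H' : (Fin n → ℂ) → Matrix ι ι ℂ} (hΩ : IsOpen Ω) (hz : z ∈ Ω)
    (h : ∀ w ∈ Ω, H w = H' w) (α : Fin n) : chernConnection H α z = chernConnection H' α z := by
  rw [chernConnection, chernConnection, h z hz,
    matDz_congr (Filter.eventually_of_mem (hΩ.mem_nhds hz) h)]

theorem chernCurvature_congr {H' : (Fin n → ℂ) → Matrix ι ι ℂ} (hΩ : IsOpen Ω) (hz : z ∈ Ω)
    (h : ∀ w ∈ Ω, H w = H' w) (α β : Fin n) : chernCurvature H α β z = chernCurvature H' α β z := by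
  rw [chernCurvature, chernCurvature, matDzbar_congr (Filter.eventually_of_mem (hΩ.mem_nhds hz)
    fun w hw => chernConnection_congr hΩ hw h α)]

theorem inv_congruence {P : Matrix κ ι ℂ} {Q : Matrix ι κ ℂ} (hPQ : P * Q = 1) (hQP : Q * P = 1)
    {A : Matrix ι ι ℂ} (hA : A.det ≠ 0) : (P * A * Pᴴ)⁻¹ = Qᴴ * A⁻¹ * Q := by
  refine Matrix.inv_eq_right_inv ?_
  have h1 : Pᴴ * Qᴴ = 1 := by rw [← Matrix.conjTranspose_mul, hQP, Matrix.conjTranspose_one]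
  calc P * A * Pᴴ * (Qᴴ * A⁻¹ * Q) = P * A * (Pᴴ * Qᴴ) * A⁻¹ * Q := by simp only [Matrix.mul_assoc]
    _ = P * (A * A⁻¹) * Q := by rw [h1]; simp only [Matrix.mul_assoc, Matrix.one_mul]
    _ = 1 := by rw [Matrix.mul_nonsing_inv _ (isUnit_iff_ne_zero.2 hA), Matrix.mul_one, hPQ]

section FrameChange

variable {P : (Fin n → ℂ) → Matrix κ ι ℂ} {Q : (Fin n → ℂ) → Matrix ι κ ℂ}

/-- The derivative `∂` of `P H Pᴴ` has no term from `Pᴴ`, which is antiholomorphic. -/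
theorem chernConnection_frame_change (hΩ : IsOpen Ω) (hH : MatSmoothOn ℝ H Ω)
    (hdet : ∀ z ∈ Ω, (H z).det ≠ 0) (hP : MatSmoothOn ℂ P Ω)
    (hPQ : ∀ z ∈ Ω, P z * Q z = 1) (hQP : ∀ z ∈ Ω, Q z * P z = 1) (hz : z ∈ Ω) (α : Fin n) :
    chernConnection (fun w => P w * H w * (P w)ᴴ) α z =
      matDz α P z * Q z + P z * chernConnection H α z * Q z := by
  have hPz := hP.matDiffAt hΩ hz
  have hHz := hH.matDiffAt hΩ hz
  have h1 : (P z)ᴴ * (Q z)ᴴ = 1 := by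
    rw [← Matrix.conjTranspose_mul, hQP z hz, Matrix.conjTranspose_one]
  rw [chernConnection, inv_congruence (hPQ z hz) (hQP z hz) (hdet z hz),
    matDz_mul (hPz.real.mul hHz) hPz.real.conjTranspose, matDz_mul hPz.real hHz,
    matDz_conjTranspose_eq_zero hPz, Matrix.mul_zero, add_zero, chernConnection]
  calc (matDz α P z * H z + P z * matDz α H z) * (P z)ᴴ * ((Q z)ᴴ * (H z)⁻¹ * Q z)
      = (matDz α P z * H z + P z * matDz α H z) * ((P z)ᴴ * (Q z)ᴴ) * (H z)⁻¹ * Q z := by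
        simp only [Matrix.mul_assoc]
    _ = matDz α P z * (H z * (H z)⁻¹) * Q z + P z * (matDz α H z * (H z)⁻¹) * Q z := by
        rw [h1]
        simp only [Matrix.mul_one, Matrix.add_mul, Matrix.mul_assoc]
    _ = _ := by
        rw [Matrix.mul_nonsing_inv _ (isUnit_iff_ne_zero.2 (hdet z hz)), Matrix.mul_one]

/-- The inhomogeneous term `∂P · Q` of the connection is holomorphic, and `∂̄` passes through `P`
and `Q`. The curvature is thus an endomorphism-valued form. -/
theorem chernCurvature_frame_change (hΩ : IsOpen Ω) (hH : MatSmoothOn ℝ H Ω)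
    (hdet : ∀ z ∈ Ω, (H z).det ≠ 0) (hP : MatSmoothOn ℂ P Ω) (hQ : MatSmoothOn ℂ Q Ω)
    (hPQ : ∀ z ∈ Ω, P z * Q z = 1) (hQP : ∀ z ∈ Ω, Q z * P z = 1) (hz : z ∈ Ω) (α β : Fin n) :
    chernCurvature (fun w => P w * H w * (P w)ᴴ) α β z =
      P z * chernCurvature H α β z * Q z := by
  have hPz := hP.matDiffAt hΩ hz
  have hQz := hQ.matDiffAt hΩ hz
  have hAz := (hH.chernConnection hΩ hdet α).matDiffAt hΩ hz
  have hDz := hP.matDiffAt_matDz hΩ α hz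
  rw [chernCurvature, matDzbar_congr (Filter.eventually_of_mem (hΩ.mem_nhds hz) fun w hw =>
    chernConnection_frame_change hΩ hH hdet hP hPQ hQP hw α),
    matDzbar_add (hDz.real.mul hQz.real) ((hPz.real.mul hAz).mul hQz.real),
    matDzbar_mul hDz.real hQz.real, matDzbar_mul (hPz.real.mul hAz) hQz.real,
    matDzbar_mul hPz.real hAz, matDzbar_eq_zero hDz, matDzbar_eq_zero hQz, matDzbar_eq_zero hPz,
    chernCurvature]
  simp

end FrameChange

omit [Fintype ι] [Fintype κ] [DecidableEq ι] [DecidableEq κ] in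
theorem matDz_kronecker {α : Fin n} (hH : MatDiffAt ℝ H z) (hK : MatDiffAt ℝ K z) :
    matDz α (fun w => H w ⊗ₖ K w) z = matDz α H z ⊗ₖ K z + H z ⊗ₖ matDz α K z := by
  ext i j
  exact dz_mul (hH i.1 j.1) (hK i.2 j.2)

/-- Leibniz' rule, and the fact that inversion and multiplication act on each Kronecker factor
separately. -/
theorem chernConnection_kronecker (hH : MatDiffAt ℝ H z) (hK : MatDiffAt ℝ K z)
    (hdH : (H z).det ≠ 0) (hdK : (K z).det ≠ 0) (α : Fin n) :
    chernConnection (fun w => H w ⊗ₖ K w) α z =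
      chernConnection H α z ⊗ₖ 1 + 1 ⊗ₖ chernConnection K α z := by
  rw [chernConnection, matDz_kronecker hH hK, Matrix.inv_kronecker, Matrix.add_mul,
    ← Matrix.mul_kronecker_mul, ← Matrix.mul_kronecker_mul,
    Matrix.mul_nonsing_inv _ (isUnit_iff_ne_zero.2 hdH),
    Matrix.mul_nonsing_inv _ (isUnit_iff_ne_zero.2 hdK)]
  rfl

/-- Applying `∂̄` to the formula for the connection leaves the identity factors untouched, since
they are constant. -/
theorem chernCurvature_kronecker (hΩ : IsOpen Ω) (hH : MatSmoothOn ℝ H Ω)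
    (hdH : ∀ z ∈ Ω, (H z).det ≠ 0) (hK : MatSmoothOn ℝ K Ω)
    (hdK : ∀ z ∈ Ω, (K z).det ≠ 0) (hz : z ∈ Ω) (α β : Fin n) :
    chernCurvature (fun w => H w ⊗ₖ K w) α β z =
      chernCurvature H α β z ⊗ₖ 1 + 1 ⊗ₖ chernCurvature K α β z := by
  have hA := (hH.chernConnection hΩ hdH α).matDiffAt hΩ hz
  have hB := (hK.chernConnection hΩ hdK α).matDiffAt hΩ hz
  rw [chernCurvature, matDzbar_congr (Filter.eventually_of_mem (hΩ.mem_nhds hz) fun w hw =>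
    chernConnection_kronecker (hH.matDiffAt hΩ hw) (hK.matDiffAt hΩ hw) (hdH w hw) (hdK w hw) α)]
  ext ⟨i, i'⟩ ⟨j, j'⟩
  have h1 : DifferentiableAt ℝ (fun w => chernConnection H α w i j * (1 : Matrix κ κ ℂ) i' j') z :=
    (hA i j).mul_const _
  have h2 : DifferentiableAt ℝ (fun w => (1 : Matrix ι ι ℂ) i j * chernConnection K α w i' j') z :=
    (hB i' j').const_mul _
  change -dzbar β (fun w => chernConnection H α w i j * (1 : Matrix κ κ ℂ) i' j' +
    (1 : Matrix ι ι ℂ) i j * chernConnection K α w i' j') z = _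
  rw [dzbar_add h1 h2, dzbar_mul (hA i j) (differentiableAt_const _),
    dzbar_mul (differentiableAt_const _) (hB i' j'), dzbar_const, dzbar_const]
  simp only [Matrix.add_apply, Matrix.kroneckerMap_apply, chernCurvature, Matrix.neg_apply,
    matDzbar, Matrix.of_apply]
  ring

theorem inv_fromBlocks_diagonal {A : Matrix ι ι ℂ} {B : Matrix κ κ ℂ} (hA : A.det ≠ 0)
    (hB : B.det ≠ 0) : (Matrix.fromBlocks A 0 0 B)⁻¹ = Matrix.fromBlocks A⁻¹ 0 0 B⁻¹ := by
  refine Matrix.inv_eq_right_inv ?_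
  simp [Matrix.fromBlocks_multiply, Matrix.mul_nonsing_inv _ (isUnit_iff_ne_zero.2 hA),
    Matrix.mul_nonsing_inv _ (isUnit_iff_ne_zero.2 hB)]

omit [Fintype ι] [Fintype κ] [DecidableEq ι] [DecidableEq κ] in
theorem matDz_fromBlocks (α : Fin n) :
    matDz α (fun w => Matrix.fromBlocks (H w) 0 0 (K w)) z =
      Matrix.fromBlocks (matDz α H z) 0 0 (matDz α K z) := by
  ext (i | i) (j | j)
  · rfl
  · exact dz_const α 0 z
  · exact dz_const α 0 z
  · rfl

omit [Fintype ι] [Fintype κ] [DecidableEq ι] [DecidableEq κ] in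
theorem matDzbar_fromBlocks (α : Fin n) :
    matDzbar α (fun w => Matrix.fromBlocks (H w) 0 0 (K w)) z =
      Matrix.fromBlocks (matDzbar α H z) 0 0 (matDzbar α K z) := by
  ext (i | i) (j | j)
  · rfl
  · exact dzbar_const α 0 z
  · exact dzbar_const α 0 z
  · rfl

theorem chernConnection_fromBlocks (hdH : (H z).det ≠ 0) (hdK : (K z).det ≠ 0) (α : Fin n) :
    chernConnection (fun w => Matrix.fromBlocks (H w) 0 0 (K w)) α z =
      Matrix.fromBlocks (chernConnection H α z) 0 0 (chernConnection K α z) := by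
  rw [chernConnection, matDz_fromBlocks, inv_fromBlocks_diagonal hdH hdK]
  simp [Matrix.fromBlocks_multiply, chernConnection]

theorem chernCurvature_fromBlocks (hΩ : IsOpen Ω) (hdH : ∀ z ∈ Ω, (H z).det ≠ 0)
    (hdK : ∀ z ∈ Ω, (K z).det ≠ 0) (hz : z ∈ Ω) (α β : Fin n) :
    chernCurvature (fun w => Matrix.fromBlocks (H w) 0 0 (K w)) α β z =
      Matrix.fromBlocks (chernCurvature H α β z) 0 0 (chernCurvature K α β z) := by
  rw [chernCurvature, matDzbar_congr (Filter.eventually_of_mem (hΩ.mem_nhds hz) fun w hw =>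
    chernConnection_fromBlocks (hdH w hw) (hdK w hw) α), matDzbar_fromBlocks,
    Matrix.fromBlocks_neg, neg_zero, neg_zero]
  rfl

end Curvature

/-! ### Norms of endomorphisms and of curvature -/

section Norms

open scoped Kronecker

variable {n : ℕ} {ι κ : Type} [Fintype ι] [Fintype κ] [DecidableEq ι] [DecidableEq κ]

/-- The Hermitian product `tr(A B^*)` of endomorphisms, `B^* = H Bᴴ H⁻¹`. -/
noncomputable def endProd (H A B : Matrix ι ι ℂ) : ℂ := (A * (H * Bᴴ * H⁻¹)).trace

/-- The contraction `∑ g^{αβ̄} R_{αβ̄}` with the inverse `g` of a metric. -/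
noncomputable def contraction (g : Matrix (Fin n) (Fin n) ℂ) (R : Fin n → Fin n → Matrix ι ι ℂ) :
    Matrix ι ι ℂ :=
  ∑ α, ∑ β, g β α • R α β

/-- The square of the norm of a family `R_{αβ̄}` of endomorphisms, `g` being the inverse of a
metric. -/
noncomputable def curvForm (g : Matrix (Fin n) (Fin n) ℂ) (H : Matrix ι ι ℂ)
    (R : Fin n → Fin n → Matrix ι ι ℂ) : ℝ :=
  (∑ α, ∑ β, ∑ γ, ∑ δ, g γ α * g β δ * endProd H (R α β) (R γ δ)).re

theorem endProd_add_left (H A A' B : Matrix ι ι ℂ) :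
    endProd H (A + A') B = endProd H A B + endProd H A' B := by
  simp [endProd, Matrix.add_mul]

theorem endProd_add_right (H A B B' : Matrix ι ι ℂ) :
    endProd H A (B + B') = endProd H A B + endProd H A B' := by
  simp [endProd, Matrix.add_mul, Matrix.mul_add]

theorem endProd_smul_left (H A B : Matrix ι ι ℂ) (c : ℂ) :
    endProd H (c • A) B = c * endProd H A B := by
  simp [endProd]

theorem endProd_smul_right (H A B : Matrix ι ι ℂ) (c : ℂ) :
    endProd H A (c • B) = star c * endProd H A B := by
  simp [endProd]

theorem endProd_neg_left (H A B : Matrix ι ι ℂ) : endProd H (-A) B = -endProd H A B := by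
  simp [endProd]

theorem endProd_neg_right (H A B : Matrix ι ι ℂ) : endProd H A (-B) = -endProd H A B := by
  simp [endProd]

theorem endProd_sum_left {μ : Type*} (s : Finset μ) (H B : Matrix ι ι ℂ) (A : μ → Matrix ι ι ℂ) :
    endProd H (∑ i ∈ s, A i) B = ∑ i ∈ s, endProd H (A i) B := by
  simp [endProd, Matrix.sum_mul, Matrix.trace_sum]

theorem endProd_sum_right {μ : Type*} (s : Finset μ) (H A : Matrix ι ι ℂ) (B : μ → Matrix ι ι ℂ) :
    endProd H A (∑ i ∈ s, B i) = ∑ i ∈ s, endProd H A (B i) := by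
  simp [endProd, Matrix.sum_mul, Matrix.mul_sum, Matrix.trace_sum, Matrix.conjTranspose_sum]

open scoped MatrixOrder in
-- Such a factorization turns quantities weighted by a positive definite matrix into sums of
-- squares.
theorem exists_eq_conjTranspose_mul_self {A : Matrix ι ι ℂ} (hA : A.PosDef) :
    ∃ B : Matrix ι ι ℂ, A = Bᴴ * B := by
  obtain ⟨B, hB⟩ := CStarAlgebra.nonneg_iff_eq_star_mul_self.mp hA.posSemidef.nonneg
  exact ⟨B, hB⟩

/-- With `H⁻¹ = Fᴴ F`, cyclicity of the trace rewrites the product as the trace of the positive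
semidefinite matrix `(F A) H (F A)ᴴ`. -/
theorem endProd_self_nonneg {H : Matrix ι ι ℂ} (hH : H.PosDef) (A : Matrix ι ι ℂ) :
    0 ≤ (endProd H A A).re := by
  obtain ⟨F, hF⟩ := exists_eq_conjTranspose_mul_self hH.inv
  have h : endProd H A A = (F * A * H * (F * A)ᴴ).trace := by
    rw [endProd, hF, Matrix.conjTranspose_mul]
    calc (A * (H * Aᴴ * (Fᴴ * F))).trace = (A * H * Aᴴ * Fᴴ * F).trace := by
          simp only [Matrix.mul_assoc]
      _ = (F * (A * H * Aᴴ * Fᴴ)).trace := Matrix.trace_mul_comm _ _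
      _ = _ := by simp only [Matrix.mul_assoc]
  rw [h]
  exact (Complex.le_def.1 (hH.posSemidef.mul_mul_conjTranspose_same (F * A)).trace_nonneg).1

theorem endProd_frame_change {H A B : Matrix ι ι ℂ} {P : Matrix κ ι ℂ} {Q : Matrix ι κ ℂ}
    (hPQ : P * Q = 1) (hQP : Q * P = 1) (hH : H.det ≠ 0) :
    endProd (P * H * Pᴴ) (P * A * Q) (P * B * Q) = endProd H A B := by
  have h1 : Pᴴ * Qᴴ = 1 := by rw [← Matrix.conjTranspose_mul, hQP, Matrix.conjTranspose_one]
  rw [endProd, inv_congruence hPQ hQP hH, Matrix.conjTranspose_mul, Matrix.conjTranspose_mul]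
  calc (P * A * Q * (P * H * Pᴴ * (Qᴴ * (Bᴴ * Pᴴ)) * (Qᴴ * H⁻¹ * Q))).trace
      = (P * (A * (Q * P) * H * (Pᴴ * Qᴴ) * Bᴴ * (Pᴴ * Qᴴ) * H⁻¹ * Q)).trace := by
        simp only [Matrix.mul_assoc]
    _ = (A * H * Bᴴ * H⁻¹).trace := by
        rw [hQP, h1, Matrix.trace_mul_comm]
        simp only [Matrix.mul_one, Matrix.mul_assoc, hQP]
    _ = endProd H A B := by
        rw [endProd]
        simp only [Matrix.mul_assoc]

/-- The second factor contributes the trace of the identity. This is where the ranks in the final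
estimates come from. -/
theorem endProd_kronecker_one {H : Matrix ι ι ℂ} {K : Matrix κ κ ℂ} (hK : K.det ≠ 0)
    (A B : Matrix ι ι ℂ) :
    endProd (H ⊗ₖ K) (A ⊗ₖ 1) (B ⊗ₖ 1) = Fintype.card κ * endProd H A B := by
  rw [endProd, Matrix.conjTranspose_kronecker, Matrix.inv_kronecker, ← Matrix.mul_kronecker_mul,
    ← Matrix.mul_kronecker_mul, ← Matrix.mul_kronecker_mul, Matrix.conjTranspose_one,
    Matrix.mul_one, Matrix.one_mul, Matrix.mul_nonsing_inv _ (isUnit_iff_ne_zero.2 hK),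
    Matrix.trace_kronecker, Matrix.trace_one, mul_comm, endProd]

theorem endProd_one_kronecker {H : Matrix ι ι ℂ} {K : Matrix κ κ ℂ} (hH : H.det ≠ 0)
    (A B : Matrix κ κ ℂ) :
    endProd (H ⊗ₖ K) (1 ⊗ₖ A) (1 ⊗ₖ B) = Fintype.card ι * endProd K A B := by
  rw [endProd, Matrix.conjTranspose_kronecker, Matrix.inv_kronecker, ← Matrix.mul_kronecker_mul,
    ← Matrix.mul_kronecker_mul, ← Matrix.mul_kronecker_mul, Matrix.conjTranspose_one,
    Matrix.mul_one, Matrix.one_mul, Matrix.mul_nonsing_inv _ (isUnit_iff_ne_zero.2 hH),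
    Matrix.trace_kronecker, Matrix.trace_one, endProd]

theorem endProd_fromBlocks {H : Matrix ι ι ℂ} {K : Matrix κ κ ℂ} (hH : H.det ≠ 0) (hK : K.det ≠ 0)
    (A B : Matrix ι ι ℂ) (A' B' : Matrix κ κ ℂ) :
    endProd (Matrix.fromBlocks H 0 0 K) (Matrix.fromBlocks A 0 0 A') (Matrix.fromBlocks B 0 0 B') =
      endProd H A B + endProd K A' B' := by
  rw [endProd, inv_fromBlocks_diagonal hH hK]
  simp [Matrix.fromBlocks_multiply, Matrix.fromBlocks_conjTranspose, endProd,
    Matrix.trace, Fintype.sum_sum_type]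

variable {g : Matrix (Fin n) (Fin n) ℂ}

theorem sum_comm_five {a b c d e M : Type*} [Fintype a] [Fintype b] [Fintype c] [Fintype d]
    [Fintype e] [AddCommMonoid M] (f : a → b → c → d → e → M) :
    ∑ i, ∑ j, ∑ k, ∑ l, ∑ m, f i j k l m = ∑ j, ∑ k, ∑ l, ∑ m, ∑ i, f i j k l m := by
  rw [Finset.sum_comm]
  refine Finset.sum_congr rfl fun j _ => ?_
  rw [Finset.sum_comm]
  refine Finset.sum_congr rfl fun k _ => ?_
  rw [Finset.sum_comm]
  exact Finset.sum_congr rfl fun l _ => Finset.sum_comm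

/-- Writing `g = Cᴴ C` for the inverse metric, the quadruple sum becomes the sum of the squared
norms of the components of `R` after the linear change of coordinates `C`. -/
theorem curvForm_nonneg (hg : g.PosDef) {H : Matrix ι ι ℂ} (hH : H.PosDef)
    (R : Fin n → Fin n → Matrix ι ι ℂ) : 0 ≤ curvForm g H R := by
  obtain ⟨C, hC⟩ := exists_eq_conjTranspose_mul_self hg
  have hg' : ∀ α β, g α β = ∑ p, star (C p α) * C p β := by
    intro α β
    rw [hC, Matrix.mul_apply]
    rfl
  -- The components in the coordinates in which `g` becomes the identity; the second index is
  -- transformed by the conjugate of `C`.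
  let S : Fin n → Fin n → Matrix ι ι ℂ := fun p q => ∑ α, ∑ β, (C p α * star (C q β)) • R α β
  have h : curvForm g H R = (∑ p, ∑ q, endProd H (S p q) (S p q)).re := by
    have e : ∀ p q, endProd H (S p q) (S p q) = ∑ α, ∑ β, ∑ γ, ∑ δ, (C p α * star (C q β)) *
        (star (C p γ) * C q δ) * endProd H (R α β) (R γ δ) := by
      intro p q
      simp only [S, endProd_sum_left, endProd_smul_left]
      simp only [endProd_sum_right, endProd_smul_right, star_mul', star_star, Finset.mul_sum,
        mul_assoc]
    simp only [e]
    -- The sums over `p` and `q` are moved innermost, where they reassemble the two entries of `g`.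
    rw [Finset.sum_congr rfl fun p _ => sum_comm_five _, sum_comm_five, curvForm]
    refine congrArg Complex.re (Finset.sum_congr rfl fun α _ => Finset.sum_congr rfl fun β _ =>
      Finset.sum_congr rfl fun γ _ => Finset.sum_congr rfl fun δ _ => ?_)
    rw [hg', hg', Finset.sum_mul_sum, Finset.sum_mul]
    refine Finset.sum_congr rfl fun p _ => ?_
    rw [Finset.sum_mul]
    exact Finset.sum_congr rfl fun q _ => by ring
  rw [h, Complex.re_sum]
  refine Finset.sum_nonneg fun p _ => ?_
  rw [Complex.re_sum]
  exact Finset.sum_nonneg fun q _ => endProd_self_nonneg hH _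

/-- The parallelogram identity with the nonnegative norm of `A - B` discarded; the mixed terms need
not be estimated. -/
theorem endProd_add_self_le {H : Matrix ι ι ℂ} (hH : H.PosDef) (A B : Matrix ι ι ℂ) :
    (endProd H (A + B) (A + B)).re ≤ 2 * (endProd H A A).re + 2 * (endProd H B B).re := by
  have h := endProd_self_nonneg hH (A + -B)
  simp only [endProd_add_left, endProd_add_right, endProd_neg_left, endProd_neg_right,
    Complex.add_re, Complex.neg_re] at h ⊢
  linarith

theorem curvForm_add_le (hg : g.PosDef) {H : Matrix ι ι ℂ} (hH : H.PosDef)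
    (R S : Fin n → Fin n → Matrix ι ι ℂ) :
    curvForm g H (fun α β => R α β + S α β) ≤ 2 * curvForm g H R + 2 * curvForm g H S := by
  have h := curvForm_nonneg hg hH (fun α β => R α β + -S α β)
  simp only [curvForm, endProd_add_left, endProd_add_right, endProd_neg_left, endProd_neg_right,
    mul_add, Finset.sum_add_distrib, Complex.add_re, mul_neg, Finset.sum_neg_distrib,
    Complex.neg_re] at h ⊢
  linarith

theorem curvForm_frame_change {H : Matrix ι ι ℂ} {P : Matrix κ ι ℂ} {Q : Matrix ι κ ℂ}
    (hPQ : P * Q = 1) (hQP : Q * P = 1) (hH : H.det ≠ 0) (R : Fin n → Fin n → Matrix ι ι ℂ) :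
    curvForm g (P * H * Pᴴ) (fun α β => P * R α β * Q) = curvForm g H R := by
  simp only [curvForm, endProd_frame_change hPQ hQP hH]

omit [Fintype κ] [DecidableEq ι] [DecidableEq κ] in
theorem contraction_frame_change (P : Matrix κ ι ℂ) (Q : Matrix ι κ ℂ)
    (R : Fin n → Fin n → Matrix ι ι ℂ) :
    contraction g (fun α β => P * R α β * Q) = P * contraction g R * Q := by
  simp only [contraction, Matrix.mul_sum, Matrix.sum_mul, Matrix.mul_smul, Matrix.smul_mul]

/-- The factor `2` is the parallelogram constant, and each cardinality is the trace of the identity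
on the opposite factor. -/
theorem curvForm_kronecker_le (hg : g.PosDef) {H : Matrix ι ι ℂ} {K : Matrix κ κ ℂ} (hH : H.PosDef)
    (hK : K.PosDef) (R : Fin n → Fin n → Matrix ι ι ℂ) (S : Fin n → Fin n → Matrix κ κ ℂ) :
    curvForm g (H ⊗ₖ K) (fun α β => R α β ⊗ₖ 1 + 1 ⊗ₖ S α β) ≤
      2 * Fintype.card κ * curvForm g H R + 2 * Fintype.card ι * curvForm g K S := by
  refine (curvForm_add_le hg (hH.kronecker hK) _ _).trans (le_of_eq ?_)
  have e : ∀ (r : ℕ) (z : ℂ), ((r : ℂ) * z).re = r * z.re := fun r z => by simp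
  simp only [curvForm, endProd_kronecker_one hK.det_pos.ne', endProd_one_kronecker hH.det_pos.ne',
    mul_left_comm _ ((Fintype.card _ : ℕ) : ℂ), ← Finset.mul_sum, e]
  ring

omit [Fintype ι] [Fintype κ] in
theorem contraction_kronecker (R : Fin n → Fin n → Matrix ι ι ℂ) (S : Fin n → Fin n → Matrix κ κ ℂ) :
    contraction g (fun α β => R α β ⊗ₖ (1 : Matrix κ κ ℂ) + (1 : Matrix ι ι ℂ) ⊗ₖ S α β) =
      contraction g R ⊗ₖ 1 + 1 ⊗ₖ contraction g S := by
  ext ⟨i, i'⟩ ⟨j, j'⟩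
  simp only [contraction, Matrix.sum_apply, Matrix.smul_apply, Matrix.add_apply,
    Matrix.kroneckerMap_apply, smul_eq_mul, mul_add, Finset.sum_add_distrib, Finset.sum_mul,
    Finset.mul_sum]
  congr 1 <;> refine Finset.sum_congr rfl fun α _ => Finset.sum_congr rfl fun β _ => ?_ <;> ring

theorem endProd_kronecker_le {H : Matrix ι ι ℂ} {K : Matrix κ κ ℂ} (hH : H.PosDef)
    (hK : K.PosDef) (A : Matrix ι ι ℂ) (B : Matrix κ κ ℂ) :
    (endProd (H ⊗ₖ K) (A ⊗ₖ 1 + 1 ⊗ₖ B) (A ⊗ₖ 1 + 1 ⊗ₖ B)).re ≤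
      2 * Fintype.card κ * (endProd H A A).re + 2 * Fintype.card ι * (endProd K B B).re := by
  refine (endProd_add_self_le (hH.kronecker hK) _ _).trans (le_of_eq ?_)
  rw [endProd_kronecker_one hK.det_pos.ne', endProd_one_kronecker hH.det_pos.ne']
  simp
  ring

theorem curvForm_fromBlocks {H : Matrix ι ι ℂ} {K : Matrix κ κ ℂ} (hH : H.det ≠ 0)
    (hK : K.det ≠ 0) (R : Fin n → Fin n → Matrix ι ι ℂ) (S : Fin n → Fin n → Matrix κ κ ℂ) :
    curvForm g (Matrix.fromBlocks H 0 0 K) (fun α β => Matrix.fromBlocks (R α β) 0 0 (S α β)) =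
      curvForm g H R + curvForm g K S := by
  simp only [curvForm, endProd_fromBlocks hH hK, mul_add, Finset.sum_add_distrib, Complex.add_re]

omit [Fintype ι] [Fintype κ] [DecidableEq ι] [DecidableEq κ] in
theorem contraction_fromBlocks (R : Fin n → Fin n → Matrix ι ι ℂ)
    (S : Fin n → Fin n → Matrix κ κ ℂ) :
    contraction g (fun α β => Matrix.fromBlocks (R α β) 0 0 (S α β)) =
      Matrix.fromBlocks (contraction g R) 0 0 (contraction g S) := by
  ext (i | i) (j | j) <;> simp [contraction, Matrix.sum_apply]

end Norms

/-! ### Gram matrices in charts and independence of the frame -/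

section Gram

open AnalyticSheaf

/-- The right inverse `Q` makes `v ↦ v P` injective, which preserves definiteness. -/
theorem posDef_congruence {ι κ : Type} [Fintype ι] [Fintype κ] [DecidableEq κ] {P : Matrix κ ι ℂ}
    {Q : Matrix ι κ ℂ} (hPQ : P * Q = 1) {A : Matrix ι ι ℂ} (hA : A.PosDef) :
    (P * A * Pᴴ).PosDef := by
  refine hA.mul_mul_conjTranspose_same fun v w hvw => ?_
  have h := congrArg (fun u => u ᵥ* Q) hvw
  simpa only [Matrix.vecMul_vecMul, hPQ, Matrix.vecMul_one] using h

theorem posDef_fromBlocks {ι κ : Type} [Fintype ι] [Fintype κ] {A : Matrix ι ι ℂ}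
    {B : Matrix κ κ ℂ} (hA : A.PosDef) (hB : B.PosDef) : (Matrix.fromBlocks A 0 0 B).PosDef := by
  refine .of_dotProduct_mulVec_pos (hA.1.fromBlocks (by simp) hB.1) fun v hv => ?_
  have h : star v ⬝ᵥ (Matrix.fromBlocks A 0 0 B *ᵥ v) =
      star (v ∘ Sum.inl) ⬝ᵥ (A *ᵥ (v ∘ Sum.inl)) + star (v ∘ Sum.inr) ⬝ᵥ (B *ᵥ (v ∘ Sum.inr)) := by
    rw [Matrix.fromBlocks_mulVec]
    simp [dotProduct]
  rw [h]
  by_cases h1 : v ∘ Sum.inl = 0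
  · have h2 : v ∘ Sum.inr ≠ 0 := fun h2 => hv (funext fun i => by
      rcases i with i | i
      · exact congrFun h1 i
      · exact congrFun h2 i)
    exact add_pos_of_nonneg_of_pos (hA.posSemidef.dotProduct_mulVec_nonneg _)
      (hB.dotProduct_mulVec_pos h2)
  · exact add_pos_of_pos_of_nonneg (hA.dotProduct_mulVec_pos h1)
      (hB.posSemidef.dotProduct_mulVec_nonneg _)

variable {n : ℕ} {X : Type} [TopologicalSpace X] [ChartedSpace (Fin n → ℂ) X]
  {E : AnalyticSheaf n X} {U V V' W : Opens X} {ι κ : Type} [Fintype ι] [Fintype κ]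

omit [ChartedSpace (Fin n → ℂ) X] in
theorem inChart_of_mem {c : OpenPartialHomeomorph X (Fin n → ℂ)} {f : V → ℂ} {z : Fin n → ℂ}
    (hz : c.symm z ∈ V) : inChart c f z = f ⟨c.symm z, hz⟩ := dif_pos hz

/-- The image of an open set in a chart. -/
def chartSet (c : OpenPartialHomeomorph X (Fin n → ℂ)) (V : Opens X) : Set (Fin n → ℂ) :=
  c.target ∩ c.symm ⁻¹' V

omit [ChartedSpace (Fin n → ℂ) X] in
theorem isOpen_chartSet (c : OpenPartialHomeomorph X (Fin n → ℂ)) (V : Opens X) :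
    IsOpen (chartSet c V) :=
  c.symm.isOpen_inter_preimage V.isOpen

omit [ChartedSpace (Fin n → ℂ) X] in
theorem mem_chartSet {c : OpenPartialHomeomorph X (Fin n → ℂ)} {x : X} (hc : x ∈ c.source)
    (hx : x ∈ V) : c x ∈ chartSet c V :=
  ⟨c.map_source hc, by rw [Set.mem_preimage, c.left_inv hc]; exact hx⟩

/-- Smoothness is needed, not only differentiability: the curvature of a transformed metric
differentiates the change of frame twice. -/
theorem contDiffOn_inChart [IsManifold 𝓘(ℂ, Fin n → ℂ) ∞ X] (f : HolFun n V)
    {c : OpenPartialHomeomorph X (Fin n → ℂ)} (hc : c ∈ atlas (Fin n → ℂ) X) :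
    ContDiffOn ℂ ∞ (inChart c f.eval) (chartSet c V) := by
  classical
  intro z hz
  have hV : c.symm z ∈ V := hz.2
  let F : X → ℂ := fun y => if h : y ∈ V then f.eval ⟨y, h⟩ else 0
  have hf : ContMDiff 𝓘(ℂ, Fin n → ℂ) 𝓘(ℂ) ∞ f.eval :=
    (show C^∞⟮𝓘(ℂ, Fin n → ℂ), V; 𝓘(ℂ), ℂ⟯ from f).contMDiff
  have hF : ContMDiffAt 𝓘(ℂ, Fin n → ℂ) 𝓘(ℂ) ∞ F (c.symm z) := by
    have h1 : ContMDiffAt 𝓘(ℂ, Fin n → ℂ) 𝓘(ℂ) ∞ (fun y : V => F y) ⟨c.symm z, hV⟩ := by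
      have : (fun y : V => F y) = f.eval := by
        funext y
        simp [F]
      rw [this]
      exact hf _
    exact contMDiffAt_subtype_iff.1 h1
  have hs : ContMDiffAt 𝓘(ℂ, Fin n → ℂ) 𝓘(ℂ, Fin n → ℂ) ∞ c.symm z :=
    (contMDiffOn_symm_of_mem_maximalAtlas (IsManifold.subset_maximalAtlas hc)).contMDiffAt
      (c.open_target.mem_nhds hz.1)
  have h2 : ContMDiffAt 𝓘(ℂ, Fin n → ℂ) 𝓘(ℂ) ∞ (F ∘ c.symm) z := ContMDiffAt.comp _ hF hs
  exact (contMDiffAt_iff_contDiffAt.1 h2).contDiffWithinAt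

namespace HermitianMetric

variable (h : HermitianMetric E U)

theorem form_zero_left (hV : V ≤ U) (t : E.Sec V) (x : V) : h.form V hV 0 t x = 0 := by
  have := h.add_left V hV 0 0 t x
  rw [add_zero] at this
  exact left_eq_add.1 this

theorem form_sum_left (hV : V ≤ U) (s : ι → E.Sec V) (t : E.Sec V) (x : V) :
    h.form V hV (∑ i, s i) t x = ∑ i, h.form V hV (s i) t x := by
  let f : E.Sec V →+ ℂ :=
    { toFun := fun s => h.form V hV s t x
      map_zero' := h.form_zero_left hV t x
      map_add' := fun a b => h.add_left V hV a b t x }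
  exact map_sum f s Finset.univ

theorem form_linear_left (hV : V ≤ U) (a : ι → HolFun n V) (s : ι → E.Sec V) (t : E.Sec V) (x : V) :
    h.form V hV (∑ i, a i • s i) t x = ∑ i, (a i).eval x * h.form V hV (s i) t x := by
  simp only [form_sum_left, h.smul_left]

theorem form_linear_right (hV : V ≤ U) (a : ι → HolFun n V) (s : E.Sec V) (t : ι → E.Sec V)
    (x : V) : h.form V hV s (∑ i, a i • t i) x = ∑ i, star ((a i).eval x) * h.form V hV s (t i) x := by
  rw [h.conj_symm, form_linear_left, map_sum]
  refine Finset.sum_congr rfl fun i _ => ?_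
  rw [map_mul, ← h.conj_symm]
  rfl

/-- The matrix of the metric in a family of sections at a point. -/
noncomputable def gramAt (hV : V ≤ U) (e : ι → E.Sec V) (x : V) : Matrix ι ι ℂ :=
  Matrix.of fun i j => h.form V hV (e i) (e j) x

/-- The matrix of the metric in a family of sections, read in a chart. -/
noncomputable def gramIn (hV : V ≤ U) (e : ι → E.Sec V)
    (c : OpenPartialHomeomorph X (Fin n → ℂ)) (z : Fin n → ℂ) : Matrix ι ι ℂ :=
  Matrix.of fun i j => inChart c (h.form V hV (e i) (e j)) z

omit [Fintype ι] in
theorem gramIn_eq (hV : V ≤ U) (e : ι → E.Sec V) {c : OpenPartialHomeomorph X (Fin n → ℂ)}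
    {z : Fin n → ℂ} (hz : c.symm z ∈ V) : h.gramIn hV e c z = h.gramAt hV e ⟨c.symm z, hz⟩ := by
  ext i j
  exact inChart_of_mem hz

/-- The axiom `posDef` concerns frames indexed by `Fin r`; reindexing extends it to the pairs and
disjoint unions that index frames of tensor products and direct sums. -/
theorem gramAt_posDef (hV : V ≤ U) {e : ι → E.Sec V} (he : IsFrame e) (x : V) :
    (h.gramAt hV e x).PosDef :=
  (h.posDef V hV _ _ (he.reindex (Fintype.equivFin ι).symm) x).submatrix
    (e := Fintype.equivFin ι) (Equiv.injective _) |> fun h1 => by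
      convert h1 using 1
      ext i j
      simp [gramAt]

theorem gramIn_posDef (hV : V ≤ U) {e : ι → E.Sec V} (he : IsFrame e)
    {c : OpenPartialHomeomorph X (Fin n → ℂ)} {z : Fin n → ℂ} (hz : z ∈ chartSet c V) :
    (h.gramIn hV e c z).PosDef := by
  rw [h.gramIn_eq hV e hz.2]
  exact h.gramAt_posDef hV he _

omit [Fintype ι] in
theorem gramIn_smooth (hV : V ≤ U) (e : ι → E.Sec V) {c : OpenPartialHomeomorph X (Fin n → ℂ)}
    (hc : c ∈ atlas (Fin n → ℂ) X) : MatSmoothOn ℝ (h.gramIn hV e c) (chartSet c V) := fun i j =>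
  h.smooth V hV (e i) (e j) c hc

omit [Fintype ι] in
theorem gramAt_change (hV : V ≤ U) (hV' : V' ≤ U) (hW : W ≤ V) (hW' : W ≤ V') {e : ι → E.Sec V}
    {e' : κ → E.Sec V'} {P : Matrix ι κ (HolFun n W)}
    (hP : ∀ i, res hW (e i) = ∑ j, P i j • res hW' (e' j)) (x : W) :
    h.gramAt hV e ⟨x, hW x.2⟩ = (Matrix.of fun i j => (P i j).eval x) *
      h.gramAt hV' e' ⟨x, hW' x.2⟩ * (Matrix.of fun i j => (P i j).eval x)ᴴ := by
  ext i j
  have h1 : h.gramAt hV e ⟨x, hW x.2⟩ i j = h.form W (hW.trans hV) (res hW (e i)) (res hW (e j)) x :=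
    (h.restrict V W hV hW (e i) (e j) x).symm
  have h2 : ∀ k l, h.gramAt hV' e' ⟨x, hW' x.2⟩ k l =
      h.form W (hW'.trans hV') (res hW' (e' k)) (res hW' (e' l)) x := fun k l =>
    (h.restrict V' W hV' hW' (e' k) (e' l) x).symm
  rw [h1, hP, hP, form_linear_right]
  simp only [Matrix.mul_apply, form_linear_left, h2, Matrix.of_apply, Matrix.conjTranspose_apply,
    Finset.sum_mul, Finset.mul_sum]
  exact Finset.sum_congr rfl fun k _ => Finset.sum_congr rfl fun l _ => by ring

variable [IsManifold 𝓘(ℂ, Fin n → ℂ) ∞ X]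

/-- Near a point two frames are related by a holomorphic change of frame, which transforms the
matrix of the metric by congruence and the curvature by conjugation. -/
theorem exists_frame_change [DecidableEq ι] [DecidableEq κ] (hV : V ≤ U) (hV' : V' ≤ U)
    {e : ι → E.Sec V} (he : IsFrame e) {e' : κ → E.Sec V'} (he' : IsFrame e') {x : X} (hx : x ∈ V)
    (hx' : x ∈ V') {c : OpenPartialHomeomorph X (Fin n → ℂ)} (hc : c ∈ atlas (Fin n → ℂ) X)
    (hxc : x ∈ c.source) : ∃ (P : Matrix ι κ ℂ) (Q : Matrix κ ι ℂ), P * Q = 1 ∧ Q * P = 1 ∧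
      h.gramIn hV e c (c x) = P * h.gramIn hV' e' c (c x) * Pᴴ ∧
      ∀ α β, chernCurvature (h.gramIn hV e c) α β (c x) =
        P * chernCurvature (h.gramIn hV' e' c) α β (c x) * Q := by
  let W : Opens X := V ⊓ V'
  have hW : W ≤ V := inf_le_left
  have hW' : W ≤ V' := inf_le_right
  obtain ⟨P, Q, hP, hPQ, hQP⟩ := he.exists_change he' hW hW'
  let Pc : (Fin n → ℂ) → Matrix ι κ ℂ := fun z => Matrix.of fun i j => inChart c (P i j).eval z
  let Qc : (Fin n → ℂ) → Matrix κ ι ℂ := fun z => Matrix.of fun i j => inChart c (Q i j).eval z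
  have hPc : MatSmoothOn ℂ Pc (chartSet c W) := fun i j => contDiffOn_inChart (P i j) hc
  have hQc : MatSmoothOn ℂ Qc (chartSet c W) := fun i j => contDiffOn_inChart (Q i j) hc
  have hPe : ∀ z (hz : c.symm z ∈ W), Pc z = P.map (HolFun.evalHom ⟨c.symm z, hz⟩) := fun z hz => by
    ext i j
    exact inChart_of_mem hz
  have hQe : ∀ z (hz : c.symm z ∈ W), Qc z = Q.map (HolFun.evalHom ⟨c.symm z, hz⟩) := fun z hz => by
    ext i j
    exact inChart_of_mem hz
  have hPQc : ∀ z ∈ chartSet c W, Pc z * Qc z = 1 := fun z hz => by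
    rw [hPe z hz.2, hQe z hz.2, ← Matrix.map_mul, hPQ, Matrix.map_one _ (map_zero _) (map_one _)]
  have hQPc : ∀ z ∈ chartSet c W, Qc z * Pc z = 1 := fun z hz => by
    rw [hPe z hz.2, hQe z hz.2, ← Matrix.map_mul, hQP, Matrix.map_one _ (map_zero _) (map_one _)]
  have hgram : ∀ z ∈ chartSet c W, h.gramIn hV e c z = Pc z * h.gramIn hV' e' c z * (Pc z)ᴴ := by
    intro z hz
    rw [h.gramIn_eq hV e (hW hz.2), h.gramIn_eq hV' e' (hW' hz.2), hPe z hz.2]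
    exact h.gramAt_change hV hV' hW hW' hP ⟨c.symm z, hz.2⟩
  have hxW : c x ∈ chartSet c W := mem_chartSet hxc ⟨hx, hx'⟩
  have hΩ := isOpen_chartSet c W
  have hsub : chartSet c W ⊆ chartSet c V' := fun z hz => ⟨hz.1, hW' hz.2⟩
  refine ⟨Pc (c x), Qc (c x), hPQc _ hxW, hQPc _ hxW, hgram _ hxW, fun α β => ?_⟩
  -- The congruence of Gram matrices holds on an open set around `c x`, so it may be differentiated.
  rw [chernCurvature_congr hΩ hxW hgram]
  exact chernCurvature_frame_change hΩ (fun i j => (h.gramIn_smooth hV' e' hc i j).mono hsub)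
    (fun z hz => (h.gramIn_posDef hV' he' (hsub hz)).det_pos.ne') hPc hQc hPQc hQPc hxW α β

/-- The inverse of the matrix of the Kähler metric in a chart. -/
noncomputable def _root_.Higgs.KahlerMetric.invCoeff (g : KahlerMetric n X)
    (c : OpenPartialHomeomorph X (Fin n → ℂ)) (z : Fin n → ℂ) : Matrix (Fin n) (Fin n) ℂ :=
  (metricCoeff g.inner c z)⁻¹

omit [IsManifold 𝓘(ℂ, Fin n → ℂ) ∞ X] in
theorem curvatureNormSqIn_eq (g : KahlerMetric n X) (hV : V ≤ U) {r : ℕ} (e : Fin r → E.Sec V)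
    (c : OpenPartialHomeomorph X (Fin n → ℂ)) (z : Fin n → ℂ) :
    h.curvatureNormSqIn g hV e c z = curvForm (g.invCoeff c z) (h.gramIn hV e c z)
      fun α β => chernCurvature (h.gramIn hV e c) α β z := rfl

/-- The mean curvature in a frame and a chart. -/
noncomputable def meanCurvIn (g : KahlerMetric n X) [DecidableEq ι] (hV : V ≤ U) (e : ι → E.Sec V)
    (c : OpenPartialHomeomorph X (Fin n → ℂ)) (z : Fin n → ℂ) : Matrix ι ι ℂ :=
  contraction (g.invCoeff c z) fun α β => chernCurvature (h.gramIn hV e c) α β z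

omit [IsManifold 𝓘(ℂ, Fin n → ℂ) ∞ X] in
theorem meanCurvatureNormIn_eq (g : KahlerMetric n X) (hV : V ≤ U) {r : ℕ} (e : Fin r → E.Sec V)
    (c : OpenPartialHomeomorph X (Fin n → ℂ)) (z : Fin n → ℂ) :
    h.meanCurvatureNormIn g hV e c z = √(endProd (h.gramIn hV e c z) (h.meanCurvIn g hV e c z)
      (h.meanCurvIn g hV e c z)).re := rfl

/-- Allows a frame with any finite index type as reference. The chart is fixed throughout: the
estimates are made chart by chart, so invariance under change of chart is not needed. -/
theorem curvatureNormSqIn_eq_of_frame [DecidableEq κ] (g : KahlerMetric n X) (hV : V ≤ U)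
    (hV' : V' ≤ U) {r : ℕ} {e : Fin r → E.Sec V} (he : IsFrame e) {e' : κ → E.Sec V'}
    (he' : IsFrame e') {x : X} (hx : x ∈ V) (hx' : x ∈ V')
    {c : OpenPartialHomeomorph X (Fin n → ℂ)} (hc : c ∈ atlas (Fin n → ℂ) X) (hxc : x ∈ c.source) :
    h.curvatureNormSqIn g hV e c (c x) = curvForm (g.invCoeff c (c x)) (h.gramIn hV' e' c (c x))
      fun α β => chernCurvature (h.gramIn hV' e' c) α β (c x) := by
  obtain ⟨P, Q, hPQ, hQP, hgram, hcurv⟩ := h.exists_frame_change hV hV' he he' hx hx' hc hxc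
  rw [curvatureNormSqIn_eq, hgram]
  simp only [hcurv]
  exact curvForm_frame_change hPQ hQP
    (h.gramIn_posDef hV' he' (mem_chartSet hxc hx')).det_pos.ne' _

theorem meanCurvatureNormIn_eq_of_frame [DecidableEq κ] (g : KahlerMetric n X) (hV : V ≤ U)
    (hV' : V' ≤ U) {r : ℕ} {e : Fin r → E.Sec V} (he : IsFrame e) {e' : κ → E.Sec V'}
    (he' : IsFrame e') {x : X} (hx : x ∈ V) (hx' : x ∈ V')
    {c : OpenPartialHomeomorph X (Fin n → ℂ)} (hc : c ∈ atlas (Fin n → ℂ) X) (hxc : x ∈ c.source) :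
    h.meanCurvatureNormIn g hV e c (c x) = √(endProd (h.gramIn hV' e' c (c x))
      (h.meanCurvIn g hV' e' c (c x)) (h.meanCurvIn g hV' e' c (c x))).re := by
  obtain ⟨P, Q, hPQ, hQP, hgram, hcurv⟩ := h.exists_frame_change hV hV' he he' hx hx' hc hxc
  have hm : h.meanCurvIn g hV e c (c x) = P * h.meanCurvIn g hV' e' c (c x) * Q := by
    simp only [meanCurvIn, hcurv, contraction_frame_change]
  rw [meanCurvatureNormIn_eq, hgram, hm, endProd_frame_change hPQ hQP
    (h.gramIn_posDef hV' he' (mem_chartSet hxc hx')).det_pos.ne']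

omit [IsManifold 𝓘(ℂ, Fin n → ℂ) ∞ X] in
theorem curvatureNormSqIn_le (g : KahlerMetric n X) (hV : V ≤ U) {r : ℕ} {e : Fin r → E.Sec V}
    (he : IsFrame e) {x : X} (hx : x ∈ V) {c : OpenPartialHomeomorph X (Fin n → ℂ)}
    (hc : c ∈ atlas (Fin n → ℂ) X) (hxc : x ∈ c.source) :
    ENNReal.ofReal (h.curvatureNormSqIn g hV e c (c x)) ≤ h.curvatureNormSq g x :=
  le_iSup₂_of_le c hc <| le_iSup_of_le hxc <| le_iSup₂_of_le V hV <| le_iSup_of_le hx <|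
    le_iSup₂_of_le r e <| le_iSup_of_le he le_rfl

omit [IsManifold 𝓘(ℂ, Fin n → ℂ) ∞ X] in
theorem meanCurvatureNormIn_le (g : KahlerMetric n X) (hV : V ≤ U) {r : ℕ} {e : Fin r → E.Sec V}
    (he : IsFrame e) {x : X} (hx : x ∈ V) {c : OpenPartialHomeomorph X (Fin n → ℂ)}
    (hc : c ∈ atlas (Fin n → ℂ) X) (hxc : x ∈ c.source) :
    ENNReal.ofReal (h.meanCurvatureNormIn g hV e c (c x)) ≤ h.meanCurvatureNorm g x :=
  le_iSup₂_of_le c hc <| le_iSup_of_le hxc <| le_iSup₂_of_le V hV <| le_iSup_of_le hx <|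
    le_iSup₂_of_le r e <| le_iSup_of_le he le_rfl

end HermitianMetric

end Gram

/-! ### Positivity of the Kähler matrix and measurability of the curvature norms -/

section Measurability

open AnalyticSheaf

variable {n : ℕ} {X : Type} [TopologicalSpace X] [ChartedSpace (Fin n → ℂ) X]
  [IsManifold 𝓘(ℂ, Fin n → ℂ) ∞ X] {E : AnalyticSheaf n X} {U V : Opens X} {ι : Type} [Fintype ι]

omit [IsManifold 𝓘(ℂ, Fin n → ℂ) ∞ X] in
theorem KahlerMetric.inner_self_pos (g : KahlerMetric n X) (x : X)
    {v : TangentSpace 𝓘(ℂ, Fin n → ℂ) x} (hv : v ≠ 0) : 0 < g.inner x v v := by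
  have h := g.conj_symm x v v
  rw [Complex.lt_def]
  exact ⟨g.pos x v hv, (Complex.conj_eq_iff_im.1 h.symm).symm⟩

theorem chartVec_injective {c : OpenPartialHomeomorph X (Fin n → ℂ)} (hc : c ∈ atlas (Fin n → ℂ) X)
    {z : Fin n → ℂ} (hz : z ∈ c.target) : Function.Injective (chartVec (n := n) c z) := by
  have : IsManifold 𝓘(ℂ, Fin n → ℂ) 1 X := IsManifold.of_le (n := ∞) (by simp)
  exact (mdifferentiable_of_mem_atlas (I := 𝓘(ℂ, Fin n → ℂ)) hc).symm.mfderiv_injective hz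

theorem metricCoeff_posDef (g : KahlerMetric n X) {c : OpenPartialHomeomorph X (Fin n → ℂ)}
    (hc : c ∈ atlas (Fin n → ℂ) X) {z : Fin n → ℂ} (hz : z ∈ c.target) :
    (metricCoeff g.inner c z).PosDef := by
  let T : (Fin n → ℂ) →L[ℂ] TangentSpace 𝓘(ℂ, Fin n → ℂ) (c.symm z) :=
    mfderiv 𝓘(ℂ, Fin n → ℂ) 𝓘(ℂ, Fin n → ℂ) c.symm z
  refine .of_dotProduct_mulVec_pos ?_ fun v hv => ?_
  · ext i j
    exact (g.conj_symm _ _ _).symm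
  -- The inner product is linear in its first variable, so the quadratic form of the matrix at `v`
  -- is the squared length of the image of `star v`.
  · have h : star v ⬝ᵥ (metricCoeff g.inner c z *ᵥ v) =
        g.inner (c.symm z) (T (star v)) (T (star v)) := by
      have hT : T (star v) = ∑ i, star (v i) • T (Pi.single i 1) := by
        conv_lhs => rw [← Finset.univ_sum_single (star v)]
        rw [map_sum]
        refine Finset.sum_congr rfl fun i _ => ?_
        rw [← map_smul, ← Pi.single_smul, smul_eq_mul, mul_one]
        rfl
      rw [hT]
      simp only [map_sum, LinearMap.sum_apply, map_smul, LinearMap.smul_apply, map_smulₛₗ,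
        dotProduct, Matrix.mulVec, Finset.mul_sum, smul_eq_mul]
      rw [Finset.sum_comm]
      refine Finset.sum_congr rfl fun i _ => Finset.sum_congr rfl fun j _ => ?_
      rw [starRingEnd_apply, star_star]
      change star (v j) * (g.inner (c.symm z) (T (Pi.single j 1)) (T (Pi.single i 1)) * v i) = _
      ring
    rw [h]
    refine g.inner_self_pos _ fun h0 => hv ?_
    have := chartVec_injective hc hz (a₁ := star v) (a₂ := 0) (h0.trans (map_zero T).symm)
    exact star_eq_zero.1 this

omit [Fintype ι] in
theorem continuousAt_of_matSmoothOn {κ : Type} {M : (Fin n → ℂ) → Matrix ι κ ℂ}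
    {Ω : Set (Fin n → ℂ)} (hM : MatSmoothOn ℝ M Ω) (hΩ : IsOpen Ω) {z : Fin n → ℂ} (hz : z ∈ Ω) :
    ContinuousAt M z :=
  continuousAt_pi.2 fun i => continuousAt_pi.2 fun j =>
    (hM i j).continuousOn.continuousAt (hΩ.mem_nhds hz)

omit [IsManifold 𝓘(ℂ, Fin n → ℂ) ∞ X] in
theorem metricCoeff_smooth (g : KahlerMetric n X) {c : OpenPartialHomeomorph X (Fin n → ℂ)}
    (hc : c ∈ atlas (Fin n → ℂ) X) : MatSmoothOn ℝ (metricCoeff g.inner c) c.target :=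
  fun α β => g.smooth c hc α β

theorem continuousAt_invCoeff (g : KahlerMetric n X) {c : OpenPartialHomeomorph X (Fin n → ℂ)}
    (hc : c ∈ atlas (Fin n → ℂ) X) {z : Fin n → ℂ} (hz : z ∈ c.target) :
    ContinuousAt (g.invCoeff c) z :=
  continuousAt_of_matSmoothOn ((metricCoeff_smooth g hc).inv fun _ hw =>
    (metricCoeff_posDef g hc hw).det_pos.ne') c.open_target hz

namespace HermitianMetric

variable (h : HermitianMetric E U)

omit [IsManifold 𝓘(ℂ, Fin n → ℂ) ∞ X] in
omit [Fintype ι] in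
theorem continuousAt_gramIn (hV : V ≤ U) (e : ι → E.Sec V)
    {c : OpenPartialHomeomorph X (Fin n → ℂ)} (hc : c ∈ atlas (Fin n → ℂ) X) {z : Fin n → ℂ}
    (hz : z ∈ chartSet c V) : ContinuousAt (h.gramIn hV e c) z :=
  continuousAt_of_matSmoothOn (h.gramIn_smooth hV e hc) (isOpen_chartSet c V) hz

variable [DecidableEq ι]

omit [IsManifold 𝓘(ℂ, Fin n → ℂ) ∞ X] in
theorem continuousAt_gramIn_inv (hV : V ≤ U) {e : ι → E.Sec V} (he : IsFrame e)
    {c : OpenPartialHomeomorph X (Fin n → ℂ)} (hc : c ∈ atlas (Fin n → ℂ) X) {z : Fin n → ℂ}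
    (hz : z ∈ chartSet c V) : ContinuousAt (fun w => (h.gramIn hV e c w)⁻¹) z :=
  continuousAt_of_matSmoothOn ((h.gramIn_smooth hV e hc).inv fun _ hw =>
    (h.gramIn_posDef hV he hw).det_pos.ne') (isOpen_chartSet c V) hz

omit [IsManifold 𝓘(ℂ, Fin n → ℂ) ∞ X] in
theorem continuousAt_chernCurvature (hV : V ≤ U) {e : ι → E.Sec V} (he : IsFrame e)
    {c : OpenPartialHomeomorph X (Fin n → ℂ)} (hc : c ∈ atlas (Fin n → ℂ) X) {z : Fin n → ℂ}
    (hz : z ∈ chartSet c V) (α β : Fin n) :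
    ContinuousAt (chernCurvature (h.gramIn hV e c) α β) z :=
  continuousAt_of_matSmoothOn ((h.gramIn_smooth hV e hc).chernCurvature (isOpen_chartSet c V)
    (fun _ hw => (h.gramIn_posDef hV he hw).det_pos.ne') α β) (isOpen_chartSet c V) hz

omit [IsManifold 𝓘(ℂ, Fin n → ℂ) ∞ X] in
theorem continuousAt_endProd (hV : V ≤ U) {e : ι → E.Sec V} (he : IsFrame e)
    {c : OpenPartialHomeomorph X (Fin n → ℂ)} (hc : c ∈ atlas (Fin n → ℂ) X) {z : Fin n → ℂ}
    (hz : z ∈ chartSet c V) {A B : (Fin n → ℂ) → Matrix ι ι ℂ} (hA : ContinuousAt A z)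
    (hB : ContinuousAt B z) : ContinuousAt (fun w => endProd (h.gramIn hV e c w) (A w) (B w)) z := by
  have hΦ : Continuous fun p : Matrix ι ι ℂ × Matrix ι ι ℂ × Matrix ι ι ℂ × Matrix ι ι ℂ =>
      (p.1 * (p.2.1 * p.2.2.1ᴴ * p.2.2.2)).trace := by fun_prop
  simp only [endProd]
  exact hΦ.continuousAt.comp (f := fun w => (A w, h.gramIn hV e c w, B w, (h.gramIn hV e c w)⁻¹))
    (hA.prodMk ((h.continuousAt_gramIn hV e hc hz).prodMk
      (hB.prodMk (h.continuousAt_gramIn_inv hV he hc hz))))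

theorem continuousAt_curvatureNormSqIn (g : KahlerMetric n X) (hV : V ≤ U) {r : ℕ}
    {e : Fin r → E.Sec V} (he : IsFrame e) {c : OpenPartialHomeomorph X (Fin n → ℂ)}
    (hc : c ∈ atlas (Fin n → ℂ) X) {z : Fin n → ℂ} (hz : z ∈ chartSet c V) :
    ContinuousAt (h.curvatureNormSqIn g hV e c) z := by
  have hg : ∀ α β, ContinuousAt (fun w => g.invCoeff c w α β) z := fun α β =>
    continuousAt_pi.1 (continuousAt_pi.1 (continuousAt_invCoeff g hc hz.1) α) β
  refine Complex.continuous_re.continuousAt.comp ?_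
  refine tendsto_finsetSum _ fun α _ => tendsto_finsetSum _ fun β _ => tendsto_finsetSum _ fun γ _ =>
    tendsto_finsetSum _ fun δ _ => ?_
  exact ((hg _ _).mul (hg _ _)).mul (h.continuousAt_endProd hV he hc hz
    (h.continuousAt_chernCurvature hV he hc hz α β) (h.continuousAt_chernCurvature hV he hc hz γ δ))

theorem continuousAt_meanCurvatureNormIn (g : KahlerMetric n X) (hV : V ≤ U) {r : ℕ}
    {e : Fin r → E.Sec V} (he : IsFrame e) {c : OpenPartialHomeomorph X (Fin n → ℂ)}
    (hc : c ∈ atlas (Fin n → ℂ) X) {z : Fin n → ℂ} (hz : z ∈ chartSet c V) :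
    ContinuousAt (h.meanCurvatureNormIn g hV e c) z := by
  have hg : ∀ α β, ContinuousAt (fun w => g.invCoeff c w α β) z := fun α β =>
    continuousAt_pi.1 (continuousAt_pi.1 (continuousAt_invCoeff g hc hz.1) α) β
  have hK : ContinuousAt (fun w => ∑ α, ∑ β, g.invCoeff c w β α •
      chernCurvature (h.gramIn hV e c) α β w) z :=
    tendsto_finsetSum _ fun α _ => tendsto_finsetSum _ fun β _ =>
      Filter.Tendsto.smul (hg β α) (h.continuousAt_chernCurvature hV he hc hz α β)
  exact (Real.continuous_sqrt.comp Complex.continuous_re).continuousAt.comp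
    (h.continuousAt_endProd hV he hc hz hK hK)

omit [IsManifold 𝓘(ℂ, Fin n → ℂ) ∞ X] in
/-- A supremum over charts and frames of functions which are continuous where they are defined is
lower semicontinuous. -/
theorem lowerSemicontinuous_iSup_frames (N : ∀ (_ : OpenPartialHomeomorph X (Fin n → ℂ))
      (V : Opens X) (_ : V ≤ U) (r : ℕ) (_ : Fin r → E.Sec V), (Fin n → ℂ) → ℝ)
    (hN : ∀ c ∈ atlas (Fin n → ℂ) X, ∀ (V : Opens X) (hV : V ≤ U) (r : ℕ) (e : Fin r → E.Sec V),
      IsFrame e → ∀ z ∈ chartSet c V, ContinuousAt (N c V hV r e) z) :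
    LowerSemicontinuous fun x : X => ⨆ (c ∈ atlas (Fin n → ℂ) X) (_ : x ∈ c.source) (V : Opens X)
      (hV : V ≤ U) (_ : x ∈ V) (r : ℕ) (e : Fin r → E.Sec V) (_ : IsFrame e),
        ENNReal.ofReal (N c V hV r e (c x)) := by
  intro x y hy
  simp only [gt_iff_lt, lt_iSup_iff] at hy ⊢
  obtain ⟨c, hc, hxc, V, hV, hxV, r, e, he, hy⟩ := hy
  -- The chart and the frame that exceed `y` at `x` are still available, and still exceed it, at all
  -- nearby points.
  have h1 : ContinuousAt (fun x => ENNReal.ofReal (N c V hV r e (c x))) x :=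
    ENNReal.continuous_ofReal.continuousAt.comp
      ((hN c hc V hV r e he _ (mem_chartSet hxc hxV)).comp (c.continuousAt hxc))
  filter_upwards [h1.eventually_const_lt hy, c.open_source.mem_nhds hxc, V.isOpen.mem_nhds hxV]
    with w hw hwc hwV
  exact ⟨c, hc, hwc, V, hV, hwV, r, e, he, hw⟩

variable [MeasurableSpace X] [BorelSpace X]

/-- The supremum runs over a possibly uncountable family, so measurability of its members would not
suffice; lower semicontinuity does. -/
theorem measurable_curvatureNormSq (g : KahlerMetric n X) : Measurable (h.curvatureNormSq g) :=
  (lowerSemicontinuous_iSup_frames (fun c _ hV _ e => h.curvatureNormSqIn g hV e c)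
    fun _ hc _ hV _ _ he _ hz => h.continuousAt_curvatureNormSqIn g hV he hc hz).measurable

theorem measurable_meanCurvatureNorm (g : KahlerMetric n X) : Measurable (h.meanCurvatureNorm g) :=
  (lowerSemicontinuous_iSup_frames (fun c _ hV _ e => h.meanCurvatureNormIn g hV e c)
    fun _ hc _ hV _ _ he _ hz => h.continuousAt_meanCurvatureNormIn g hV he hc hz).measurable

end HermitianMetric

end Measurability

/-! ### Existence and uniqueness of the metric on the tensor product -/

section TensorMetric

open AnalyticSheaf
open scoped Kronecker

variable {n : ℕ} {X : Type} [TopologicalSpace X] [ChartedSpace (Fin n → ℂ) X]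
  {E₁ E₂ : AnalyticSheaf n X} {U₁ U₂ V W : Opens X}

namespace HermitianMetric

theorem ext_form {E : AnalyticSheaf n X} {U : Opens X} {h h' : HermitianMetric E U}
    (hh : ∀ V hV s t x, h.form V hV s t x = h'.form V hV s t x) : h = h' := by
  obtain ⟨f, _⟩ := h
  obtain ⟨f', _⟩ := h'
  obtain rfl : f = f' := by
    funext V hV s t x
    exact hh V hV s t x
  rfl

theorem add_right {E : AnalyticSheaf n X} {U : Opens X} (h : HermitianMetric E U) (hV : V ≤ U)
    (s t t' : E.Sec V) (x : V) :
    h.form V hV s (t + t') x = h.form V hV s t x + h.form V hV s t' x := by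
  rw [h.conj_symm, h.add_left, map_add, ← h.conj_symm, ← h.conj_symm]

theorem smul_right {E : AnalyticSheaf n X} {U : Opens X} (h : HermitianMetric E U) (hV : V ≤ U)
    (f : HolFun n V) (s t : E.Sec V) (x : V) :
    h.form V hV s (f • t) x = (starRingEnd ℂ) (f.eval x) * h.form V hV s t x := by
  rw [h.conj_symm, h.smul_left, map_mul, ← h.conj_symm]

variable (h₁ : HermitianMetric E₁ U₁) (h₂ : HermitianMetric E₂ U₂)

/-- The additive functional `s₁ ⊗ s₂ ↦ h₁(s₁, t₁) h₂(s₂, t₂)`. -/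
noncomputable def tensorFunctional (hV₁ : V ≤ U₁) (hV₂ : V ≤ U₂) (x : V) (t₁ : E₁.Sec V)
    (t₂ : E₂.Sec V) : E₁.Sec V ⊗[HolFun n V] E₂.Sec V →+ ℂ :=
  TensorProduct.liftAddHom
    (AddMonoidHom.mk' (fun s₁ => AddMonoidHom.mk'
      (fun s₂ => h₁.form V hV₁ s₁ t₁ x * h₂.form V hV₂ s₂ t₂ x)
      fun a b => by rw [h₂.add_left, mul_add])
      fun a b => by
        ext s
        change h₁.form V hV₁ (a + b) t₁ x * _ = _
        rw [h₁.add_left, add_mul]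
        rfl)
    fun r s₁ s₂ => by
      change h₁.form V hV₁ (r • s₁) t₁ x * _ = _ * h₂.form V hV₂ (r • s₂) t₂ x
      rw [h₁.smul_left, h₂.smul_left]
      ring

theorem tensorFunctional_tmul (hV₁ : V ≤ U₁) (hV₂ : V ≤ U₂) (x : V) (s₁ t₁ : E₁.Sec V)
    (s₂ t₂ : E₂.Sec V) : tensorFunctional h₁ h₂ hV₁ hV₂ x t₁ t₂ (s₁ ⊗ₜ s₂) =
      h₁.form V hV₁ s₁ t₁ x * h₂.form V hV₂ s₂ t₂ x := rfl

theorem tensorAddHom_ext {R M N A : Type*} [CommRing R] [AddCommGroup M] [AddCommGroup N]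
    [Module R M] [Module R N] [AddCommGroup A] {f g : M ⊗[R] N →+ A}
    (h : ∀ m k, f (m ⊗ₜ k) = g (m ⊗ₜ k)) : f = g := by
  ext u
  induction u with
  | zero => simp
  | tmul m k => exact h m k
  | add a b ha hb => rw [map_add, map_add, ha, hb]

/-- The sesquilinear pairing on `E₁(V) ⊗ E₂(V)` defined by `h₁` and `h₂` at a point; the variable in
which it is conjugate-linear comes first. -/
noncomputable def tensorPairing (hV₁ : V ≤ U₁) (hV₂ : V ≤ U₂) (x : V) :
    E₁.Sec V ⊗[HolFun n V] E₂.Sec V →+ E₁.Sec V ⊗[HolFun n V] E₂.Sec V →+ ℂ :=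
  TensorProduct.liftAddHom
    (AddMonoidHom.mk' (fun t₁ => AddMonoidHom.mk'
      (fun t₂ => tensorFunctional h₁ h₂ hV₁ hV₂ x t₁ t₂)
      fun a b => tensorAddHom_ext fun s₁ s₂ => by
        simp only [AddMonoidHom.add_apply, tensorFunctional_tmul, add_right, mul_add])
      fun a b => by
        ext t₂ : 1
        exact tensorAddHom_ext fun s₁ s₂ => by
          simp only [AddMonoidHom.mk'_apply, AddMonoidHom.add_apply, tensorFunctional_tmul,
            add_right, add_mul])
    fun r t₁ t₂ => tensorAddHom_ext fun s₁ s₂ => by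
      simp only [AddMonoidHom.mk'_apply, tensorFunctional_tmul, smul_right]
      ring

theorem tensorPairing_tmul (hV₁ : V ≤ U₁) (hV₂ : V ≤ U₂) (x : V) (s₁ t₁ : E₁.Sec V)
    (s₂ t₂ : E₂.Sec V) : tensorPairing h₁ h₂ hV₁ hV₂ x (t₁ ⊗ₜ t₂) (s₁ ⊗ₜ s₂) =
      h₁.form V hV₁ s₁ t₁ x * h₂.form V hV₂ s₂ t₂ x := rfl

theorem tensorPairing_smul (hV₁ : V ≤ U₁) (hV₂ : V ≤ U₂) (x : V) (f : HolFun n V)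
    (u v : E₁.Sec V ⊗[HolFun n V] E₂.Sec V) : tensorPairing h₁ h₂ hV₁ hV₂ x v (f • u) =
      f.eval x * tensorPairing h₁ h₂ hV₁ hV₂ x v u := by
  induction u with
  | zero => simp
  | add a b ha hb => rw [smul_add, map_add, map_add, ha, hb, mul_add]
  | tmul s₁ s₂ =>
    induction v with
    | zero => simp
    | add a b ha hb => simp only [map_add, AddMonoidHom.add_apply, ha, hb, mul_add]
    | tmul t₁ t₂ =>
      rw [TensorProduct.smul_tmul', tensorPairing_tmul, tensorPairing_tmul, h₁.smul_left, mul_assoc]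

theorem tensorPairing_conj (hV₁ : V ≤ U₁) (hV₂ : V ≤ U₂) (x : V)
    (u v : E₁.Sec V ⊗[HolFun n V] E₂.Sec V) : tensorPairing h₁ h₂ hV₁ hV₂ x u v =
      (starRingEnd ℂ) (tensorPairing h₁ h₂ hV₁ hV₂ x v u) := by
  induction u with
  | zero => simp
  | add a b ha hb => simp only [map_add, AddMonoidHom.add_apply, ha, hb]
  | tmul s₁ s₂ =>
    induction v with
    | zero => simp
    | add a b ha hb => simp only [map_add, AddMonoidHom.add_apply, ha, hb]
    | tmul t₁ t₂ =>
      rw [tensorPairing_tmul, tensorPairing_tmul, map_mul, ← h₁.conj_symm, ← h₂.conj_symm]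

theorem tensorPairing_linear {ι κ : Type} [Fintype ι] [Fintype κ] (hV₁ : V ≤ U₁) (hV₂ : V ≤ U₂)
    (x : V) (a : ι → HolFun n V) (b : κ → HolFun n V) (u : ι → E₁.Sec V ⊗[HolFun n V] E₂.Sec V)
    (v : κ → E₁.Sec V ⊗[HolFun n V] E₂.Sec V) :
    tensorPairing h₁ h₂ hV₁ hV₂ x (∑ j, b j • v j) (∑ i, a i • u i) =
      ∑ i, ∑ j, (a i).eval x * tensorPairing h₁ h₂ hV₁ hV₂ x (v j) (u i) * star ((b j).eval x) := by
  rw [map_sum]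
  refine Finset.sum_congr rfl fun i _ => ?_
  rw [tensorPairing_smul, tensorPairing_conj, map_sum, map_sum, Finset.mul_sum]
  refine Finset.sum_congr rfl fun j _ => ?_
  rw [tensorPairing_smul, map_mul, ← tensorPairing_conj, starRingEnd_apply]
  ring

theorem tensorPairing_res (hV₁ : V ≤ U₁) (hV₂ : V ≤ U₂) (hW : W ≤ V) (x : W)
    (u v : E₁.Sec V ⊗[HolFun n V] E₂.Sec V) :
    tensorPairing h₁ h₂ (hW.trans hV₁) (hW.trans hV₂) x (resTensor E₁ E₂ hW v)
      (resTensor E₁ E₂ hW u) = tensorPairing h₁ h₂ hV₁ hV₂ ⟨x, hW x.2⟩ v u := by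
  induction u with
  | zero => simp
  | add a b ha hb => simp only [map_add, ha, hb]
  | tmul s₁ s₂ =>
    induction v with
    | zero => simp
    | add a b ha hb => simp only [map_add, AddMonoidHom.add_apply, ha, hb]
    | tmul t₁ t₂ =>
      rw [resTensor_tmul, resTensor_tmul, tensorPairing_tmul, tensorPairing_tmul, h₁.restrict V W,
        h₂.restrict V W]

omit [ChartedSpace (Fin n → ℂ) X] in
theorem inChart_eqOn {c : OpenPartialHomeomorph X (Fin n → ℂ)} {f g k : V → ℂ}
    {op : ℂ → ℂ → ℂ} (h : ∀ x, k x = op (f x) (g x)) :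
    ∀ z ∈ c.target ∩ c.symm ⁻¹' V, inChart c k z = op (inChart c f z) (inChart c g z) := by
  intro z hz
  rw [inChart_of_mem hz.2, inChart_of_mem hz.2, inChart_of_mem hz.2, h]

theorem tensorPairing_smooth (hV₁ : V ≤ U₁) (hV₂ : V ≤ U₂)
    (u v : E₁.Sec V ⊗[HolFun n V] E₂.Sec V) {c : OpenPartialHomeomorph X (Fin n → ℂ)}
    (hc : c ∈ atlas (Fin n → ℂ) X) :
    ContDiffOn ℝ ∞ (inChart c fun x => tensorPairing h₁ h₂ hV₁ hV₂ x v u)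
      (c.target ∩ c.symm ⁻¹' V) := by
  have h0 : ContDiffOn ℝ ∞ (inChart c fun _ : V => 0) (c.target ∩ c.symm ⁻¹' V) :=
    contDiffOn_const (c := (0 : ℂ)) |>.congr fun z hz => inChart_of_mem hz.2
  induction u with
  | zero => simpa only [map_zero] using h0
  | add a b ha hb => 
    exact (ha.add hb).congr (inChart_eqOn (op := (· + ·)) fun x => map_add _ _ _)
  | tmul s₁ s₂ =>
    induction v with
    | zero => simpa only [map_zero, AddMonoidHom.zero_apply] using h0
    | add a b ha hb =>
      exact (ha.add hb).congr (inChart_eqOn (op := (· + ·)) fun x => by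
        rw [map_add, AddMonoidHom.add_apply])
    | tmul t₁ t₂ =>
      exact ((h₁.smooth V hV₁ s₁ t₁ c hc).mul (h₂.smooth V hV₂ s₂ t₂ c hc)).congr
        (inChart_eqOn (op := (· * ·)) fun x => rfl)

/-- Elements with the same image in the sheaf agree near `x`, and the pairing at `x` can be computed
after restriction. Conjugate symmetry transfers this to the other variable. -/
theorem tensorPairing_eq_of_ofTensor_eq (hV₁ : V ≤ U₁) (hV₂ : V ≤ U₂) (x : V)
    {u u' v v' : E₁.Sec V ⊗[HolFun n V] E₂.Sec V}
    (hu : ofTensor E₁ E₂ V u = ofTensor E₁ E₂ V u') (hv : ofTensor E₁ E₂ V v = ofTensor E₁ E₂ V v') :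
    tensorPairing h₁ h₂ hV₁ hV₂ x v u = tensorPairing h₁ h₂ hV₁ hV₂ x v' u' := by
  have key : ∀ {u u' : E₁.Sec V ⊗[HolFun n V] E₂.Sec V} (v : E₁.Sec V ⊗[HolFun n V] E₂.Sec V),
      ofTensor E₁ E₂ V u = ofTensor E₁ E₂ V u' →
      tensorPairing h₁ h₂ hV₁ hV₂ x v u = tensorPairing h₁ h₂ hV₁ hV₂ x v u' := by
    intro u u' v hu
    obtain ⟨W, hW, hxW, h⟩ := resTensor_eq_of_ofTensor_eq hu x.2
    rw [← tensorPairing_res h₁ h₂ hV₁ hV₂ hW ⟨x, hxW⟩, h, tensorPairing_res]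
  rw [key v hu, tensorPairing_conj, key u' hv, ← tensorPairing_conj]

theorem exists_ofTensor_pair (s t : (ten E₁ E₂).Sec V) {x : X} (hx : x ∈ V) :
    ∃ (W : Opens X) (hW : W ≤ V), x ∈ W ∧ ∃ u v, ofTensor E₁ E₂ W u = res hW s ∧
      ofTensor E₁ E₂ W v = res hW t := by
  obtain ⟨W, hW, hxW, u, hu⟩ := exists_ofTensor s hx
  obtain ⟨W', hW', hxW', v, hv⟩ := exists_ofTensor (res hW t) hxW
  refine ⟨W', hW'.trans hW, hxW', resTensor E₁ E₂ hW' u, v, ?_, ?_⟩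
  · rw [← res_ofTensor, hu, res_res]
  · rw [hv, res_res]

/-- The value at `x` depends neither on the neighbourhood nor on the local representatives: any two
choices are compared on the intersection. -/
theorem exists_tensorForm (hV : V ≤ U₁ ⊓ U₂) (s t : (ten E₁ E₂).Sec V) (x : V) :
    ∃ a : ℂ, ∀ (W : Opens X) (hW : W ≤ V) (hx : (x : X) ∈ W) u v,
      ofTensor E₁ E₂ W u = res hW s → ofTensor E₁ E₂ W v = res hW t →
      a = tensorPairing h₁ h₂ ((hW.trans hV).trans inf_le_left) ((hW.trans hV).trans inf_le_right)
        ⟨x, hx⟩ v u := by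
  obtain ⟨W₀, hW₀, hx₀, u₀, v₀, hu₀, hv₀⟩ := exists_ofTensor_pair s t x.2
  refine ⟨tensorPairing h₁ h₂ ((hW₀.trans hV).trans inf_le_left)
    ((hW₀.trans hV).trans inf_le_right) ⟨x, hx₀⟩ v₀ u₀, fun W hW hx u v hu hv => ?_⟩
  have hl : W₀ ⊓ W ≤ W₀ := inf_le_left
  have hr : W₀ ⊓ W ≤ W := inf_le_right
  rw [← tensorPairing_res h₁ h₂ _ _ hl ⟨x, hx₀, hx⟩, ← tensorPairing_res h₁ h₂ _ _ hr ⟨x, hx₀, hx⟩]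
  refine tensorPairing_eq_of_ofTensor_eq h₁ h₂ _ _ _ ?_ ?_
  · rw [← res_ofTensor, ← res_ofTensor, hu, hu₀, res_res, res_res]
  · rw [← res_ofTensor, ← res_ofTensor, hv, hv₀, res_res, res_res]

/-- The sesquilinear form on sections of `E₁ ⊗ E₂` defined by `h₁` and `h₂`. -/
noncomputable def tensorForm (hV : V ≤ U₁ ⊓ U₂) (s t : (ten E₁ E₂).Sec V) (x : V) : ℂ :=
  (exists_tensorForm h₁ h₂ hV s t x).choose

theorem tensorForm_eq (hV : V ≤ U₁ ⊓ U₂) {s t : (ten E₁ E₂).Sec V} {x : V} {W : Opens X}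
    (hW : W ≤ V) (hx : (x : X) ∈ W) {u v : E₁.Sec W ⊗[HolFun n W] E₂.Sec W}
    (hu : ofTensor E₁ E₂ W u = res hW s) (hv : ofTensor E₁ E₂ W v = res hW t) :
    tensorForm h₁ h₂ hV s t x = tensorPairing h₁ h₂ ((hW.trans hV).trans inf_le_left)
      ((hW.trans hV).trans inf_le_right) ⟨x, hx⟩ v u :=
  (exists_tensorForm h₁ h₂ hV s t x).choose_spec W hW hx u v hu hv

theorem tensorForm_tmul (hV : V ≤ U₁ ⊓ U₂) (s₁ t₁ : E₁.Sec V) (s₂ t₂ : E₂.Sec V) (x : V) :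
    tensorForm h₁ h₂ hV (tmul s₁ s₂) (tmul t₁ t₂) x = h₁.form V (hV.trans inf_le_left) s₁ t₁ x *
      h₂.form V (hV.trans inf_le_right) s₂ t₂ x :=
  (tensorForm_eq h₁ h₂ hV le_rfl x.2 (u := s₁ ⊗ₜ s₂) (v := t₁ ⊗ₜ t₂) (res_self _ _).symm
    (res_self _ _).symm).trans rfl

/-- A frame of `E₁ ⊗ E₂` need not consist of pure tensors. Near a point where both factors are
locally free it differs from a tensor product of frames by an invertible matrix, so its Gram matrix
is congruent to a Kronecker product of positive definite ones. -/
theorem tensorForm_posDef (hV : V ≤ U₁ ⊓ U₂) {r : ℕ} {e : Fin r → (ten E₁ E₂).Sec V}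
    (he : IsFrame e) (x : V) (hx₁ : (x : X) ∉ E₁.singularSet) (hx₂ : (x : X) ∉ E₂.singularSet) :
    (Matrix.of fun i j => tensorForm h₁ h₂ hV (e i) (e j) x).PosDef := by
  obtain ⟨V₁, hxV₁, r₁, e₁, he₁⟩ := not_not.1 hx₁
  obtain ⟨V₂, hxV₂, r₂, e₂, he₂⟩ := not_not.1 hx₂
  let W : Opens X := V ⊓ (V₁ ⊓ V₂)
  have hW : W ≤ V := inf_le_left
  have hW₁ : W ≤ V₁ := inf_le_right.trans inf_le_left
  have hW₂ : W ≤ V₂ := inf_le_right.trans inf_le_right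
  have hxW : (x : X) ∈ W := ⟨x.2, hxV₁, hxV₂⟩
  have hf₁ := he₁.restrict hW₁
  have hf₂ := he₂.restrict hW₂
  set f₁ := fun i => res hW₁ (e₁ i)
  set f₂ := fun i => res hW₂ (e₂ i)
  obtain ⟨P, Q, hP, hPQ, -⟩ := he.exists_change (hf₁.tensor hf₂) hW le_rfl
  have hWU₁ : W ≤ U₁ := (hW.trans hV).trans inf_le_left
  have hWU₂ : W ≤ U₂ := (hW.trans hV).trans inf_le_right
  let ev : HolFun n W →+* ℂ := HolFun.evalHom (⟨x, hxW⟩ : W)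
  have hgram : (Matrix.of fun i j => tensorForm h₁ h₂ hV (e i) (e j) x) = P.map ev *
      (h₁.gramAt hWU₁ f₁ ⟨x, hxW⟩ ⊗ₖ h₂.gramAt hWU₂ f₂ ⟨x, hxW⟩) * (P.map ev)ᴴ := by
    have hu : ∀ i, ofTensor E₁ E₂ W (∑ j, P i j • (f₁ j.1 ⊗ₜ[HolFun n W] f₂ j.2)) =
        res hW (e i) := fun i => by
      rw [hP, map_sum]
      simp only [map_smul, res_self, tmul_eq]
    ext i j
    rw [Matrix.of_apply, tensorForm_eq h₁ h₂ hV hW hxW (hu i) (hu j), tensorPairing_linear]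
    simp only [tensorPairing_tmul, Matrix.mul_apply, Finset.sum_mul]
    rw [Finset.sum_comm]
    refine Finset.sum_congr rfl fun k _ => Finset.sum_congr rfl fun l _ => ?_
    simp only [Matrix.map_apply, Matrix.conjTranspose_apply, Matrix.kroneckerMap_apply, gramAt,
      Matrix.of_apply]
    rfl
  rw [hgram]
  refine posDef_congruence (Q := Q.map ev) ?_ ((h₁.gramAt_posDef hWU₁ hf₁ _).kronecker
    (h₂.gramAt_posDef hWU₂ hf₂ _))
  rw [← Matrix.map_mul, hPQ, Matrix.map_one _ (map_zero _) (map_one _)]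

theorem exists_tensorForm_eq_pair (hV : V ≤ U₁ ⊓ U₂) (s t : (ten E₁ E₂).Sec V) {x : X}
    (hx : x ∈ V) : ∃ (W : Opens X) (hW : W ≤ V), x ∈ W ∧ ∃ u v,
      ofTensor E₁ E₂ W u = res hW s ∧ ofTensor E₁ E₂ W v = res hW t ∧
      ∀ y : W, tensorForm h₁ h₂ hV s t ⟨y, hW y.2⟩ = tensorPairing h₁ h₂
        ((hW.trans hV).trans inf_le_left) ((hW.trans hV).trans inf_le_right) y v u := by
  obtain ⟨W, hW, hx, u, v, hu, hv⟩ := exists_ofTensor_pair s t hx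
  exact ⟨W, hW, hx, u, v, hu, hv, fun y => tensorForm_eq h₁ h₂ hV hW y.2 hu hv⟩

theorem tensorForm_smooth (hV : V ≤ U₁ ⊓ U₂) (s t : (ten E₁ E₂).Sec V)
    {c : OpenPartialHomeomorph X (Fin n → ℂ)} (hc : c ∈ atlas (Fin n → ℂ) X) :
    ContDiffOn ℝ ∞ (inChart c (tensorForm h₁ h₂ hV s t)) (c.target ∩ c.symm ⁻¹' V) := by
  intro z hz
  obtain ⟨W, hW, hxW, u, v, -, -, h⟩ := exists_tensorForm_eq_pair h₁ h₂ hV s t hz.2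
  have hn : chartSet c W ∈ nhds z := (isOpen_chartSet c W).mem_nhds ⟨hz.1, hxW⟩
  refine (((tensorPairing_smooth h₁ h₂ ((hW.trans hV).trans inf_le_left)
    ((hW.trans hV).trans inf_le_right) u v hc).contDiffAt hn).congr_of_eventuallyEq
    ?_).contDiffWithinAt
  filter_upwards [hn] with w hw
  rw [inChart_of_mem (hW hw.2), inChart_of_mem hw.2]
  exact h ⟨_, hw.2⟩

/-- The Hermitian metric `h₁ ⊗ h₂`. -/
noncomputable def tensor (hs₁ : E₁.singularSet ⊆ (U₁ : Set X)ᶜ)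
    (hs₂ : E₂.singularSet ⊆ (U₂ : Set X)ᶜ) : HermitianMetric (ten E₁ E₂) (U₁ ⊓ U₂) where
  form V hV s t x := tensorForm h₁ h₂ hV s t x
  add_left V hV s₁ s₂ t x := by
    obtain ⟨W, hW, hx, u₁, v, hu₁, hv⟩ := exists_ofTensor_pair s₁ t x.2
    obtain ⟨W', hW', hx', u₂, hu₂⟩ := exists_ofTensor (res hW s₂) hx
    rw [res_res] at hu₂
    have hu₁' : ofTensor E₁ E₂ W' (resTensor E₁ E₂ hW' u₁) = res (hW'.trans hW) s₁ := by
      rw [← res_ofTensor, hu₁, res_res]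
    have hv' : ofTensor E₁ E₂ W' (resTensor E₁ E₂ hW' v) = res (hW'.trans hW) t := by
      rw [← res_ofTensor, hv, res_res]
    rw [tensorForm_eq h₁ h₂ hV (hW'.trans hW) hx' hu₁' hv',
      tensorForm_eq h₁ h₂ hV (hW'.trans hW) hx' hu₂ hv', ← map_add]
    exact tensorForm_eq h₁ h₂ hV (hW'.trans hW) hx' (by rw [map_add, hu₁', hu₂, res_add]) hv'
  smul_left V hV f s t x := by
    obtain ⟨W, hW, hx, u, v, hu, hv⟩ := exists_ofTensor_pair s t x.2
    have hu' : ofTensor E₁ E₂ W (f.res hW • u) = res hW (f • s) := by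
      rw [map_smul, hu, res_smul]
    rw [tensorForm_eq h₁ h₂ hV hW hx hu' hv, tensorPairing_smul, tensorForm_eq h₁ h₂ hV hW hx hu hv,
      HolFun.eval_res]
  conj_symm V hV s t x := by
    obtain ⟨W, hW, hx, u, v, hu, hv⟩ := exists_ofTensor_pair s t x.2
    exact (tensorForm_eq h₁ h₂ hV hW hx hv hu).trans ((tensorPairing_conj h₁ h₂ _ _ _ u v).trans
      (congrArg (starRingEnd ℂ) (tensorForm_eq h₁ h₂ hV hW hx hu hv).symm))
  restrict V W hV hW s t x := by
    obtain ⟨W', hW', hx, u, v, hu, hv⟩ := exists_ofTensor_pair (res hW s) (res hW t) x.2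
    have hu' : ofTensor E₁ E₂ W' u = res (hW'.trans hW) s := hu.trans (res_res _ _ _)
    have hv' : ofTensor E₁ E₂ W' v = res (hW'.trans hW) t := hv.trans (res_res _ _ _)
    exact (tensorForm_eq h₁ h₂ (hW.trans hV) hW' hx hu hv).trans
      (tensorForm_eq h₁ h₂ hV (x := ⟨x, hW x.2⟩) (hW'.trans hW) hx hu' hv').symm
  smooth V hV s t c hc := tensorForm_smooth h₁ h₂ hV s t hc
  posDef V hV r e he x := tensorForm_posDef h₁ h₂ hV he x (fun h => hs₁ h (hV x.2).1)
    fun h => hs₂ h (hV x.2).2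

theorem isTensorMetric_tensor (hs₁ : E₁.singularSet ⊆ (U₁ : Set X)ᶜ)
    (hs₂ : E₂.singularSet ⊆ (U₂ : Set X)ᶜ) : IsTensorMetric h₁ h₂ (tensor h₁ h₂ hs₁ hs₂) :=
  fun _ hV s₁ t₁ s₂ t₂ x => tensorForm_tmul h₁ h₂ hV s₁ t₁ s₂ t₂ x

variable {h₁ h₂}

theorem _root_.Higgs.IsTensorMetric.unique {h h' : HermitianMetric (ten E₁ E₂) (U₁ ⊓ U₂)}
    (hh : IsTensorMetric h₁ h₂ h) (hh' : IsTensorMetric h₁ h₂ h') : h = h' := by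
  refine ext_form fun V hV s t x => ?_
  obtain ⟨W, hW, hx, u, v, hu, hv⟩ := exists_ofTensor_pair s t x.2
  rw [← h.restrict V W hV hW s t ⟨x, hx⟩, ← h'.restrict V W hV hW s t ⟨x, hx⟩, ← hu, ← hv]
  -- Nothing but the local representatives matters from here on; dropping their link to `s` and `t`
  -- leaves them free for induction.
  clear hu hv
  induction u with
  | zero => rw [map_zero, form_zero_left, form_zero_left]
  | add a b ha hb => rw [map_add, h.add_left, h'.add_left, ha, hb]
  | tmul s₁ s₂ =>
    induction v with
    | zero => rw [map_zero, h.conj_symm, h'.conj_symm, form_zero_left, form_zero_left]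
    | add a b ha hb => rw [map_add, h.add_right, h'.add_right, ha, hb]
    | tmul t₁ t₂ => exact (hh _ _ _ _ _ _ _).trans (hh' _ _ _ _ _ _ _).symm

end HermitianMetric

end TensorMetric

/-! ### Existence and uniqueness of the metric on the direct sum -/

section SumMetric

open AnalyticSheaf

variable {n : ℕ} {X : Type} [TopologicalSpace X] [ChartedSpace (Fin n → ℂ) X]
  {E₁ E₂ : AnalyticSheaf n X} {U₁ U₂ V W : Opens X}

namespace HermitianMetric

variable (h₁ : HermitianMetric E₁ U₁) (h₂ : HermitianMetric E₂ U₂)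

/-- The sesquilinear form on sections of `E₁ ⊕ E₂` defined by `h₁` and `h₂`. -/
noncomputable def sumForm (hV : V ≤ U₁ ⊓ U₂) (s t : (E₁ ⊞ E₂ : AnalyticSheaf n X).Sec V) (x : V) : ℂ :=
  h₁.form V (hV.trans inf_le_left) (fst V s) (fst V t) x +
    h₂.form V (hV.trans inf_le_right) (snd V s) (snd V t) x

theorem sumForm_linear {ι κ : Type} [Fintype ι] [Fintype κ] (hV : V ≤ U₁ ⊓ U₂)
    (a : ι → HolFun n V) (b : κ → HolFun n V) (s : ι → (E₁ ⊞ E₂ : AnalyticSheaf n X).Sec V)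
    (t : κ → (E₁ ⊞ E₂ : AnalyticSheaf n X).Sec V) (x : V) :
    sumForm h₁ h₂ hV (∑ i, a i • s i) (∑ j, b j • t j) x =
      ∑ i, ∑ j, (a i).eval x * sumForm h₁ h₂ hV (s i) (t j) x * star ((b j).eval x) := by
  simp only [sumForm, map_sum, map_smul, form_linear_left, form_linear_right, Finset.mul_sum,
    ← Finset.sum_add_distrib]
  rw [Finset.sum_comm]
  exact Finset.sum_congr rfl fun i _ => Finset.sum_congr rfl fun j _ => by ring

theorem sumForm_restrict (hV : V ≤ U₁ ⊓ U₂) (hW : W ≤ V)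
    (s t : (E₁ ⊞ E₂ : AnalyticSheaf n X).Sec V) (x : W) :
    sumForm h₁ h₂ (hW.trans hV) (res hW s) (res hW t) x = sumForm h₁ h₂ hV s t ⟨x, hW x.2⟩ := by
  simp only [sumForm, map_res]
  rw [h₁.restrict V W, h₂.restrict V W]

theorem form_zero_right (hV : V ≤ U₁) (s : E₁.Sec V) (x : V) : h₁.form V hV s 0 x = 0 := by
  rw [h₁.conj_symm, form_zero_left, map_zero]

/-- The two summands are orthogonal, whence the zero blocks. -/
theorem sumForm_inl_inr {ι κ : Type} (hV : V ≤ U₁ ⊓ U₂) (e₁ : ι → E₁.Sec V) (e₂ : κ → E₂.Sec V)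
    (x : V) (k l : ι ⊕ κ) :
    sumForm h₁ h₂ hV (Sum.elim (fun i => inl V (e₁ i)) (fun i => inr V (e₂ i)) k)
        (Sum.elim (fun i => inl V (e₁ i)) (fun i => inr V (e₂ i)) l) x =
      Matrix.fromBlocks (h₁.gramAt (hV.trans inf_le_left) e₁ x) 0 0
        (h₂.gramAt (hV.trans inf_le_right) e₂ x) k l := by
  rcases k with k | k <;> rcases l with l | l <;>
    simp [sumForm, form_zero_left, form_zero_right, gramAt]

/-- As for the tensor product, with the Gram matrix congruent to a block diagonal one. -/
theorem sumForm_posDef (hV : V ≤ U₁ ⊓ U₂) {r : ℕ}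
    {e : Fin r → (E₁ ⊞ E₂ : AnalyticSheaf n X).Sec V} (he : IsFrame e) (x : V)
    (hx₁ : (x : X) ∉ E₁.singularSet) (hx₂ : (x : X) ∉ E₂.singularSet) :
    (Matrix.of fun i j => sumForm h₁ h₂ hV (e i) (e j) x).PosDef := by
  obtain ⟨V₁, hxV₁, r₁, e₁, he₁⟩ := not_not.1 hx₁
  obtain ⟨V₂, hxV₂, r₂, e₂, he₂⟩ := not_not.1 hx₂
  let W : Opens X := V ⊓ (V₁ ⊓ V₂)
  have hW : W ≤ V := inf_le_left
  have hW₁ : W ≤ V₁ := inf_le_right.trans inf_le_left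
  have hW₂ : W ≤ V₂ := inf_le_right.trans inf_le_right
  have hxW : (x : X) ∈ W := ⟨x.2, hxV₁, hxV₂⟩
  have hf₁ := he₁.restrict hW₁
  have hf₂ := he₂.restrict hW₂
  set f₁ := fun i => res hW₁ (e₁ i)
  set f₂ := fun i => res hW₂ (e₂ i)
  obtain ⟨P, Q, hP, hPQ, -⟩ := he.exists_change (hf₁.directSum hf₂) hW le_rfl
  have hWU₁ : W ≤ U₁ := (hW.trans hV).trans inf_le_left
  have hWU₂ : W ≤ U₂ := (hW.trans hV).trans inf_le_right
  let ev : HolFun n W →+* ℂ := HolFun.evalHom (⟨x, hxW⟩ : W)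
  have hgram : (Matrix.of fun i j => sumForm h₁ h₂ hV (e i) (e j) x) = P.map ev *
      (Matrix.fromBlocks (h₁.gramAt hWU₁ f₁ ⟨x, hxW⟩) 0 0 (h₂.gramAt hWU₂ f₂ ⟨x, hxW⟩)) *
        (P.map ev)ᴴ := by
    ext i j
    rw [Matrix.of_apply, ← sumForm_restrict h₁ h₂ hV hW (e i) (e j) ⟨x, hxW⟩, hP, hP,
      sumForm_linear]
    simp only [res_self, sumForm_inl_inr, Matrix.mul_apply, Finset.sum_mul]
    rw [Finset.sum_comm]
    rfl
  rw [hgram]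
  refine posDef_congruence (Q := Q.map ev) ?_ (posDef_fromBlocks (h₁.gramAt_posDef hWU₁ hf₁ _)
    (h₂.gramAt_posDef hWU₂ hf₂ _))
  rw [← Matrix.map_mul, hPQ, Matrix.map_one _ (map_zero _) (map_one _)]

/-- The Hermitian metric `h₁ ⊕ h₂`. -/
noncomputable def directSum (hs₁ : E₁.singularSet ⊆ (U₁ : Set X)ᶜ)
    (hs₂ : E₂.singularSet ⊆ (U₂ : Set X)ᶜ) :
    HermitianMetric (E₁ ⊞ E₂ : AnalyticSheaf n X) (U₁ ⊓ U₂) where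
  form V hV s t x := sumForm h₁ h₂ hV s t x
  add_left V hV s₁ s₂ t x := by
    simp only [sumForm, map_add, h₁.add_left, h₂.add_left]
    ring
  smul_left V hV f s t x := by
    simp only [sumForm, map_smul, h₁.smul_left, h₂.smul_left, mul_add]
  conj_symm V hV s t x := by
    simp only [sumForm, map_add]
    rw [← h₁.conj_symm, ← h₂.conj_symm]
  restrict V W hV hW s t x := sumForm_restrict h₁ h₂ hV hW s t x
  smooth V hV s t c hc :=
    ((h₁.smooth V _ (fst V s) (fst V t) c hc).add (h₂.smooth V _ (snd V s) (snd V t) c hc)).congr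
      (inChart_eqOn (op := (· + ·)) fun _ => rfl)
  posDef V hV r e he x := sumForm_posDef h₁ h₂ hV he x (fun h => hs₁ h (hV x.2).1)
    fun h => hs₂ h (hV x.2).2

theorem isSumMetric_directSum (hs₁ : E₁.singularSet ⊆ (U₁ : Set X)ᶜ)
    (hs₂ : E₂.singularSet ⊆ (U₂ : Set X)ᶜ) : IsSumMetric h₁ h₂ (directSum h₁ h₂ hs₁ hs₂) :=
  fun _ _ _ _ _ => rfl

variable {h₁ h₂}

theorem _root_.Higgs.IsSumMetric.unique
    {h h' : HermitianMetric (E₁ ⊞ E₂ : AnalyticSheaf n X) (U₁ ⊓ U₂)}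
    (hh : IsSumMetric h₁ h₂ h) (hh' : IsSumMetric h₁ h₂ h') : h = h' :=
  ext_form fun _ _ _ _ _ => (hh _ _ _ _ _).trans (hh' _ _ _ _ _).symm

end HermitianMetric

end SumMetric

/-! ### Unions of analytic subsets and their codimension -/

section AnalyticSubsets

variable {n : ℕ} {X : Type} [TopologicalSpace X] [ChartedSpace (Fin n → ℂ) X] {A B : Set X}

/-- The products `fᵢ gⱼ` all vanish at a point exactly when all `fᵢ` or all `gⱼ` do. -/
theorem IsAnalyticSubset.union (hA : IsAnalyticSubset n A) (hB : IsAnalyticSubset n B) :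
    IsAnalyticSubset n (A ∪ B) := by
  intro x
  obtain ⟨V, hV, k, f, hf⟩ := hA x
  obtain ⟨W, hW, l, g, hg⟩ := hB x
  refine ⟨V ⊓ W, ⟨hV, hW⟩, k * l, fun i => (f (finProdFinEquiv.symm i).1).res inf_le_left *
    (g (finProdFinEquiv.symm i).2).res inf_le_right, fun y => ?_⟩
  have hy : (y : X) ∈ A ∪ B ↔ (∀ i, (f i).eval ⟨y, y.2.1⟩ = 0) ∨ ∀ j, (g j).eval ⟨y, y.2.2⟩ = 0 :=
    or_congr (hf ⟨y, y.2.1⟩) (hg ⟨y, y.2.2⟩)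
  rw [hy]
  change _ ↔ ∀ i, (f (finProdFinEquiv.symm i).1).eval ⟨y, y.2.1⟩ *
    (g (finProdFinEquiv.symm i).2).eval ⟨y, y.2.2⟩ = 0
  constructor
  · rintro (h | h) i
    · rw [h, zero_mul]
    · rw [h, mul_zero]
  · intro h
    by_contra! hne
    obtain ⟨⟨i, hi⟩, j, hj⟩ := hne
    have := h (finProdFinEquiv (i, j))
    rw [Equiv.symm_apply_apply] at this
    exact mul_ne_zero hi hj this

/-- In a chart that flattens `A ∪ B` around a regular point, either `A` is the whole flat piece, or
some point of it lies in `B` off `A` and is a regular point of `B` of the same codimension. No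
decomposition into irreducible components is involved. -/
theorem CodimAtLeast.union {m : ℕ} (hA : CodimAtLeast n m A) (hB : CodimAtLeast n m B)
    (hcl : IsClosed A) : CodimAtLeast n m (A ∪ B) := by
  rintro a k ⟨ha, hk, c, hc, hac, hreg⟩
  by_cases h : ∀ y ∈ c.source, y ∈ A ∪ B → y ∈ A
  · exact hA a k ⟨h a hac ha, hk, c, hc, hac, fun y hy =>
      ⟨fun hyA => (hreg y hy).1 (Or.inl hyA), fun h0 => h y hy ((hreg y hy).2 h0)⟩⟩
  · push Not at h
    obtain ⟨b, hbc, hb, hbA⟩ := h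
    -- Off the closed set `A` the union coincides with `B`, so the same flattening chart, restricted
    -- there, serves `B` at `b`.
    refine hB b k ⟨hb.resolve_left hbA, hk, c.restr Aᶜ,
      restr_mem_maximalAtlas (contDiffGroupoid ∞ 𝓘(ℂ, Fin n → ℂ)) hc hcl.isOpen_compl, ?_, ?_⟩
    · rw [c.restr_source' _ hcl.isOpen_compl]
      exact ⟨hbc, hbA⟩
    · intro y hy
      rw [c.restr_source' _ hcl.isOpen_compl] at hy
      exact ⟨fun hyB => (hreg y hy.1).1 (Or.inr hyB),
        fun h0 => ((hreg y hy.1).2 h0).resolve_left hy.2⟩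

end AnalyticSubsets

/-! ### Curvature estimates and admissibility -/

section Admissible

open AnalyticSheaf
open scoped Kronecker

variable {n : ℕ} {X : Type} [TopologicalSpace X] [ChartedSpace (Fin n → ℂ) X]
  [IsManifold 𝓘(ℂ, Fin n → ℂ) ∞ X] {E E₁ E₂ : AnalyticSheaf n X} {U U₁ U₂ V : Opens X}
  {g : KahlerMetric n X} {h₁ : HermitianMetric E₁ U₁} {h₂ : HermitianMetric E₂ U₂}

/-- A Hermitian metric whose curvature is controlled by those of two admissible structures is
admissible. -/
theorem IsAdmissible.of_le [MeasurableSpace X] [BorelSpace X] (hadm₁ : IsAdmissible g h₁)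
    (hadm₂ : IsAdmissible g h₂) {h : HermitianMetric E (U₁ ⊓ U₂)}
    (hs : E.singularSet ⊆ E₁.singularSet ∪ E₂.singularSet) {a b a' b' : ℝ}
    (hR : ∀ x ∈ U₁ ⊓ U₂, h.curvatureNormSq g x ≤
      ENNReal.ofReal a * h₁.curvatureNormSq g x + ENNReal.ofReal b * h₂.curvatureNormSq g x)
    (hK : ∀ x ∈ U₁ ⊓ U₂, h.meanCurvatureNorm g x ≤
      ENNReal.ofReal a' * h₁.meanCurvatureNorm g x + ENNReal.ofReal b' * h₂.meanCurvatureNorm g x) :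
    IsAdmissible g h := by
  have hU : ((U₁ ⊓ U₂ : Opens X) : Set X)ᶜ = (U₁ : Set X)ᶜ ∪ (U₂ : Set X)ᶜ := by
    rw [Opens.coe_inf, Set.compl_inter]
  have key : ∀ {a b : ℝ} {F F₁ F₂ : X → ℝ≥0∞}, Measurable F₁ → Measurable F₂ →
      (∀ x ∈ U₁ ⊓ U₂, F x ≤ ENNReal.ofReal a * F₁ x + ENNReal.ofReal b * F₂ x) →
      ∫⁻ x in (U₁ : Set X), F₁ x ∂g.volume < ⊤ → ∫⁻ x in (U₂ : Set X), F₂ x ∂g.volume < ⊤ →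
      ∫⁻ x in ((U₁ ⊓ U₂ : Opens X) : Set X), F x ∂g.volume < ⊤ := by
    intro a b F F₁ F₂ hm₁ hm₂ hF hF₁ hF₂
    refine (setLIntegral_mono' (U₁ ⊓ U₂).isOpen.measurableSet hF).trans_lt ?_
    rw [lintegral_add_left (hm₁.const_mul _), lintegral_const_mul _ hm₁, lintegral_const_mul _ hm₂]
    refine ENNReal.add_lt_top.2 ⟨ENNReal.mul_lt_top ENNReal.ofReal_lt_top ?_,
      ENNReal.mul_lt_top ENNReal.ofReal_lt_top ?_⟩
    · exact (lintegral_mono_set (fun x hx => hx.1)).trans_lt hF₁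
    · exact (lintegral_mono_set (fun x hx => hx.2)).trans_lt hF₂
  refine ⟨?_, ?_, ?_, ?_, ?_⟩
  · rw [hU]
    exact hadm₁.analytic.union hadm₂.analytic
  · rw [hU]
    exact hadm₁.codim.union hadm₂.codim U₁.isOpen.isClosed_compl
  · rw [hU]
    exact hs.trans (Set.union_subset_union hadm₁.singular hadm₂.singular)
  · exact key (h₁.measurable_curvatureNormSq g) (h₂.measurable_curvatureNormSq g) hR hadm₁.curvature
      hadm₂.curvature
  · exact key (h₁.measurable_meanCurvatureNorm g) (h₂.measurable_meanCurvatureNorm g) hK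
      hadm₁.meanCurvature hadm₂.meanCurvature

omit [IsManifold 𝓘(ℂ, Fin n → ℂ) ∞ X] in
theorem exists_common_frames {x : X} (hx₁ : x ∉ E₁.singularSet) (hx₂ : x ∉ E₂.singularSet)
    (hx : x ∈ V) : ∃ W : Opens X, W ≤ V ∧ x ∈ W ∧ ∃ (r₁ r₂ : ℕ) (e₁ : Fin r₁ → E₁.Sec W)
      (e₂ : Fin r₂ → E₂.Sec W), IsFrame e₁ ∧ IsFrame e₂ := by
  obtain ⟨V₁, hxV₁, r₁, e₁, he₁⟩ := not_not.1 hx₁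
  obtain ⟨V₂, hxV₂, r₂, e₂, he₂⟩ := not_not.1 hx₂
  exact ⟨V ⊓ (V₁ ⊓ V₂), inf_le_left, ⟨hx, hxV₁, hxV₂⟩, r₁, r₂, _, _,
    he₁.restrict (inf_le_right.trans inf_le_left), he₂.restrict (inf_le_right.trans inf_le_right)⟩

omit [IsManifold 𝓘(ℂ, Fin n → ℂ) ∞ X] in
theorem notMem_singularSet {ι : Type} [Fintype ι] {e : ι → E.Sec V} (he : IsFrame e) {x : X}
    (hx : x ∈ V) : x ∉ E.singularSet :=
  not_not.2 ⟨V, hx, _, _, he.reindex (Fintype.equivFin ι).symm⟩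

omit [IsManifold 𝓘(ℂ, Fin n → ℂ) ∞ X] in
theorem singularSet_tensor : (ten E₁ E₂).singularSet ⊆ E₁.singularSet ∪ E₂.singularSet := by
  intro x hx
  by_contra h
  rw [Set.mem_union, not_or] at h
  obtain ⟨W, -, hxW, r₁, r₂, e₁, e₂, he₁, he₂⟩ := exists_common_frames (V := ⊤) h.1 h.2 trivial
  exact notMem_singularSet (he₁.tensor he₂) hxW hx

omit [IsManifold 𝓘(ℂ, Fin n → ℂ) ∞ X] in
theorem singularSet_directSum :
    (E₁ ⊞ E₂ : AnalyticSheaf n X).singularSet ⊆ E₁.singularSet ∪ E₂.singularSet := by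
  intro x hx
  by_contra h
  rw [Set.mem_union, not_or] at h
  obtain ⟨W, -, hxW, r₁, r₂, e₁, e₂, he₁, he₂⟩ := exists_common_frames (V := ⊤) h.1 h.2 trivial
  exact notMem_singularSet (he₁.directSum he₂) hxW hx

namespace HermitianMetric

/-- By invariance under change of frame, the supremum over all frames is controlled by a single one;
only the supremum over charts remains. -/
theorem curvatureNormSq_le_of_frame (h : HermitianMetric E U) (g : KahlerMetric n X) {κ : Type}
    [Fintype κ] [DecidableEq κ] (hV : V ≤ U) {e : κ → E.Sec V} (he : IsFrame e) {x : X}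
    (hx : x ∈ V) {B : ℝ≥0∞} (hB : ∀ c ∈ atlas (Fin n → ℂ) X, x ∈ c.source → ENNReal.ofReal
      (curvForm (g.invCoeff c (c x)) (h.gramIn hV e c (c x))
        fun α β => chernCurvature (h.gramIn hV e c) α β (c x)) ≤ B) :
    h.curvatureNormSq g x ≤ B :=
  iSup₂_le fun c hc => iSup_le fun hxc => iSup₂_le fun V' hV' => iSup_le fun hx' =>
    iSup₂_le fun r e' => iSup_le fun he' => by
      rw [h.curvatureNormSqIn_eq_of_frame g hV' hV he' he hx' hx hc hxc]
      exact hB c hc hxc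

theorem meanCurvatureNorm_le_of_frame (h : HermitianMetric E U) (g : KahlerMetric n X) {κ : Type}
    [Fintype κ] [DecidableEq κ] (hV : V ≤ U) {e : κ → E.Sec V} (he : IsFrame e) {x : X}
    (hx : x ∈ V) {B : ℝ≥0∞} (hB : ∀ c ∈ atlas (Fin n → ℂ) X, x ∈ c.source → ENNReal.ofReal
      √(endProd (h.gramIn hV e c (c x)) (h.meanCurvIn g hV e c (c x))
        (h.meanCurvIn g hV e c (c x))).re ≤ B) :
    h.meanCurvatureNorm g x ≤ B :=
  iSup₂_le fun c hc => iSup_le fun hxc => iSup₂_le fun V' hV' => iSup_le fun hx' =>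
    iSup₂_le fun r e' => iSup_le fun he' => by
      rw [h.meanCurvatureNormIn_eq_of_frame g hV' hV he' he hx' hx hc hxc]
      exact hB c hc hxc

end HermitianMetric

theorem ofReal_le_of_le_add {y a b A B : ℝ} {F G : ℝ≥0∞} (hy : y ≤ a * A + b * B) (ha : 0 ≤ a)
    (hb : 0 ≤ b) (hA : ENNReal.ofReal A ≤ F) (hB : ENNReal.ofReal B ≤ G) :
    ENNReal.ofReal y ≤ ENNReal.ofReal a * F + ENNReal.ofReal b * G :=
  calc ENNReal.ofReal y ≤ ENNReal.ofReal (a * A) + ENNReal.ofReal (b * B) :=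
        (ENNReal.ofReal_le_ofReal hy).trans ENNReal.ofReal_add_le
    _ = ENNReal.ofReal a * ENNReal.ofReal A + ENNReal.ofReal b * ENNReal.ofReal B := by
        rw [ENNReal.ofReal_mul ha, ENNReal.ofReal_mul hb]
    _ ≤ _ := by gcongr

theorem sqrt_le_of_le_add {y a b A B : ℝ} (hy : y ≤ a * A + b * B) (ha : 0 ≤ a) (hb : 0 ≤ b)
    (hA : 0 ≤ A) (hB : 0 ≤ B) : √y ≤ √a * √A + √b * √B := by
  rw [← Real.sqrt_mul ha, ← Real.sqrt_mul hb]
  -- Comparing squares, the right-hand side exceeds the left by the nonnegative cross term.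
  refine (Real.sqrt_le_sqrt hy).trans (Real.sqrt_le_left (by positivity) |>.2 ?_)
  nlinarith [Real.sq_sqrt (mul_nonneg ha hA), Real.sq_sqrt (mul_nonneg hb hB),
    mul_nonneg (Real.sqrt_nonneg (a * A)) (Real.sqrt_nonneg (b * B))]

section Tensor

variable {h : HermitianMetric (ten E₁ E₂) (U₁ ⊓ U₂)} {ι κ : Type} [Fintype ι] [Fintype κ]
  {e₁ : ι → E₁.Sec V} {e₂ : κ → E₂.Sec V}

omit [IsManifold 𝓘(ℂ, Fin n → ℂ) ∞ X] [Fintype ι] [Fintype κ] in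
theorem IsTensorMetric.gramIn_eq (hh : IsTensorMetric h₁ h₂ h) (hV : V ≤ U₁ ⊓ U₂)
    (e₁ : ι → E₁.Sec V) (e₂ : κ → E₂.Sec V) (c : OpenPartialHomeomorph X (Fin n → ℂ))
    {z : Fin n → ℂ} (hz : z ∈ chartSet c V) :
    h.gramIn hV (fun i : ι × κ => tmul (e₁ i.1) (e₂ i.2)) c z =
      h₁.gramIn (hV.trans inf_le_left) e₁ c z ⊗ₖ h₂.gramIn (hV.trans inf_le_right) e₂ c z := by
  rw [h.gramIn_eq hV _ hz.2, h₁.gramIn_eq _ _ hz.2, h₂.gramIn_eq _ _ hz.2]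
  ext i j
  exact hh V hV _ _ _ _ _

variable [DecidableEq ι] [DecidableEq κ]

omit [IsManifold 𝓘(ℂ, Fin n → ℂ) ∞ X] in
theorem IsTensorMetric.chernCurvature_eq (hh : IsTensorMetric h₁ h₂ h) (hV : V ≤ U₁ ⊓ U₂)
    (he₁ : IsFrame e₁) (he₂ : IsFrame e₂) {c : OpenPartialHomeomorph X (Fin n → ℂ)}
    (hc : c ∈ atlas (Fin n → ℂ) X) {z : Fin n → ℂ} (hz : z ∈ chartSet c V) (α β : Fin n) :
    chernCurvature (h.gramIn hV (fun i : ι × κ => tmul (e₁ i.1) (e₂ i.2)) c) α β z =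
      chernCurvature (h₁.gramIn (hV.trans inf_le_left) e₁ c) α β z ⊗ₖ 1 +
        1 ⊗ₖ chernCurvature (h₂.gramIn (hV.trans inf_le_right) e₂ c) α β z := by
  rw [chernCurvature_congr (isOpen_chartSet c V) hz fun w hw => hh.gramIn_eq hV e₁ e₂ c hw]
  exact chernCurvature_kronecker (isOpen_chartSet c V) (h₁.gramIn_smooth _ e₁ hc)
    (fun w hw => (h₁.gramIn_posDef _ he₁ hw).det_pos.ne') (h₂.gramIn_smooth _ e₂ hc)
    (fun w hw => (h₂.gramIn_posDef _ he₂ hw).det_pos.ne') hz α β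

/-- The estimate is computed in a tensor product of frames. The curvature of `h₁` carries the rank
of `E₂` and conversely; replacing these ranks by `N₂` and `N₁` makes the constants uniform in `x`.
-/
theorem IsTensorMetric.curvatureNormSq_le (hh : IsTensorMetric h₁ h₂ h) {N₁ N₂ : ℕ}
    (hN₁ : ∀ (V : Opens X) (r : ℕ) (e : Fin r → E₁.Sec V), IsFrame e → (V : Set X).Nonempty → r ≤ N₁)
    (hN₂ : ∀ (V : Opens X) (r : ℕ) (e : Fin r → E₂.Sec V), IsFrame e → (V : Set X).Nonempty → r ≤ N₂)
    {x : X} (hx : x ∈ U₁ ⊓ U₂) (hx₁ : x ∉ E₁.singularSet) (hx₂ : x ∉ E₂.singularSet) :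
    h.curvatureNormSq g x ≤ ENNReal.ofReal (2 * N₂) * h₁.curvatureNormSq g x +
      ENNReal.ofReal (2 * N₁) * h₂.curvatureNormSq g x := by
  obtain ⟨W, hW, hxW, r₁, r₂, e₁, e₂, he₁, he₂⟩ := exists_common_frames hx₁ hx₂ hx
  have hr₁ : (r₁ : ℝ) ≤ N₁ := Nat.cast_le.2 (hN₁ W r₁ e₁ he₁ ⟨x, hxW⟩)
  have hr₂ : (r₂ : ℝ) ≤ N₂ := Nat.cast_le.2 (hN₂ W r₂ e₂ he₂ ⟨x, hxW⟩)
  refine h.curvatureNormSq_le_of_frame g hW (he₁.tensor he₂) hxW fun c hc hxc => ?_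
  have hz := mem_chartSet hxc hxW
  have hg := (metricCoeff_posDef g hc hz.1).inv
  have p₁ := h₁.gramIn_posDef (hW.trans inf_le_left) he₁ hz
  have p₂ := h₂.gramIn_posDef (hW.trans inf_le_right) he₂ hz
  rw [hh.gramIn_eq hW e₁ e₂ c hz]
  simp only [hh.chernCurvature_eq hW he₁ he₂ hc hz]
  refine ofReal_le_of_le_add ((curvForm_kronecker_le hg p₁ p₂ _ _).trans ?_) (by positivity)
    (by positivity) (h₁.curvatureNormSqIn_le g (hW.trans inf_le_left) he₁ hxW hc hxc)
    (h₂.curvatureNormSqIn_le g (hW.trans inf_le_right) he₂ hxW hc hxc)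
  rw [Fintype.card_fin, Fintype.card_fin]
  exact add_le_add (mul_le_mul_of_nonneg_right (by linarith) (curvForm_nonneg hg p₁ _))
    (mul_le_mul_of_nonneg_right (by linarith) (curvForm_nonneg hg p₂ _))

/-- Contraction preserves the shape `K₁ ⊗ 1 + 1 ⊗ K₂`. The constants are square roots because `|K|`
is integrated, not its square. -/
theorem IsTensorMetric.meanCurvatureNorm_le (hh : IsTensorMetric h₁ h₂ h) {N₁ N₂ : ℕ}
    (hN₁ : ∀ (V : Opens X) (r : ℕ) (e : Fin r → E₁.Sec V), IsFrame e → (V : Set X).Nonempty → r ≤ N₁)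
    (hN₂ : ∀ (V : Opens X) (r : ℕ) (e : Fin r → E₂.Sec V), IsFrame e → (V : Set X).Nonempty → r ≤ N₂)
    {x : X} (hx : x ∈ U₁ ⊓ U₂) (hx₁ : x ∉ E₁.singularSet) (hx₂ : x ∉ E₂.singularSet) :
    h.meanCurvatureNorm g x ≤ ENNReal.ofReal √(2 * N₂) * h₁.meanCurvatureNorm g x +
      ENNReal.ofReal √(2 * N₁) * h₂.meanCurvatureNorm g x := by
  obtain ⟨W, hW, hxW, r₁, r₂, e₁, e₂, he₁, he₂⟩ := exists_common_frames hx₁ hx₂ hx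
  have hr₁ : (r₁ : ℝ) ≤ N₁ := Nat.cast_le.2 (hN₁ W r₁ e₁ he₁ ⟨x, hxW⟩)
  have hr₂ : (r₂ : ℝ) ≤ N₂ := Nat.cast_le.2 (hN₂ W r₂ e₂ he₂ ⟨x, hxW⟩)
  refine h.meanCurvatureNorm_le_of_frame g hW (he₁.tensor he₂) hxW fun c hc hxc => ?_
  have hz := mem_chartSet hxc hxW
  have p₁ := h₁.gramIn_posDef (hW.trans inf_le_left) he₁ hz
  have p₂ := h₂.gramIn_posDef (hW.trans inf_le_right) he₂ hz
  have hK : h.meanCurvIn g hW (fun i : Fin r₁ × Fin r₂ => tmul (e₁ i.1) (e₂ i.2)) c (c x) =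
      h₁.meanCurvIn g (hW.trans inf_le_left) e₁ c (c x) ⊗ₖ 1 +
        1 ⊗ₖ h₂.meanCurvIn g (hW.trans inf_le_right) e₂ c (c x) := by
    simp only [HermitianMetric.meanCurvIn, hh.chernCurvature_eq hW he₁ he₂ hc hz]
    exact contraction_kronecker _ _
  rw [hh.gramIn_eq hW e₁ e₂ c hz, hK]
  refine ofReal_le_of_le_add (sqrt_le_of_le_add ((endProd_kronecker_le p₁ p₂ _ _).trans ?_)
    (by positivity) (by positivity) (endProd_self_nonneg p₁ _) (endProd_self_nonneg p₂ _))
    (Real.sqrt_nonneg _) (Real.sqrt_nonneg _)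
    (h₁.meanCurvatureNormIn_le g (hW.trans inf_le_left) he₁ hxW hc hxc)
    (h₂.meanCurvatureNormIn_le g (hW.trans inf_le_right) he₂ hxW hc hxc)
  rw [Fintype.card_fin, Fintype.card_fin]
  exact add_le_add (mul_le_mul_of_nonneg_right (by linarith) (endProd_self_nonneg p₁ _))
    (mul_le_mul_of_nonneg_right (by linarith) (endProd_self_nonneg p₂ _))

theorem IsTensorMetric.isAdmissible [CompactSpace X] [MeasurableSpace X] [BorelSpace X]
    (hh : IsTensorMetric h₁ h₂ h) (hE₁ : E₁.IsCoherent) (hE₂ : E₂.IsCoherent)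
    (hadm₁ : IsAdmissible g h₁) (hadm₂ : IsAdmissible g h₂) : IsAdmissible g h := by
  obtain ⟨N₁, hN₁⟩ := hE₁.exists_card_le
  obtain ⟨N₂, hN₂⟩ := hE₂.exists_card_le
  exact hadm₁.of_le hadm₂ singularSet_tensor
    (fun x hx => hh.curvatureNormSq_le hN₁ hN₂ hx (fun h => hadm₁.singular h hx.1)
      fun h => hadm₂.singular h hx.2)
    fun x hx => hh.meanCurvatureNorm_le hN₁ hN₂ hx (fun h => hadm₁.singular h hx.1)
      fun h => hadm₂.singular h hx.2

end Tensor

section DirectSum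

variable {h : HermitianMetric (E₁ ⊞ E₂ : AnalyticSheaf n X) (U₁ ⊓ U₂)} {ι κ : Type} [Fintype ι]
  [Fintype κ] {e₁ : ι → E₁.Sec V} {e₂ : κ → E₂.Sec V}

omit [IsManifold 𝓘(ℂ, Fin n → ℂ) ∞ X] [Fintype ι] [Fintype κ] in
theorem IsSumMetric.gramIn_eq (hh : IsSumMetric h₁ h₂ h) (hV : V ≤ U₁ ⊓ U₂)
    (e₁ : ι → E₁.Sec V) (e₂ : κ → E₂.Sec V) (c : OpenPartialHomeomorph X (Fin n → ℂ))
    {z : Fin n → ℂ} (hz : z ∈ chartSet c V) :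
    h.gramIn hV (Sum.elim (fun i => inl V (e₁ i)) fun i => inr V (e₂ i)) c z =
      Matrix.fromBlocks (h₁.gramIn (hV.trans inf_le_left) e₁ c z) 0 0
        (h₂.gramIn (hV.trans inf_le_right) e₂ c z) := by
  rw [h.gramIn_eq hV _ hz.2, h₁.gramIn_eq _ _ hz.2, h₂.gramIn_eq _ _ hz.2]
  ext i j
  exact (hh V hV _ _ _).trans (HermitianMetric.sumForm_inl_inr h₁ h₂ hV e₁ e₂ _ i j)

variable [DecidableEq ι] [DecidableEq κ]

omit [IsManifold 𝓘(ℂ, Fin n → ℂ) ∞ X] in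
theorem IsSumMetric.chernCurvature_eq (hh : IsSumMetric h₁ h₂ h) (hV : V ≤ U₁ ⊓ U₂)
    (he₁ : IsFrame e₁) (he₂ : IsFrame e₂) {c : OpenPartialHomeomorph X (Fin n → ℂ)}
    {z : Fin n → ℂ} (hz : z ∈ chartSet c V) (α β : Fin n) :
    chernCurvature (h.gramIn hV (Sum.elim (fun i => inl V (e₁ i)) fun i => inr V (e₂ i)) c) α β z =
      Matrix.fromBlocks (chernCurvature (h₁.gramIn (hV.trans inf_le_left) e₁ c) α β z) 0 0
        (chernCurvature (h₂.gramIn (hV.trans inf_le_right) e₂ c) α β z) := by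
  rw [chernCurvature_congr (isOpen_chartSet c V) hz fun w hw => hh.gramIn_eq hV e₁ e₂ c hw]
  exact chernCurvature_fromBlocks (isOpen_chartSet c V)
    (fun w hw => (h₁.gramIn_posDef _ he₁ hw).det_pos.ne')
    (fun w hw => (h₂.gramIn_posDef _ he₂ hw).det_pos.ne') hz α β

theorem IsSumMetric.curvatureNormSq_le (hh : IsSumMetric h₁ h₂ h) {x : X} (hx : x ∈ U₁ ⊓ U₂)
    (hx₁ : x ∉ E₁.singularSet) (hx₂ : x ∉ E₂.singularSet) :
    h.curvatureNormSq g x ≤ ENNReal.ofReal 1 * h₁.curvatureNormSq g x +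
      ENNReal.ofReal 1 * h₂.curvatureNormSq g x := by
  obtain ⟨W, hW, hxW, r₁, r₂, e₁, e₂, he₁, he₂⟩ := exists_common_frames hx₁ hx₂ hx
  refine h.curvatureNormSq_le_of_frame g hW (he₁.directSum he₂) hxW fun c hc hxc => ?_
  have hz := mem_chartSet hxc hxW
  have p₁ := (h₁.gramIn_posDef (hW.trans inf_le_left) he₁ hz).det_pos.ne'
  have p₂ := (h₂.gramIn_posDef (hW.trans inf_le_right) he₂ hz).det_pos.ne'
  rw [hh.gramIn_eq hW e₁ e₂ c hz]
  simp only [hh.chernCurvature_eq hW he₁ he₂ hz]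
  refine ofReal_le_of_le_add (le_of_eq ?_) zero_le_one zero_le_one
    (h₁.curvatureNormSqIn_le g (hW.trans inf_le_left) he₁ hxW hc hxc)
    (h₂.curvatureNormSqIn_le g (hW.trans inf_le_right) he₂ hxW hc hxc)
  rw [curvForm_fromBlocks p₁ p₂, one_mul, one_mul]
  rfl

theorem IsSumMetric.meanCurvatureNorm_le (hh : IsSumMetric h₁ h₂ h) {x : X} (hx : x ∈ U₁ ⊓ U₂)
    (hx₁ : x ∉ E₁.singularSet) (hx₂ : x ∉ E₂.singularSet) :
    h.meanCurvatureNorm g x ≤ ENNReal.ofReal √1 * h₁.meanCurvatureNorm g x +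
      ENNReal.ofReal √1 * h₂.meanCurvatureNorm g x := by
  obtain ⟨W, hW, hxW, r₁, r₂, e₁, e₂, he₁, he₂⟩ := exists_common_frames hx₁ hx₂ hx
  refine h.meanCurvatureNorm_le_of_frame g hW (he₁.directSum he₂) hxW fun c hc hxc => ?_
  have hz := mem_chartSet hxc hxW
  have p₁ := h₁.gramIn_posDef (hW.trans inf_le_left) he₁ hz
  have p₂ := h₂.gramIn_posDef (hW.trans inf_le_right) he₂ hz
  have hK : h.meanCurvIn g hW (Sum.elim (fun i => inl W (e₁ i)) fun i => inr W (e₂ i)) c (c x) =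
      Matrix.fromBlocks (h₁.meanCurvIn g (hW.trans inf_le_left) e₁ c (c x)) 0 0
        (h₂.meanCurvIn g (hW.trans inf_le_right) e₂ c (c x)) := by
    simp only [HermitianMetric.meanCurvIn, hh.chernCurvature_eq hW he₁ he₂ hz]
    exact contraction_fromBlocks _ _
  rw [hh.gramIn_eq hW e₁ e₂ c hz, hK]
  -- The squared norms of the diagonal blocks add exactly; only the square root turns this into an
  -- inequality.
  refine ofReal_le_of_le_add (sqrt_le_of_le_add (le_of_eq ?_) zero_le_one zero_le_one
    (endProd_self_nonneg p₁ _) (endProd_self_nonneg p₂ _))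
    (Real.sqrt_nonneg _) (Real.sqrt_nonneg _)
    (h₁.meanCurvatureNormIn_le g (hW.trans inf_le_left) he₁ hxW hc hxc)
    (h₂.meanCurvatureNormIn_le g (hW.trans inf_le_right) he₂ hxW hc hxc)
  rw [endProd_fromBlocks p₁.det_pos.ne' p₂.det_pos.ne', one_mul, one_mul, Complex.add_re]
  rfl

theorem IsSumMetric.isAdmissible [MeasurableSpace X] [BorelSpace X]
    (hh : IsSumMetric h₁ h₂ h) (hadm₁ : IsAdmissible g h₁) (hadm₂ : IsAdmissible g h₂) :
    IsAdmissible g h :=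
  hadm₁.of_le hadm₂ singularSet_directSum
    (fun _ hx => hh.curvatureNormSq_le hx (fun h => hadm₁.singular h hx.1)
      fun h => hadm₂.singular h hx.2)
    fun _ hx => hh.meanCurvatureNorm_le hx (fun h => hadm₁.singular h hx.1)
      fun h => hadm₂.singular h hx.2

end DirectSum

end Admissible

end Higgs

theorem mainTheorem6 (n : ℕ) (X : Type) [TopologicalSpace X] [T2Space X] [CompactSpace X]
    [ChartedSpace (Fin n → ℂ) X] [IsManifold 𝓘(ℂ, Fin n → ℂ) ∞ X]
    [MeasurableSpace X] [BorelSpace X] (g : Higgs.KahlerMetric n X)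
    (H₁ H₂ : Higgs.HiggsPair n X) (hH₁ : H₁.IsHiggsSheaf) (hH₂ : H₂.IsHiggsSheaf)
    (htf₁ : H₁.sheaf.IsTorsionFree) (htf₂ : H₂.sheaf.IsTorsionFree)
    (U₁ U₂ : TopologicalSpace.Opens X)
    (h₁ : Higgs.HermitianMetric H₁.sheaf U₁) (h₂ : Higgs.HermitianMetric H₂.sheaf U₂)
    (hadm₁ : Higgs.IsAdmissible g h₁) (hadm₂ : Higgs.IsAdmissible g h₂) :
    ((H₁.tensor H₂).IsHiggsSheaf ∧
      (∃! h : Higgs.HermitianMetric (H₁.tensor H₂).sheaf (U₁ ⊓ U₂),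
        Higgs.IsTensorMetric h₁ h₂ h) ∧
      ∀ h : Higgs.HermitianMetric (H₁.tensor H₂).sheaf (U₁ ⊓ U₂),
        Higgs.IsTensorMetric h₁ h₂ h → Higgs.IsAdmissible g h) ∧
    ((H₁.directSum H₂).IsHiggsSheaf ∧
      (∃! h : Higgs.HermitianMetric (H₁.directSum H₂).sheaf (U₁ ⊓ U₂),
        Higgs.IsSumMetric h₁ h₂ h) ∧
      ∀ h : Higgs.HermitianMetric (H₁.directSum H₂).sheaf (U₁ ⊓ U₂),
        Higgs.IsSumMetric h₁ h₂ h → Higgs.IsAdmissible g h) := by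
  -- Over `U₁ ⊓ U₂` both sheaves are locally free, which is what positive definiteness of the two
  -- metrics rests on.
  have hs₁ := hadm₁.singular
  have hs₂ := hadm₂.singular
  exact ⟨⟨⟨hH₁.coherent.tensor hH₂.coherent,
      Higgs.HiggsPair.fieldSquare_tensor hH₁.integrable hH₂.integrable⟩,
    ⟨Higgs.HermitianMetric.tensor h₁ h₂ hs₁ hs₂,
      Higgs.HermitianMetric.isTensorMetric_tensor h₁ h₂ hs₁ hs₂,
      fun _ hh => Higgs.IsTensorMetric.unique hh
        (Higgs.HermitianMetric.isTensorMetric_tensor h₁ h₂ hs₁ hs₂)⟩,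
    fun _ hh => Higgs.IsTensorMetric.isAdmissible hh hH₁.coherent hH₂.coherent hadm₁ hadm₂⟩,
    ⟨hH₁.coherent.directSum hH₂.coherent,
      Higgs.HiggsPair.fieldSquare_directSum hH₁.integrable hH₂.integrable⟩,
    ⟨Higgs.HermitianMetric.directSum h₁ h₂ hs₁ hs₂,
      Higgs.HermitianMetric.isSumMetric_directSum h₁ h₂ hs₁ hs₂,
      fun _ hh => Higgs.IsSumMetric.unique hh
        (Higgs.HermitianMetric.isSumMetric_directSum h₁ h₂ hs₁ hs₂)⟩,
    fun _ hh => Higgs.IsSumMetric.isAdmissible hh hadm₁ hadm₂⟩
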